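/- **Conventions.** 2-categories are strict. For a 2-category $\mathcal L$ and a class $\mathcal S$ of its morphisms, $\mathcal L_{\mathcal S}$ denotes the 2-category obtained from $\mathcal L$ by freely adjoining a right adjoint $\mu^\dagger$ to every $\mu\in\mathcal S$, and $\mathcal L_{\mathrm{all}}$ the one obtained by adjoining a right adjoint to every morphism. An *adjoint mode theory* is a 2-category with four classes of morphisms, *tangible*, *sharp*, *transparent* and *sinister*, such that identities are transparent and sharp, $\varrho\circ\mu$ is tangible if $\mu$ is sharp and $\varrho$ is transparent, and every sinister $\mu$ has a chosen right adjoint $\mu^\dagger$. We regard $\mathcal L_{\mathcal S}$ as an adjoint mode theory whose transparent morphisms are those of $\mathcal L$, whose sinister morphisms are those of $\mathcal S$, and whose tangible and sharp morphisms are those isomorphic to some $\mu\circ\nu^\dagger$, where $\mu$ is in $\mathcal L$ and $\nu$ is in $\mathcal S$ or is an identity. A *modal context structure* over $\mathcal K$ is a 2-functor $\mathcal D:\mathcal K^{\mathrm{coop}}\to\mathrm{Cat}$, with actions $\mathcal D^\mu:\mathcal D_q\to\mathcal D_p$ for $\mu:p\to q$, such that each $\mathcal D_p$ has a terminal object. A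 *natural pseudo-model* on a category $\mathcal C$ is a representable strict natural transformation $\tau:\mathrm{Tm}\to\mathrm{Ty}$ with discrete fibers between groupoid-valued pseudofunctors on $\mathcal C^{\mathrm{op}}$; so every $A\in\mathrm{Ty}(\Gamma)$ has a comprehension $\mathsf p_A:\Gamma.A\to\Gamma$, called a type projection. Its *left adjoint splitting* is the morphism of presheaves $\tau^!:\mathrm{Tm}^!\to\mathrm{Ty}^!$, where an element of $\mathrm{Ty}^!(\Gamma)$ is an object $V$, a type $E\in\mathrm{Ty}(V)$ and a morphism $\Gamma\to V$; an element of $\mathrm{Tm}^!(\Gamma)$ is an object $V$, a type $E\in\mathrm{Ty}(V)$ and a morphism $\Gamma\to V.E$; and $\tau^!$ composes with $\mathsf p_E$. A *modal pre-model* over $\mathcal K$ is a pseudofunctor $\mathcal C:\mathcal K\to\mathrm{Cat}$, with actions $\mathcal C_\mu:\mathcal C_p\to\mathcal C_q$, together with a natural pseudo-model $\tau_p$ on each $\mathcal C_p$. An *adjoint modal pre-model* $(\widehat{\mathcal C},\mathcal C)$ over $(\mathcal L,\mathcal S)$ consists of: a modal context structure $\widehat{\mathcal C}$ over $\mathcal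 L_{\mathrm{all}}$ with each $\widehat{\mathcal C}_p$ locally cartesian closed; a modal pre-model $\mathcal C$ over $\mathcal L_{\mathcal S}$; and functors $\mathsf L_p:\widehat{\mathcal C}_p\to\mathcal C_p$ that are pseudonatural in $p\in\mathcal L$, where $\mu:p\to q$ in $\mathcal L$ acts by $\widehat{\mathcal C}_\mu:=\widehat{\mathcal C}^{\mu^\dagger}$ on the source and by $\mathcal C_\mu$ on the target, and such that each $\mathsf L_p$ preserves finite limits and has a fully faithful right adjoint. Over $\mathcal L_{\mathcal S}$ the modal context structure $\widehat{\mathcal C}$ carries the morphisms of presheaves $\widehat\tau^!_p:=\mathsf L_p^*(\tau_p^!)$. **Pre-structures on $\mathcal C$.** In a natural pseudo-model, a morphism $\delta:\Gamma\to\Delta$ is *type-exponentiable* if, for every $B\in\mathrm{Ty}(\Gamma)$, some type projection over $\Delta$ is a pushforward of $\mathsf p_B$ along $\delta$. A morphism $f:\Gamma\to\Delta$ is *anodyne* if, for every $B\in\mathrm{Ty}(\Delta)$ and $g:\Gamma\to\Delta.B$ with $\mathsf p_B g=f$, there is a section $s$ of $\mathsf p_B$ with $sf=g$; it is *stably anodyne*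 if all its pullbacks are anodyne. The modal pre-model $\mathcal C$ has * *pre-$\Pi$-structure* if for all sharp $\mu:p\to q$ and $A\in\mathrm{Ty}_p(\Gamma)$, every pullback of $\mathcal C_\mu\mathsf p_A$ is type-exponentiable; * *positive pre-modalities* if for all sharp $\mu:p\to q$ and $A\in\mathrm{Ty}_p(\Gamma)$, there are $F\in\mathrm{Ty}_q(\mathcal C_\mu\Gamma)$ and a map $i:\mathcal C_\mu(\Gamma.A)\to(\mathcal C_\mu\Gamma).F$ over $\mathcal C_\mu\Gamma$ such that $\mathcal C_\varrho(i)$ is stably anodyne for every transparent $\varrho:q\to r$; * *negative pre-modalities* if for all sinister $\mu:p\to q$ and $A\in\mathrm{Ty}_q(\Gamma)$, there is $U\in\mathrm{Ty}_p(\mathcal C_{\mu^\dagger}\Gamma)$ with $(\mathcal C_{\mu^\dagger}\Gamma).U\cong\mathcal C_{\mu^\dagger}(\Gamma.A)$ over $\mathcal C_{\mu^\dagger}\Gamma$. **Models of MATT.** Let $\mathcal D$ be a modal context structure over an adjoint mode theory $\mathcal K$, with a morphism of presheaves $\tau_p:\mathrm{Tm}_p\to\mathrm{Ty}_p$ on each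 $\mathcal D_p$. We say that $(\mathcal D,\tau)$ *models MATT over $\mathcal K$* if the following hold. 1. $(\mathcal D^\mu)^*\tau_p$ is representable for every tangible $\mu:p\to q$ (that is, $(\mathcal D,\tau)$ is an *adjoint modal natural model*). For $\Gamma\in\mathcal D_q$ and $A\in\mathrm{Ty}_p(\mathcal D^\mu\Gamma)$, let $\Gamma.^\mu A\to\Gamma$ denote the comprehension, and write $\Gamma.A$ if $\mu$ is an identity. 2. ($\Pi$-structure.) For $\mu:p\to q$ sharp, $A\in\mathrm{Ty}_p(\mathcal D^\mu\Gamma)$ and $B\in\mathrm{Ty}_q(\Gamma.^\mu A)$, there is a chosen $\Pi(A,B)\in\mathrm{Ty}_q(\Gamma)$ such that $\Gamma.\Pi(A,B)$ is a pushforward of $(\Gamma.^\mu A).B$ along $\Gamma.^\mu A\to\Gamma$, all naturally in $\Gamma$. 3. (Positive modalities.) For $\mu:p\to q$ sharp and $A\in\mathrm{Ty}_p(\mathcal D^\mu\Gamma)$, there are a chosen $F_\mu A\in\mathrm{Ty}_q(\Gamma)$ and map $j:\Gamma.^\mu A\to\Gamma.F_\mu A$ over $\Gamma$, naturally in $\Gamma$.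 Moreover, for $\varrho:q\to r$ transparent, $\Gamma\in\mathcal D_r$ and $A\in\mathrm{Ty}_p(\mathcal D^{\varrho\circ\mu}\Gamma)$, let $\ell:\Gamma.^{\varrho\circ\mu}A\to\Gamma.^{\varrho}(F_\mu A)$ be the map over $\Gamma$ obtained by applying $j$ to the generic term. Then for every $B\in\mathrm{Ty}_r(\Gamma.^\varrho(F_\mu A))$ and $g:\Gamma.^{\varrho\circ\mu}A\to\Gamma.^{\varrho}(F_\mu A).B$ with $\mathsf p_B g=\ell$, there is a chosen section $s$ of $\mathsf p_B$ with $s\ell=g$, naturally in $\Gamma$. 4. (Negative modalities.) For every sinister $\mu:p\to q$, there is a pullback square of presheaves on $\mathcal D_p$ that exhibits $(\mathcal D^{\mu^\dagger})^*\tau_q$ as a pullback of $\tau_p$ along a morphism $(\mathcal D^{\mu^\dagger})^*\mathrm{Ty}_q\to\mathrm{Ty}_p$. **Theorem.** Let $\mathcal L$ be a 2-category with a class $\mathcal S$ of morphisms, and let $(\widehat{\mathcal C},\mathcal C)$ be an adjoint modal pre-model over $(\mathcal L,\mathcal S)$ such that $\mathcal C$ has pre-$\Pi$-structure, positive pre-modalities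 and negative pre-modalities over $\mathcal L_{\mathcal S}$. Then $(\widehat{\mathcal C},\widehat\tau^!)$ models MATT over $\mathcal L_{\mathcal S}$. -/

import Mathlib

open CategoryTheory Bicategory Opposite Limits

universe w v u w₁ v₁ u₁ w₂ v₂ u₂

/-- The 2-category `B^coop`: both the 1-cells and the 2-cells of `B` are reversed. -/
structure Coop (B : Type u) where
  /-- the underlying object -/
  unop : B

namespace Coop

variable {B : Type u} [Bicategory.{w, v} B]

/-- 1-cells `a ⟶ b` of `B^coop` are 1-cells `b ⟶ a` of `B`. -/
structure Hom (a b : Coop B) where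
  /-- the underlying 1-cell -/
  unop1 : b.unop ⟶ a.unop

instance : CategoryStruct (Coop B) where
  Hom a b := Hom a b
  id a := ⟨𝟙 a.unop⟩
  comp f g := ⟨g.unop1 ≫ f.unop1⟩

/-- 2-cells `f ⟶ g` of `B^coop` are 2-cells `g ⟶ f` of `B`. -/
@[ext]
structure Hom₂ {a b : Coop B} (f g : a ⟶ b) where
  /-- the underlying 2-cell -/
  unop2 : g.unop1 ⟶ f.unop1

@[simps]
instance homCategory (a b : Coop B) : Category (a ⟶ b) where
  Hom f g := Hom₂ f g
  id f := ⟨𝟙 f.unop1⟩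
  comp η θ := ⟨θ.unop2 ≫ η.unop2⟩

@[ext]
theorem hom₂_ext {a b : Coop B} {f g : a ⟶ b} {η θ : f ⟶ g} (h : η.unop2 = θ.unop2) : η = θ :=
  Hom₂.ext h

@[simp] theorem id_unop1 (a : Coop B) : (𝟙 a : a ⟶ a).unop1 = 𝟙 a.unop := rfl

@[simp] theorem comp_unop1 {a b c : Coop B} (f : a ⟶ b) (g : b ⟶ c) :
    (f ≫ g).unop1 = g.unop1 ≫ f.unop1 := rfl

/-- An invertible 2-cell of `B` gives an invertible 2-cell of `B^coop`. -/
@[simps]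
def isoMk {a b : Coop B} {f g : a ⟶ b} (e : g.unop1 ≅ f.unop1) : f ≅ g where
  hom := ⟨e.hom⟩
  inv := ⟨e.inv⟩

@[simps! whiskerLeft_unop2 whiskerRight_unop2 associator_hom_unop2 associator_inv_unop2
  leftUnitor_hom_unop2 leftUnitor_inv_unop2 rightUnitor_hom_unop2 rightUnitor_inv_unop2]
instance bicategory : Bicategory.{w, v} (Coop B) where
  homCategory := homCategory
  whiskerLeft f _ _ η := ⟨η.unop2 ▷ f.unop1⟩
  whiskerRight η h := ⟨h.unop1 ◁ η.unop2⟩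
  associator f g h := isoMk (α_ h.unop1 g.unop1 f.unop1)
  leftUnitor f := isoMk (ρ_ f.unop1).symm
  rightUnitor f := isoMk (λ_ f.unop1).symm
  whisker_exchange η θ := by ext; simp [whisker_exchange]

end Coop

namespace Coop

variable {B : Type u} [Bicategory.{w, v} B]

theorem hom_ext {a b : Coop B} {f g : a ⟶ b} (h : f.unop1 = g.unop1) : f = g := by
  exact congrArg Hom.mk h

theorem eqToHom_unop2 {a b : Coop B} {f g : a ⟶ b} (h : f = g) :
    (eqToHom h).unop2 = eqToHom (congrArg Hom.unop1 h.symm) := by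
  subst h; rfl

instance strict [Strict B] : Strict (Coop B) where
  id_comp f := hom_ext (Strict.comp_id f.unop1)
  comp_id f := hom_ext (Strict.id_comp f.unop1)
  assoc f g h := hom_ext (Strict.assoc h.unop1 g.unop1 f.unop1).symm
  leftUnitor_eqToIso f := by
    ext; simp [Strict.rightUnitor_eqToIso, eqToHom_unop2]
  rightUnitor_eqToIso f := by
    ext; simp [Strict.leftUnitor_eqToIso, eqToHom_unop2]
  associator_eqToIso f g h := by
    ext; simp [Strict.associator_eqToIso, eqToHom_unop2]

/-- The action of a strict 2-functor on `coop` duals. -/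
def mapStrict {C : Type u₁} [Bicategory.{w₁, v₁} C] [Strict B] [Strict C]
    (F : StrictPseudofunctor B C) : StrictPseudofunctor (Coop B) (Coop C) :=
  StrictPseudofunctor.mk''
    { obj := fun a => ⟨F.obj a.unop⟩
      map := fun f => ⟨F.map f.unop1⟩
      map₂ := fun η => ⟨F.map₂ η.unop2⟩
      map₂_id := fun f => by ext; simp
      map₂_comp := fun η θ => by ext; simp
      map_id := fun a => hom_ext (F.map_id a.unop)
      map_comp := fun f g => hom_ext (F.map_comp g.unop1 f.unop1)
      map₂_whisker_left := fun f _ _ η => by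
        ext
        simp [eqToHom_unop2, F.mapComp_eq_eqToIso]
      map₂_whisker_right := fun η g => by
        ext
        simp [eqToHom_unop2, F.mapComp_eq_eqToIso] }

end Coop

/-- The pseudofunctor sending an adjunction to its right adjoint; both 1-cells and 2-cells
are reversed. -/
def adjForgetRight (B : Type u) [Bicategory.{w, v} B] : Pseudofunctor (Adj B) (Coop B) where
  obj a := ⟨a.obj⟩
  map x := ⟨x.r⟩
  map₂ α := ⟨α.τr⟩
  mapId _ := Iso.refl _
  mapComp _ _ := Iso.refl _

/-- Two adjunctions with isomorphic left adjoints are isomorphic in the bicategory of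
adjunctions. -/
@[simps! hom_τl inv_τl]
def adjIsoOfLeft {B : Type u} [Bicategory.{w, v} B] {a b : Adj B} {x y : a ⟶ b} (e : x.l ≅ y.l) :
    x ≅ y :=
  Adj.iso₂Mk e (conjugateIsoEquiv y.adj x.adj e) rfl

/-- If `F` sends every 1-cell to a left adjoint, then `F` lifts to the bicategory of adjunctions,
a 2-cell being sent to itself together with its mate. -/
def toAdj {B : Type u} [Bicategory.{w, v} B] {C : Type u₁} [Bicategory.{w₁, v₁} C]
    (F : Pseudofunctor B C) (r : ∀ {a b : B}, (a ⟶ b) → (F.obj b ⟶ F.obj a))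
    (adj : ∀ {a b : B} (f : a ⟶ b), F.map f ⊣ r f) : Pseudofunctor B (Adj C) where
  obj a := ⟨F.obj a⟩
  map f := ⟨adj f⟩
  map₂ {_ _ f g} η := ⟨F.map₂ η, conjugateEquiv (adj g) (adj f) (F.map₂ η), rfl⟩
  map₂_id f := by ext; simp
  map₂_comp η θ := by ext; simp
  mapId a := adjIsoOfLeft (F.mapId a)
  mapComp f g := adjIsoOfLeft (F.mapComp f g)
  map₂_whisker_left f _ _ η := by ext; simp
  map₂_whisker_right η g := by ext; simp
  map₂_associator f g h := by ext; simp
  map₂_left_unitor f := by ext; simp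
  map₂_right_unitor f := by ext; simp

/-- The 2-category obtained from a strict 2-category `L` by freely adjoining a right adjoint to
every 1-cell in the class `S`. It has the same objects as `L`. -/
structure FreeAdj (L : Type u) [Bicategory.{w, v} L] (S : MorphismProperty L) where
  /-- the underlying object -/
  base : L

namespace FreeAdj

variable {L : Type u} [Bicategory.{w, v} L] {S : MorphismProperty L}

/-- Formal composites of 1-cells of `L` and of formal right adjoints of 1-cells in `S`. -/
inductive Word (S : MorphismProperty L) : L → L → Type max u v
  | of {p q : L} (μ : p ⟶ q) : Word S p q
  | dag {p q : L} (μ : p ⟶ q) (hμ : S μ) : Word S q p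
  | id (p : L) : Word S p p
  | comp {p q r : L} (f : Word S p q) (g : Word S q r) : Word S p r

/-- The relations on formal composites: the laws of a category, and the requirement that the
inclusion of `L` preserves identities and composition strictly. -/
inductive WordRel : ∀ {p q : L}, Word S p q → Word S p q → Prop
  | comp_left {p q r : L} {f f' : Word S p q} (g : Word S q r) :
      WordRel f f' → WordRel (f.comp g) (f'.comp g)
  | comp_right {p q r : L} (f : Word S p q) {g g' : Word S q r} :
      WordRel g g' → WordRel (f.comp g) (f.comp g')
  | id_comp {p q : L} (f : Word S p q) : WordRel ((Word.id p).comp f) f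
  | comp_id {p q : L} (f : Word S p q) : WordRel (f.comp (Word.id q)) f
  | assoc {p q r s : L} (f : Word S p q) (g : Word S q r) (h : Word S r s) :
      WordRel ((f.comp g).comp h) (f.comp (g.comp h))
  | of_id (p : L) : WordRel (Word.of (𝟙 p)) (Word.id p)
  | of_comp {p q r : L} (μ : p ⟶ q) (ν : q ⟶ r) :
      WordRel (Word.of (μ ≫ ν)) ((Word.of μ).comp (Word.of ν))

instance : CategoryStruct (FreeAdj L S) where
  Hom p q := Quot (@WordRel L _ S p.base q.base)
  id p := Quot.mk _ (Word.id p.base)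
  comp f g := Quot.map₂ Word.comp (fun f _ _ h => WordRel.comp_right f h)
    (fun _ _ g h => WordRel.comp_left g h) f g

theorem one_id_comp {p q : FreeAdj L S} (f : p ⟶ q) : 𝟙 p ≫ f = f := by
  induction f using Quot.ind
  exact Quot.sound (WordRel.id_comp _)

theorem one_comp_id {p q : FreeAdj L S} (f : p ⟶ q) : f ≫ 𝟙 q = f := by
  induction f using Quot.ind
  exact Quot.sound (WordRel.comp_id _)

theorem one_assoc {p q r s : FreeAdj L S} (f : p ⟶ q) (g : q ⟶ r) (h : r ⟶ s) :
    (f ≫ g) ≫ h = f ≫ g ≫ h := by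
  induction f using Quot.ind
  induction g using Quot.ind
  induction h using Quot.ind
  exact Quot.sound (WordRel.assoc _ _ _)

/-- The 1-cell of `FreeAdj L S` given by a 1-cell of `L`. -/
def inl₁ {p q : L} (μ : p ⟶ q) : (⟨p⟩ : FreeAdj L S) ⟶ ⟨q⟩ := Quot.mk _ (Word.of μ)

/-- The right adjoint adjoined to a 1-cell in `S`. -/
def dag {p q : L} (μ : p ⟶ q) (hμ : S μ) : (⟨q⟩ : FreeAdj L S) ⟶ ⟨p⟩ := Quot.mk _ (Word.dag μ hμ)

theorem inl₁_id (p : L) : (inl₁ (𝟙 p) : (⟨p⟩ : FreeAdj L S) ⟶ ⟨p⟩) = 𝟙 _ :=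
  Quot.sound (WordRel.of_id p)

theorem inl₁_comp {p q r : L} (μ : p ⟶ q) (ν : q ⟶ r) :
    (inl₁ (μ ≫ ν) : (⟨p⟩ : FreeAdj L S) ⟶ ⟨r⟩) = inl₁ μ ≫ inl₁ ν :=
  Quot.sound (WordRel.of_comp μ ν)

/-- Formal 2-cells: they are generated by the 2-cells of `L`, the units and counits of the adjoined
adjunctions, and identities between equal 1-cells, under vertical composition and whiskering. -/
inductive Cell : ∀ {p q : FreeAdj L S}, (p ⟶ q) → (p ⟶ q) → Type max u v w
  | eqTo {p q : FreeAdj L S} {f g : p ⟶ q} (h : f = g) : Cell f g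
  | vcomp {p q : FreeAdj L S} {f g h : p ⟶ q} (η : Cell f g) (θ : Cell g h) : Cell f h
  | whiskerLeft {p q r : FreeAdj L S} (f : p ⟶ q) {g h : q ⟶ r} (η : Cell g h) :
      Cell (f ≫ g) (f ≫ h)
  | whiskerRight {p q r : FreeAdj L S} {f g : p ⟶ q} (η : Cell f g) (h : q ⟶ r) :
      Cell (f ≫ h) (g ≫ h)
  | of {p q : L} {μ ν : p ⟶ q} (α : μ ⟶ ν) :
      Cell (inl₁ μ : (⟨p⟩ : FreeAdj L S) ⟶ ⟨q⟩) (inl₁ ν)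
  | unit {p q : L} (μ : p ⟶ q) (hμ : S μ) :
      Cell (𝟙 (⟨p⟩ : FreeAdj L S)) (inl₁ μ ≫ dag μ hμ)
  | counit {p q : L} (μ : p ⟶ q) (hμ : S μ) :
      Cell (dag μ hμ ≫ inl₁ μ) (𝟙 (⟨q⟩ : FreeAdj L S))

open Cell in
/-- The relations on formal 2-cells: the laws of a strict 2-category, the requirement that the
inclusion of `L` is a strict 2-functor, and the triangle identities. -/
inductive CellRel : ∀ {p q : FreeAdj L S} {f g : p ⟶ q}, Cell f g → Cell f g → Prop
  | vcomp_left {p q : FreeAdj L S} {f g h : p ⟶ q} {η η' : Cell f g} (θ : Cell g h) :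
      CellRel η η' → CellRel (vcomp η θ) (vcomp η' θ)
  | vcomp_right {p q : FreeAdj L S} {f g h : p ⟶ q} (η : Cell f g) {θ θ' : Cell g h} :
      CellRel θ θ' → CellRel (vcomp η θ) (vcomp η θ')
  | whiskerLeft {p q r : FreeAdj L S} (f : p ⟶ q) {g h : q ⟶ r} {η η' : Cell g h} :
      CellRel η η' → CellRel (whiskerLeft f η) (whiskerLeft f η')
  | whiskerRight {p q r : FreeAdj L S} {f g : p ⟶ q} {η η' : Cell f g} (h : q ⟶ r) :
      CellRel η η' → CellRel (whiskerRight η h) (whiskerRight η' h)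
  | id_vcomp {p q : FreeAdj L S} {f g : p ⟶ q} (η : Cell f g) : CellRel (vcomp (eqTo rfl) η) η
  | vcomp_id {p q : FreeAdj L S} {f g : p ⟶ q} (η : Cell f g) : CellRel (vcomp η (eqTo rfl)) η
  | assoc {p q : FreeAdj L S} {f g h i : p ⟶ q} (η : Cell f g) (θ : Cell g h) (ι : Cell h i) :
      CellRel (vcomp (vcomp η θ) ι) (vcomp η (vcomp θ ι))
  | whiskerLeft_id {p q r : FreeAdj L S} (f : p ⟶ q) (g : q ⟶ r) :
      CellRel (whiskerLeft f (eqTo (rfl : g = g))) (eqTo rfl)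
  | whiskerLeft_vcomp {p q r : FreeAdj L S} (f : p ⟶ q) {g h i : q ⟶ r} (η : Cell g h)
      (θ : Cell h i) :
      CellRel (whiskerLeft f (vcomp η θ)) (vcomp (whiskerLeft f η) (whiskerLeft f θ))
  | id_whiskerLeft {p q : FreeAdj L S} {f g : p ⟶ q} (η : Cell f g) :
      CellRel (whiskerLeft (𝟙 p) η)
        (vcomp (eqTo (one_id_comp f)) (vcomp η (eqTo (one_id_comp g).symm)))
  | comp_whiskerLeft {p q r s : FreeAdj L S} (f : p ⟶ q) (g : q ⟶ r) {h h' : r ⟶ s}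
      (η : Cell h h') :
      CellRel (whiskerLeft (f ≫ g) η) (vcomp (eqTo (one_assoc f g h))
        (vcomp (whiskerLeft f (whiskerLeft g η)) (eqTo (one_assoc f g h').symm)))
  | id_whiskerRight {p q r : FreeAdj L S} (f : p ⟶ q) (g : q ⟶ r) :
      CellRel (whiskerRight (eqTo (rfl : f = f)) g) (eqTo rfl)
  | vcomp_whiskerRight {p q r : FreeAdj L S} {f g h : p ⟶ q} (η : Cell f g) (θ : Cell g h)
      (i : q ⟶ r) :
      CellRel (whiskerRight (vcomp η θ) i) (vcomp (whiskerRight η i) (whiskerRight θ i))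
  | whiskerRight_id {p q : FreeAdj L S} {f g : p ⟶ q} (η : Cell f g) :
      CellRel (whiskerRight η (𝟙 q))
        (vcomp (eqTo (one_comp_id f)) (vcomp η (eqTo (one_comp_id g).symm)))
  | whiskerRight_comp {p q r s : FreeAdj L S} {f f' : p ⟶ q} (η : Cell f f') (g : q ⟶ r)
      (h : r ⟶ s) :
      CellRel (whiskerRight η (g ≫ h)) (vcomp (eqTo (one_assoc f g h).symm)
        (vcomp (whiskerRight (whiskerRight η g) h) (eqTo (one_assoc f' g h))))
  | whisker_assoc {p q r s : FreeAdj L S} (f : p ⟶ q) {g g' : q ⟶ r} (η : Cell g g')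
      (h : r ⟶ s) :
      CellRel (whiskerRight (whiskerLeft f η) h) (vcomp (eqTo (one_assoc f g h))
        (vcomp (whiskerLeft f (whiskerRight η h)) (eqTo (one_assoc f g' h).symm)))
  | whisker_exchange {p q r : FreeAdj L S} {f g : p ⟶ q} {h i : q ⟶ r} (η : Cell f g)
      (θ : Cell h i) :
      CellRel (vcomp (whiskerLeft f θ) (whiskerRight η i))
        (vcomp (whiskerRight η h) (whiskerLeft g θ))
  | of_id {p q : L} (μ : p ⟶ q) :
      CellRel (of (𝟙 μ)) (eqTo (rfl : (inl₁ μ : (⟨p⟩ : FreeAdj L S) ⟶ ⟨q⟩) = inl₁ μ))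
  | of_comp {p q : L} {μ ν π : p ⟶ q} (α : μ ⟶ ν) (β : ν ⟶ π) :
      CellRel (of (α ≫ β)) (vcomp (of α) (of β))
  | of_whiskerLeft {p q r : L} (μ : p ⟶ q) {ν π : q ⟶ r} (α : ν ⟶ π) :
      CellRel (of (μ ◁ α)) (vcomp (eqTo (inl₁_comp μ ν))
        (vcomp (whiskerLeft (inl₁ μ) (of α)) (eqTo (inl₁_comp μ π).symm)))
  | of_whiskerRight {p q r : L} {μ ν : p ⟶ q} (α : μ ⟶ ν) (π : q ⟶ r) :
      CellRel (of (α ▷ π)) (vcomp (eqTo (inl₁_comp μ π))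
        (vcomp (whiskerRight (of α) (inl₁ π)) (eqTo (inl₁_comp ν π).symm)))
  | left_triangle {p q : L} (μ : p ⟶ q) (hμ : S μ) :
      CellRel (vcomp (whiskerRight (unit μ hμ) (inl₁ μ))
          (vcomp (eqTo (one_assoc _ _ _)) (whiskerLeft (inl₁ μ) (counit μ hμ))))
        (eqTo ((one_id_comp _).trans (one_comp_id _).symm))
  | right_triangle {p q : L} (μ : p ⟶ q) (hμ : S μ) :
      CellRel (vcomp (whiskerLeft (dag μ hμ) (unit μ hμ))
          (vcomp (eqTo (one_assoc _ _ _).symm) (whiskerRight (counit μ hμ) (dag μ hμ))))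
        (eqTo ((one_comp_id _).trans (one_id_comp _).symm))

instance homCategory (p q : FreeAdj L S) : Category (p ⟶ q) where
  Hom f g := Quot (@CellRel L _ S p q f g)
  id f := Quot.mk _ (Cell.eqTo rfl)
  comp η θ := Quot.map₂ Cell.vcomp (fun η _ _ h => CellRel.vcomp_right η h)
    (fun _ _ θ h => CellRel.vcomp_left θ h) η θ
  id_comp := by
    rintro f g ⟨η⟩
    exact Quot.sound (CellRel.id_vcomp η)
  comp_id := by
    rintro f g ⟨η⟩
    exact Quot.sound (CellRel.vcomp_id η)
  assoc := by
    rintro f g h i ⟨η⟩ ⟨θ⟩ ⟨ι⟩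
    exact Quot.sound (CellRel.assoc η θ ι)

theorem mk_eqTo {p q : FreeAdj L S} {f g : p ⟶ q} (h : f = g) :
    (Quot.mk _ (Cell.eqTo h) : f ⟶ g) = eqToHom h := by
  subst h; rfl

/-- Left whiskering. -/
def whiskerL {p q r : FreeAdj L S} (f : p ⟶ q) {g h : q ⟶ r} (η : g ⟶ h) : f ≫ g ⟶ f ≫ h :=
  Quot.map (Cell.whiskerLeft f) (fun _ _ h => CellRel.whiskerLeft f h) η

/-- Right whiskering. -/
def whiskerR {p q r : FreeAdj L S} {f g : p ⟶ q} (η : f ⟶ g) (h : q ⟶ r) : f ≫ h ⟶ g ≫ h :=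
  Quot.map (fun η => Cell.whiskerRight η h) (fun _ _ e => CellRel.whiskerRight h e) η

theorem whiskerL_eqToHom {p q r : FreeAdj L S} (f : p ⟶ q) {g h : q ⟶ r} (e : g = h) :
    whiskerL f (eqToHom e) = eqToHom (by rw [e]) := by
  subst e
  exact Quot.sound (CellRel.whiskerLeft_id f g)

theorem whiskerR_eqToHom {p q r : FreeAdj L S} {f g : p ⟶ q} (e : f = g) (h : q ⟶ r) :
    whiskerR (eqToHom e) h = eqToHom (by rw [e]) := by
  subst e
  exact Quot.sound (CellRel.id_whiskerRight f h)

instance bicategory : Bicategory (FreeAdj L S) where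
  homCategory := homCategory
  whiskerLeft f _ _ η := whiskerL f η
  whiskerRight η h := whiskerR η h
  associator f g h := eqToIso (one_assoc f g h)
  leftUnitor f := eqToIso (one_id_comp f)
  rightUnitor f := eqToIso (one_comp_id f)
  whiskerLeft_id f g := Quot.sound (CellRel.whiskerLeft_id f g)
  whiskerLeft_comp := by
    rintro p q r f g h i ⟨η⟩ ⟨θ⟩
    exact Quot.sound (CellRel.whiskerLeft_vcomp f η θ)
  id_whiskerLeft := by
    rintro p q f g ⟨η⟩
    rw [eqToIso.hom, eqToIso.inv, ← mk_eqTo, ← mk_eqTo]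
    exact Quot.sound (CellRel.id_whiskerLeft η)
  comp_whiskerLeft := by
    rintro p q r s f g h h' ⟨η⟩
    rw [eqToIso.hom, eqToIso.inv, ← mk_eqTo, ← mk_eqTo]
    exact Quot.sound (CellRel.comp_whiskerLeft f g η)
  id_whiskerRight f g := Quot.sound (CellRel.id_whiskerRight f g)
  comp_whiskerRight := by
    rintro p q r f g h ⟨η⟩ ⟨θ⟩ i
    exact Quot.sound (CellRel.vcomp_whiskerRight η θ i)
  whiskerRight_id := by
    rintro p q f g ⟨η⟩
    rw [eqToIso.hom, eqToIso.inv, ← mk_eqTo, ← mk_eqTo]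
    exact Quot.sound (CellRel.whiskerRight_id η)
  whiskerRight_comp := by
    rintro p q r s f f' ⟨η⟩ g h
    rw [eqToIso.hom, eqToIso.inv, ← mk_eqTo, ← mk_eqTo]
    exact Quot.sound (CellRel.whiskerRight_comp η g h)
  whisker_assoc := by
    rintro p q r s f g g' ⟨η⟩ h
    rw [eqToIso.hom, eqToIso.inv, ← mk_eqTo, ← mk_eqTo]
    exact Quot.sound (CellRel.whisker_assoc f η h)
  whisker_exchange := by
    rintro p q r f g h i ⟨η⟩ ⟨θ⟩
    exact Quot.sound (CellRel.whisker_exchange η θ)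
  pentagon f g h i := by
    simp [whiskerL_eqToHom, whiskerR_eqToHom]
  triangle f g := by
    simp [whiskerL_eqToHom, whiskerR_eqToHom]

instance strict : Strict (FreeAdj L S) where
  id_comp := one_id_comp
  comp_id := one_comp_id
  assoc := one_assoc

/-- The inclusion of `L`, a strict 2-functor. -/
def inl [Strict L] (S : MorphismProperty L) : StrictPseudofunctor L (FreeAdj L S) :=
  StrictPseudofunctor.mk''
    { obj := fun p => ⟨p⟩
      map := fun μ => inl₁ μ
      map₂ := fun α => Quot.mk _ (Cell.of α)
      map₂_id := fun μ => Quot.sound (CellRel.of_id μ)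
      map₂_comp := fun α β => Quot.sound (CellRel.of_comp α β)
      map_id := inl₁_id
      map_comp := inl₁_comp
      map₂_whisker_left := fun μ _ _ α => by
        rw [← mk_eqTo, ← mk_eqTo]
        exact Quot.sound (CellRel.of_whiskerLeft μ α)
      map₂_whisker_right := fun α π => by
        rw [← mk_eqTo, ← mk_eqTo]
        exact Quot.sound (CellRel.of_whiskerRight α π) }

/-- The adjunction adjoined to a 1-cell in `S`. -/
def adj {p q : L} (μ : p ⟶ q) (hμ : S μ) :
    (inl₁ μ : (⟨p⟩ : FreeAdj L S) ⟶ ⟨q⟩) ⊣ dag μ hμ where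
  unit := Quot.mk _ (Cell.unit μ hμ)
  counit := Quot.mk _ (Cell.counit μ hμ)
  left_triangle := by
    have h : (Quot.mk _ (Cell.unit μ hμ) : 𝟙 (⟨p⟩ : FreeAdj L S) ⟶ inl₁ μ ≫ dag μ hμ) ▷
        inl₁ μ ≫ (Quot.mk _ (Cell.eqTo (one_assoc _ _ _)) ≫ inl₁ μ ◁
          (Quot.mk _ (Cell.counit μ hμ) : dag μ hμ ≫ inl₁ μ ⟶ 𝟙 (⟨q⟩ : FreeAdj L S))) =
        Quot.mk _ (Cell.eqTo ((one_id_comp _).trans (one_comp_id _).symm)) :=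
      Quot.sound (CellRel.left_triangle μ hμ)
    rw [mk_eqTo, mk_eqTo] at h
    simpa [leftZigzag, bicategoricalComp, Strict.leftUnitor_eqToIso, Strict.rightUnitor_eqToIso,
      Strict.associator_eqToIso] using h
  right_triangle := by
    have h : dag μ hμ ◁
          (Quot.mk _ (Cell.unit μ hμ) : 𝟙 (⟨p⟩ : FreeAdj L S) ⟶ inl₁ μ ≫ dag μ hμ) ≫
        (Quot.mk _ (Cell.eqTo (one_assoc _ _ _).symm) ≫
          (Quot.mk _ (Cell.counit μ hμ) : dag μ hμ ≫ inl₁ μ ⟶ 𝟙 (⟨q⟩ : FreeAdj L S)) ▷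
            dag μ hμ) =
        Quot.mk _ (Cell.eqTo ((one_comp_id _).trans (one_id_comp _).symm)) :=
      Quot.sound (CellRel.right_triangle μ hμ)
    rw [mk_eqTo, mk_eqTo] at h
    simpa [rightZigzag, bicategoricalComp, Strict.leftUnitor_eqToIso, Strict.rightUnitor_eqToIso,
      Strict.associator_eqToIso] using h

section lift

variable [Strict L] {K : Type u₁} [Bicategory.{w₁, v₁} K] [Strict K]
  (G : StrictPseudofunctor L K)
  (r : ∀ {p q : L} (μ : p ⟶ q), S μ → (G.obj q ⟶ G.obj p))
  (a : ∀ {p q : L} (μ : p ⟶ q) (hμ : S μ), G.map μ ⊣ r μ hμ)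

/-- The action of `lift` on formal 1-cells. -/
def liftWord : ∀ {p q : L}, Word S p q → (G.obj p ⟶ G.obj q)
  | _, _, .of μ => G.map μ
  | _, _, .dag μ hμ => r μ hμ
  | _, _, .id p => 𝟙 (G.obj p)
  | _, _, .comp f g => liftWord f ≫ liftWord g

theorem liftWord_rel {p q : L} {f g : Word S p q} (h : WordRel f g) :
    liftWord G r f = liftWord G r g := by
  induction h with
  | comp_left g _ ih => exact congrArg (· ≫ liftWord G r g) ih
  | comp_right f _ ih => exact congrArg (liftWord G r f ≫ ·) ih
  | id_comp f => exact Strict.id_comp _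
  | comp_id f => exact Strict.comp_id _
  | assoc f g h => exact Strict.assoc _ _ _
  | of_id p => exact G.map_id p
  | of_comp μ ν => exact G.map_comp μ ν

/-- The action of `lift` on 1-cells. -/
def lift₁ {p q : FreeAdj L S} (f : p ⟶ q) : G.obj p.base ⟶ G.obj q.base :=
  Quot.lift (liftWord G r) (fun _ _ h => liftWord_rel G r h) f

theorem lift₁_id (p : FreeAdj L S) : lift₁ G r (𝟙 p) = 𝟙 (G.obj p.base) := rfl

theorem lift₁_comp {p q s : FreeAdj L S} (f : p ⟶ q) (g : q ⟶ s) :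
    lift₁ G r (f ≫ g) = lift₁ G r f ≫ lift₁ G r g := by
  induction f using Quot.ind
  induction g using Quot.ind
  rfl

/-- The action of `lift` on formal 2-cells. -/
def liftCell : ∀ {p q : FreeAdj L S} {f g : p ⟶ q}, Cell f g → (lift₁ G r f ⟶ lift₁ G r g)
  | _, _, _, _, .eqTo h => eqToHom (congrArg (lift₁ G r) h)
  | _, _, _, _, .vcomp η θ => liftCell η ≫ liftCell θ
  | _, _, _, _, .whiskerLeft f (g := g) (h := h) η =>
      eqToHom (lift₁_comp G r f g) ≫ lift₁ G r f ◁ liftCell η ≫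
        eqToHom (lift₁_comp G r f h).symm
  | _, _, _, _, .whiskerRight (f := f) (g := g) η h =>
      eqToHom (lift₁_comp G r f h) ≫ liftCell η ▷ lift₁ G r h ≫
        eqToHom (lift₁_comp G r g h).symm
  | _, _, _, _, .of α => G.map₂ α
  | _, _, _, _, .unit μ hμ => (a μ hμ).unit
  | _, _, _, _, .counit μ hμ => (a μ hμ).counit

theorem whiskerLeft_congr {a b c : K} {f f' : a ⟶ b} (e : f = f') {g h : b ⟶ c} (η : g ⟶ h) :
    f ◁ η = eqToHom (by rw [e]) ≫ f' ◁ η ≫ eqToHom (by rw [e]) := by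
  subst e; simp

theorem whiskerRight_congr {a b c : K} {f g : a ⟶ b} (η : f ⟶ g) {h h' : b ⟶ c} (e : h = h') :
    η ▷ h = eqToHom (by rw [e]) ≫ η ▷ h' ≫ eqToHom (by rw [e]) := by
  subst e; simp

theorem liftCell_rel {p q : FreeAdj L S} {f g : p ⟶ q} {η θ : Cell f g} (h : CellRel η θ) :
    liftCell G r a η = liftCell G r a θ := by
  induction h with
  | vcomp_left θ _ ih => simp only [liftCell, ih]
  | vcomp_right η _ ih => simp only [liftCell, ih]
  | whiskerLeft f _ ih => simp only [liftCell, ih]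
  | whiskerRight h _ ih => simp only [liftCell, ih]
  | id_vcomp η => simp [liftCell]
  | vcomp_id η => simp [liftCell]
  | assoc η θ ι => simp [liftCell]
  | whiskerLeft_id f g => simp [liftCell]
  | whiskerLeft_vcomp f η θ => simp [liftCell]
  | id_whiskerLeft η =>
    simp [liftCell, whiskerLeft_congr (lift₁_id G r _), Strict.leftUnitor_eqToIso]
  | comp_whiskerLeft f g η =>
    simp [liftCell, whiskerLeft_congr (lift₁_comp G r f g), Strict.associator_eqToIso]
  | id_whiskerRight f g => simp [liftCell]
  | vcomp_whiskerRight η θ i => simp [liftCell]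
  | whiskerRight_id η =>
    simp [liftCell, whiskerRight_congr _ (lift₁_id G r _), Strict.rightUnitor_eqToIso]
  | whiskerRight_comp η g h =>
    simp [liftCell, whiskerRight_congr _ (lift₁_comp G r g h), Strict.associator_eqToIso]
  | whisker_assoc f η h =>
    simp [liftCell, Strict.associator_eqToIso]
  | whisker_exchange η θ =>
    simp [liftCell, whisker_exchange_assoc]
  | of_id μ => simp [liftCell]; rfl
  | of_comp α β => simp [liftCell]; rfl
  | of_whiskerLeft μ α =>
    simp [liftCell, G.mapComp_eq_eqToIso]
    rfl
  | of_whiskerRight α π =>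
    simp [liftCell, G.mapComp_eq_eqToIso]
    rfl
  | left_triangle μ hμ =>
    have h := (a μ hμ).left_triangle
    simp [leftZigzag, bicategoricalComp, Strict.leftUnitor_eqToIso, Strict.rightUnitor_eqToIso,
      Strict.associator_eqToIso] at h
    simp only [liftCell, Category.assoc]
    refine Eq.trans ?_ h
    change 𝟙 _ ≫ (a μ hμ).unit ▷ G.map μ ≫ 𝟙 _ ≫ eqToHom _ ≫ 𝟙 _ ≫
      G.map μ ◁ (a μ hμ).counit ≫ 𝟙 _ = _
    simp
  | right_triangle μ hμ =>
    have h := (a μ hμ).right_triangle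
    simp [rightZigzag, bicategoricalComp, Strict.leftUnitor_eqToIso, Strict.rightUnitor_eqToIso,
      Strict.associator_eqToIso] at h
    simp only [liftCell, Category.assoc]
    refine Eq.trans ?_ h
    change 𝟙 _ ≫ r μ hμ ◁ (a μ hμ).unit ≫ 𝟙 _ ≫ eqToHom _ ≫ 𝟙 _ ≫
      (a μ hμ).counit ▷ r μ hμ ≫ 𝟙 _ = _
    simp

/-- The universal property of `FreeAdj L S`: a strict 2-functor on `L`, together with an
adjunction for the image of every 1-cell in `S`, extends to a strict 2-functor on
`FreeAdj L S`. -/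
def lift : StrictPseudofunctor (FreeAdj L S) K :=
  StrictPseudofunctor.mk''
    { obj := fun p => G.obj p.base
      map := fun f => lift₁ G r f
      map₂ := fun η => Quot.lift (liftCell G r a) (fun _ _ h => liftCell_rel G r a h) η
      map₂_id := fun f => rfl
      map₂_comp := by
        rintro _ _ _ _ _ ⟨η⟩ ⟨θ⟩
        rfl
      map_id := fun p => lift₁_id G r p
      map_comp := fun f g => lift₁_comp G r f g
      map₂_whisker_left := by
        rintro _ _ _ f _ _ ⟨η⟩
        rfl
      map₂_whisker_right := by
        rintro _ _ _ _ _ ⟨η⟩ h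
        rfl }

end lift

/-- The comparison 2-functor for two classes `S ≤ T` of 1-cells: it is the identity on `L` and
preserves the adjoined right adjoints. -/
def map [Strict L] {S T : MorphismProperty L} (h : S ≤ T) :
    StrictPseudofunctor (FreeAdj L S) (FreeAdj L T) :=
  lift (inl T) (fun μ hμ => dag μ (h μ hμ)) (fun μ hμ => adj μ (h μ hμ))

end FreeAdj
/-- An adjoint mode theory on a 2-category `K`: four classes of 1-cells such that identities are
transparent and sharp, the composite of a sharp 1-cell followed by a transparent one is tangible,
and every sinister 1-cell has a (chosen) right adjoint. -/
structure AdjointModeTheory (K : Type u) [Bicategory.{w, v} K] where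
  /-- the tangible 1-cells -/
  tangible : MorphismProperty K
  /-- the sharp 1-cells -/
  sharp : MorphismProperty K
  /-- the transparent 1-cells -/
  transparent : MorphismProperty K
  /-- the sinister 1-cells -/
  sinister : MorphismProperty K
  transparent_id (p : K) : transparent (𝟙 p)
  sharp_id (p : K) : sharp (𝟙 p)
  tangible_comp {p q r : K} (μ : p ⟶ q) (ϱ : q ⟶ r) :
    sharp μ → transparent ϱ → tangible (μ ≫ ϱ)
  /-- the right adjoint of a sinister 1-cell -/
  dagger {p q : K} (μ : p ⟶ q) (hμ : sinister μ) : q ⟶ p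
  /-- the adjunction between a sinister 1-cell and its right adjoint -/
  daggerAdj {p q : K} (μ : p ⟶ q) (hμ : sinister μ) : μ ⊣ dagger μ hμ

namespace AdjointModeTheory

variable {K : Type u} [Bicategory.{w, v} K] [Strict K] (M : AdjointModeTheory K)

theorem tangible_of_sharp {p q : K} {μ : p ⟶ q} (h : M.sharp μ) : M.tangible μ := by
  have := M.tangible_comp μ (𝟙 q) h (M.transparent_id q)
  rwa [Strict.comp_id] at this

theorem tangible_of_transparent {p q : K} {ϱ : p ⟶ q} (h : M.transparent ϱ) : M.tangible ϱ := by
  have := M.tangible_comp (𝟙 p) ϱ (M.sharp_id p) h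
  rwa [Strict.id_comp] at this

theorem tangible_id (p : K) : M.tangible (𝟙 p) := M.tangible_of_sharp (M.sharp_id p)

end AdjointModeTheory

namespace FreeAdj

variable {L : Type u} [Bicategory.{w, v} L] (S : MorphismProperty L)

/-- The image of `L` in `FreeAdj L S`. -/
def IsImage : MorphismProperty (FreeAdj L S) :=
  fun {p q} ω => ∃ μ : p.base ⟶ q.base, ω = inl₁ μ

/-- The image of `S` in `FreeAdj L S`. -/
def IsImageOf : MorphismProperty (FreeAdj L S) :=
  fun {p q} ω => ∃ μ : p.base ⟶ q.base, S μ ∧ ω = inl₁ μ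

/-- The 1-cells of `FreeAdj L S` isomorphic to one of the form `μ ∘ ν†` where `μ` is in `L`, and
`ν` is in `S` or an identity. -/
def IsSpan : MorphismProperty (FreeAdj L S) :=
  fun {p q} ω => (∃ μ : p.base ⟶ q.base, Nonempty (ω ≅ inl₁ μ)) ∨
    ∃ (r : L) (ν : r ⟶ p.base) (hν : S ν) (μ : r ⟶ q.base), Nonempty (ω ≅ dag ν hν ≫ inl₁ μ)

/-- `FreeAdj L S` as an adjoint mode theory: the transparent 1-cells are those of `L`, the sinister
ones are those of `S`, and the tangible and the sharp ones are those isomorphic to `μ ∘ ν†` where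
`μ` is in `L`, and `ν` is in `S` or an identity. -/
noncomputable def modeTheory [Strict L] : AdjointModeTheory (FreeAdj L S) where
  tangible := IsSpan S
  sharp := IsSpan S
  transparent := IsImage S
  sinister := IsImageOf S
  transparent_id p := ⟨𝟙 p.base, (inl₁_id p.base).symm⟩
  sharp_id p := Or.inl ⟨𝟙 p.base, ⟨eqToIso (inl₁_id p.base).symm⟩⟩
  tangible_comp := by
    rintro p q r ω _ (⟨μ, ⟨e⟩⟩ | ⟨s, ν, hν, μ, ⟨e⟩⟩) ⟨ϱ, rfl⟩
    · exact Or.inl ⟨μ ≫ ϱ, ⟨whiskerRightIso e _ ≪≫ eqToIso (inl₁_comp μ ϱ).symm⟩⟩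
    · exact Or.inr ⟨s, ν, hν, μ ≫ ϱ, ⟨whiskerRightIso e _ ≪≫ α_ _ _ _ ≪≫
        whiskerLeftIso _ (eqToIso (inl₁_comp μ ϱ).symm)⟩⟩
  dagger _ hμ := dag hμ.choose hμ.choose_spec.1
  daggerAdj _ hμ :=
    cast (congrArg (fun ω => ω ⊣ dag hμ.choose hμ.choose_spec.1) hμ.choose_spec.2.symm)
      (adj hμ.choose hμ.choose_spec.1)

end FreeAdj

/-- A distributivity pullback around `g : E ⟶ A` and `f : A ⟶ B`: a pullback of `z : Z ⟶ B` along
`f`, of the form `e ≫ g` with `e : P ⟶ E`, that is terminal among the pullbacks of this form with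
`f` and `g` fixed. It exhibits `z : Z ⟶ B` as a pushforward of `g` along `f`. -/
structure IsDistributivityPullback {C : Type u} [Category.{v} C] {A B E P Z : C}
    (f : A ⟶ B) (g : E ⟶ A) (e : P ⟶ E) (l : P ⟶ Z) (z : Z ⟶ B) : Prop where
  isPullback : IsPullback (e ≫ g) l f z
  terminal {X Y : C} (x : X ⟶ E) (m : X ⟶ Y) (y : Y ⟶ B) (h : IsPullback (x ≫ g) m f y) :
    ∃! t : (X ⟶ P) × (Y ⟶ Z), t.1 ≫ e = x ∧ t.1 ≫ l = m ≫ t.2 ∧ t.2 ≫ z = y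

section comprehension

variable {C : Type u₁} [Category.{v₁} C] {Tm Ty : Cᵒᵖ ⥤ Type w} (τ : Tm ⟶ Ty)

/-- A comprehension of `A ∈ Ty(Γ)`: a representation of the pullback of `τ : Tm ⟶ Ty` along the
map from the presheaf represented by `Γ` to `Ty` that corresponds to `A`. -/
structure Comprehension {Γ : C} (A : Ty.obj (op Γ)) where
  /-- the extended context -/
  ext : C
  /-- the type projection -/
  p : ext ⟶ Γ
  /-- the generic term -/
  var : Tm.obj (op ext)
  tp_var : τ.app _ var = Ty.map p.op A
  existsUnique {Θ : C} (σ : Θ ⟶ Γ) (a : Tm.obj (op Θ)) (h : τ.app _ a = Ty.map σ.op A) :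
    ∃! u : Θ ⟶ ext, u ≫ p = σ ∧ Tm.map u.op var = a

/-- A morphism of presheaves is representable if every section of its codomain has a
comprehension. -/
def IsRepresentable : Prop :=
  ∀ (Γ : C) (A : Ty.obj (op Γ)), Nonempty (Comprehension τ A)

variable {τ}

/-- A choice of comprehension. -/
noncomputable def IsRepresentable.compr (h : IsRepresentable τ) {Γ : C} (A : Ty.obj (op Γ)) :
    Comprehension τ A :=
  (h Γ A).some

namespace Comprehension

/-- The morphism into a comprehension induced by a substitution and a term. -/
noncomputable def lift {Γ : C} {A : Ty.obj (op Γ)} (c : Comprehension τ A) {Θ : C} (σ : Θ ⟶ Γ)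
    (a : Tm.obj (op Θ)) (h : τ.app _ a = Ty.map σ.op A) : Θ ⟶ c.ext :=
  (c.existsUnique σ a h).choose

theorem lift_p {Γ : C} {A : Ty.obj (op Γ)} (c : Comprehension τ A) {Θ : C} (σ : Θ ⟶ Γ)
    (a : Tm.obj (op Θ)) (h : τ.app _ a = Ty.map σ.op A) : c.lift σ a h ≫ c.p = σ :=
  (c.existsUnique σ a h).choose_spec.1.1

/-- The morphism of comprehensions `Θ.A[σ] ⟶ Γ.A` over `σ : Θ ⟶ Γ`. -/
noncomputable def reindex {Γ Θ : C} {A : Ty.obj (op Γ)} {A' : Ty.obj (op Θ)}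
    (c' : Comprehension τ A') (c : Comprehension τ A) (σ : Θ ⟶ Γ) (h : A' = Ty.map σ.op A) :
    c'.ext ⟶ c.ext :=
  c.lift (c'.p ≫ σ) c'.var (by subst h; rw [c'.tp_var]; simp)

theorem reindex_p {Γ Θ : C} {A : Ty.obj (op Γ)} {A' : Ty.obj (op Θ)}
    (c' : Comprehension τ A') (c : Comprehension τ A) (σ : Θ ⟶ Γ) (h : A' = Ty.map σ.op A) :
    reindex c' c σ h ≫ c.p = c'.p ≫ σ :=
  lift_p _ _ _ _

theorem map_p {Γ Θ : C} {A : Ty.obj (op Γ)} {A' : Ty.obj (op Θ)} (c' : Comprehension τ A')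
    (c : Comprehension τ A) (σ : Θ ⟶ Γ) (h : A' = Ty.map σ.op A) {F : Cᵒᵖ ⥤ Type w₁}
    {x : F.obj (op Γ)} {x' : F.obj (op Θ)} (hx : x' = F.map σ.op x) :
    F.map c'.p.op x' = F.map (reindex c' c σ h).op (F.map c.p.op x) := by
  subst hx
  rw [← Functor.map_comp_apply, ← Functor.map_comp_apply, ← op_comp, ← op_comp, reindex_p]

end Comprehension

end comprehension

/-- A modal context structure over a 2-category `K`: a strict 2-functor from `K^coop` to `Cat`
whose values have terminal objects. -/
structure ModalContext (K : Type u) [Bicategory.{w, v} K] where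
  /-- the underlying 2-functor -/
  functor : StrictPseudofunctor (Coop K) Cat.{v₁, u₁}
  hasTerminal (p : K) : HasTerminal (functor.obj ⟨p⟩)

namespace ModalContext

variable {K : Type u} [Bicategory.{w, v} K] (D : ModalContext.{w, v, u, v₁, u₁} K)

/-- The category of contexts at a mode. -/
abbrev Ctx (p : K) : Type u₁ := D.functor.obj ⟨p⟩

/-- The action of a modal context structure on a 1-cell of the mode theory. -/
def lock {p q : K} (μ : p ⟶ q) : D.Ctx q ⥤ D.Ctx p :=
  (D.functor.map (⟨μ⟩ : (⟨q⟩ : Coop K) ⟶ ⟨p⟩)).toFunctor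

theorem lock_id (p : K) : D.lock (𝟙 p) = 𝟭 (D.Ctx p) :=
  congrArg Cat.Hom.toFunctor (D.functor.map_id (⟨p⟩ : Coop K))

theorem lock_comp {p q r : K} (μ : p ⟶ q) (ϱ : q ⟶ r) :
    D.lock (μ ≫ ϱ) = D.lock ϱ ⋙ D.lock μ :=
  congrArg Cat.Hom.toFunctor
    (D.functor.map_comp (⟨ϱ⟩ : (⟨r⟩ : Coop K) ⟶ ⟨q⟩) (⟨μ⟩ : (⟨q⟩ : Coop K) ⟶ ⟨p⟩))

/-- A morphism of presheaves `Tm_p ⟶ Ty_p` for every mode `p`. -/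
structure Typing where
  /-- the presheaf of types at a mode -/
  Ty (p : K) : (D.Ctx p)ᵒᵖ ⥤ Type w₂
  /-- the presheaf of terms at a mode -/
  Tm (p : K) : (D.Ctx p)ᵒᵖ ⥤ Type w₂
  /-- the type of a term -/
  tp (p : K) : Tm p ⟶ Ty p

namespace Typing

variable {D} (T : Typing.{w, v, u, v₁, u₁, w₂} D)

/-- The presheaf `(D^μ)^* Ty_p` on `D_q`, for `μ : p ⟶ q`. -/
abbrev TyAt {p q : K} (μ : p ⟶ q) : (D.Ctx q)ᵒᵖ ⥤ Type w₂ := (D.lock μ).op ⋙ T.Ty p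

/-- The presheaf `(D^μ)^* Tm_p` on `D_q`, for `μ : p ⟶ q`. -/
abbrev TmAt {p q : K} (μ : p ⟶ q) : (D.Ctx q)ᵒᵖ ⥤ Type w₂ := (D.lock μ).op ⋙ T.Tm p

/-- The morphism `(D^μ)^* Tm_p ⟶ (D^μ)^* Ty_p`, for `μ : p ⟶ q`. -/
abbrev tpAt {p q : K} (μ : p ⟶ q) : T.TmAt μ ⟶ T.TyAt μ :=
  Functor.whiskerLeft (D.lock μ).op (T.tp p)

end Typing

end ModalContext

open ModalContext

section models

variable {K : Type u} [Bicategory.{w, v} K] [Strict K] (M : AdjointModeTheory K)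
  {D : ModalContext.{w, v, u, v₁, u₁} K} (T : Typing.{w, v, u, v₁, u₁, w₂} D)

/-- An adjoint modal natural model: `(D^μ)^* τ_p` is representable for all tangible `μ`. -/
def IsAdjointModalNaturalModel : Prop :=
  ∀ {p q : K} (μ : p ⟶ q), M.tangible μ → IsRepresentable (T.tpAt μ)

variable {M T}

namespace IsAdjointModalNaturalModel

theorem rep_sharp (h : IsAdjointModalNaturalModel M T) {p q : K} {μ : p ⟶ q} (hμ : M.sharp μ) : IsRepresentable (T.tpAt μ) :=
  h μ (M.tangible_of_sharp hμ)

theorem rep_transparent (h : IsAdjointModalNaturalModel M T) {p q : K} {ϱ : p ⟶ q} (hϱ : M.transparent ϱ) :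
    IsRepresentable (T.tpAt ϱ) :=
  h ϱ (M.tangible_of_transparent hϱ)

theorem rep_id (h : IsAdjointModalNaturalModel M T) (p : K) : IsRepresentable (T.tp p) := by
  have key := h (𝟙 p) (M.tangible_id p)
  unfold Typing.tpAt Typing.TmAt Typing.TyAt at key
  rw [D.lock_id] at key
  intro Γ A
  obtain ⟨c⟩ := key Γ A
  exact ⟨⟨c.ext, c.p, c.var, c.tp_var, c.existsUnique⟩⟩

theorem rep_comp (h : IsAdjointModalNaturalModel M T) {p q r : K} {μ : p ⟶ q} {ϱ : q ⟶ r} (hμ : M.sharp μ) (hϱ : M.transparent ϱ) :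
    IsRepresentable (Functor.whiskerLeft (D.lock ϱ).op (T.tpAt μ)) := by
  have key := h (μ ≫ ϱ) (M.tangible_comp μ ϱ hμ hϱ)
  unfold Typing.tpAt Typing.TmAt Typing.TyAt at key
  rw [D.lock_comp] at key
  intro Γ A
  obtain ⟨c⟩ := key Γ A
  exact ⟨⟨c.ext, c.p, c.var, c.tp_var, c.existsUnique⟩⟩

/-- The comprehension of a type at a sharp 1-cell. -/
noncomputable def comprSharp (h : IsAdjointModalNaturalModel M T) {p q : K} {μ : p ⟶ q}
    (hμ : M.sharp μ) {Γ : D.Ctx q} (A : (T.TyAt μ).obj (op Γ)) : Comprehension (T.tpAt μ) A :=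
  (h.rep_sharp hμ).compr A

/-- The comprehension of a type at a transparent 1-cell. -/
noncomputable def comprTransparent (h : IsAdjointModalNaturalModel M T) {p q : K} {ϱ : p ⟶ q}
    (hϱ : M.transparent ϱ) {Γ : D.Ctx q} (A : (T.TyAt ϱ).obj (op Γ)) :
    Comprehension (T.tpAt ϱ) A :=
  (h.rep_transparent hϱ).compr A

/-- The ordinary comprehension of a type. -/
noncomputable def compr (h : IsAdjointModalNaturalModel M T) {p : K} {Γ : D.Ctx p}
    (A : (T.Ty p).obj (op Γ)) : Comprehension (T.tp p) A :=
  (h.rep_id p).compr A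

/-- The comprehension of a type at the composite of a sharp 1-cell `μ` and a transparent
1-cell `ϱ`. -/
noncomputable def comprComp (h : IsAdjointModalNaturalModel M T) {p q r : K} {μ : p ⟶ q}
    {ϱ : q ⟶ r} (hμ : M.sharp μ) (hϱ : M.transparent ϱ) {Γ : D.Ctx r}
    (A : (T.TyAt μ).obj (op ((D.lock ϱ).obj Γ))) :
    Comprehension (Functor.whiskerLeft (D.lock ϱ).op (T.tpAt μ)) A :=
  (h.rep_comp hμ hϱ).compr A

end IsAdjointModalNaturalModel

open Comprehension

/-- A `Π`-structure: for `μ : p ⟶ q` sharp, `A ∈ Ty_p(D^μ Γ)` and `B ∈ Ty_q(Γ.A)`, a type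
`Π(A, B) ∈ Ty_q(Γ)` whose comprehension is a pushforward of `Γ.A.B` along `Γ.A ⟶ Γ`, naturally
in `Γ`. The pullback of `Γ.A` to `Γ.Π(A, B)` that occurs in the distributivity pullback is taken
to be the comprehension `Γ.Π(A, B).A`. -/
structure PiStructure (h : IsAdjointModalNaturalModel M T) where
  /-- the type `Π(A, B)` -/
  Pi {p q : K} {μ : p ⟶ q} (hμ : M.sharp μ) {Γ : D.Ctx q} (A : (T.TyAt μ).obj (op Γ))
    (B : (T.Ty q).obj (op (h.comprSharp hμ A).ext)) : (T.Ty q).obj (op Γ)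
  Pi_sub {p q : K} {μ : p ⟶ q} (hμ : M.sharp μ) {Γ Θ : D.Ctx q} (σ : Θ ⟶ Γ)
    (A : (T.TyAt μ).obj (op Γ)) (B : (T.Ty q).obj (op (h.comprSharp hμ A).ext))
    (A' : (T.TyAt μ).obj (op Θ)) (hA : A' = (T.TyAt μ).map σ.op A)
    (B' : (T.Ty q).obj (op (h.comprSharp hμ A').ext))
    (hB : B' = (T.Ty q).map (reindex (h.comprSharp hμ A') (h.comprSharp hμ A) σ hA).op B) :
    Pi hμ A' B' = (T.Ty q).map σ.op (Pi hμ A B)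
  /-- the evaluation map `Γ.Π(A, B).A ⟶ Γ.A.B` -/
  ev {p q : K} {μ : p ⟶ q} (hμ : M.sharp μ) {Γ : D.Ctx q} (A : (T.TyAt μ).obj (op Γ))
    (B : (T.Ty q).obj (op (h.comprSharp hμ A).ext)) :
    (h.comprSharp hμ ((T.TyAt μ).map (h.compr (Pi hμ A B)).p.op A)).ext ⟶ (h.compr B).ext
  ev_p {p q : K} {μ : p ⟶ q} (hμ : M.sharp μ) {Γ : D.Ctx q} (A : (T.TyAt μ).obj (op Γ))
    (B : (T.Ty q).obj (op (h.comprSharp hμ A).ext)) :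
    ev hμ A B ≫ (h.compr B).p =
      reindex (h.comprSharp hμ _) (h.comprSharp hμ A) (h.compr (Pi hμ A B)).p rfl
  ev_sub {p q : K} {μ : p ⟶ q} (hμ : M.sharp μ) {Γ Θ : D.Ctx q} (σ : Θ ⟶ Γ)
    (A : (T.TyAt μ).obj (op Γ)) (B : (T.Ty q).obj (op (h.comprSharp hμ A).ext))
    (A' : (T.TyAt μ).obj (op Θ)) (hA : A' = (T.TyAt μ).map σ.op A)
    (B' : (T.Ty q).obj (op (h.comprSharp hμ A').ext))
    (hB : B' = (T.Ty q).map (reindex (h.comprSharp hμ A') (h.comprSharp hμ A) σ hA).op B) :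
    ev hμ A' B' ≫ reindex (h.compr B') (h.compr B) _ hB =
      reindex (h.comprSharp hμ _) (h.comprSharp hμ _)
        (reindex (h.compr _) (h.compr _) σ (Pi_sub hμ σ A B A' hA B' hB))
        (map_p _ _ _ _ hA) ≫ ev hμ A B
  isDistributivityPullback {p q : K} {μ : p ⟶ q} (hμ : M.sharp μ) {Γ : D.Ctx q}
    (A : (T.TyAt μ).obj (op Γ)) (B : (T.Ty q).obj (op (h.comprSharp hμ A).ext)) :
    IsDistributivityPullback (h.comprSharp hμ A).p (h.compr B).p (ev hμ A B)
      (h.comprSharp hμ _).p (h.compr (Pi hμ A B)).p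

variable (M T) in
/-- The formation and introduction operations of positive modalities. For `μ : p ⟶ q` sharp, the
types `F_μ A ∈ Ty_q(Γ)` for `A ∈ Ty_p(D^μ Γ)`, and the maps `Γ.A ⟶ Γ.(F_μ A)` over `Γ`, both
natural in `Γ`, are given as morphisms of presheaves `F` and `j`, acting respectively on types and
on terms. -/
structure PositiveIntro where
  /-- the action of the positive modality at `μ` on types -/
  F {p q : K} {μ : p ⟶ q} (hμ : M.sharp μ) : T.TyAt μ ⟶ T.Ty q
  /-- the action of the positive modality at `μ` on terms -/
  j {p q : K} {μ : p ⟶ q} (hμ : M.sharp μ) : T.TmAt μ ⟶ T.Tm q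
  j_tp {p q : K} {μ : p ⟶ q} (hμ : M.sharp μ) : j hμ ≫ T.tp q = T.tpAt μ ≫ F hμ

namespace PositiveIntro

variable (P : PositiveIntro M T) (h : IsAdjointModalNaturalModel M T)

/-- The type `F_μ A ∈ Ty_q(D^ϱ Γ)`, for `A ∈ Ty_p(D^μ D^ϱ Γ)`. -/
abbrev FAt {p q r : K} {μ : p ⟶ q} (ϱ : q ⟶ r) (hμ : M.sharp μ) {Γ : D.Ctx r}
    (A : (T.TyAt μ).obj (op ((D.lock ϱ).obj Γ))) : (T.TyAt ϱ).obj (op Γ) :=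
  (P.F hμ).app (op ((D.lock ϱ).obj Γ)) A

theorem FAt_sub {p q r : K} {μ : p ⟶ q} (ϱ : q ⟶ r) (hμ : M.sharp μ) {Γ Θ : D.Ctx r}
    (σ : Θ ⟶ Γ) (A : (T.TyAt μ).obj (op ((D.lock ϱ).obj Γ)))
    (A' : (T.TyAt μ).obj (op ((D.lock ϱ).obj Θ)))
    (hA : A' = (T.TyAt μ).map ((D.lock ϱ).map σ).op A) :
    P.FAt ϱ hμ A' = (T.TyAt ϱ).map σ.op (P.FAt ϱ hμ A) := by
  subst hA
  exact NatTrans.naturality_apply (P.F hμ) ((D.lock ϱ).map σ).op A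

/-- The map `ℓ : Γ.A ⟶ Γ.(F_μ A)` over `Γ`, for `A ∈ Ty_p(D^μ D^ϱ Γ)`, where the first
comprehension is along `ϱ ∘ μ` and the second one is along `ϱ`. It applies `j` to the generic
term. -/
noncomputable def ell {p q r : K} {μ : p ⟶ q} {ϱ : q ⟶ r} (hμ : M.sharp μ)
    (hϱ : M.transparent ϱ) {Γ : D.Ctx r} (A : (T.TyAt μ).obj (op ((D.lock ϱ).obj Γ))) :
    (h.comprComp hμ hϱ A).ext ⟶ (h.comprTransparent hϱ (P.FAt ϱ hμ A)).ext :=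
  (h.comprTransparent hϱ (P.FAt ϱ hμ A)).lift (h.comprComp hμ hϱ A).p
    ((P.j hμ).app (op ((D.lock ϱ).obj (h.comprComp hμ hϱ A).ext)) (h.comprComp hμ hϱ A).var)
    (by
      have h₁ := congrArg (fun θ => θ.app (op ((D.lock ϱ).obj (h.comprComp hμ hϱ A).ext))
        (h.comprComp hμ hϱ A).var) (P.j_tp hμ)
      have h₂ := (h.comprComp hμ hϱ A).tp_var
      refine h₁.trans ((congrArg ((P.F hμ).app _) h₂).trans ?_)
      exact P.FAt_sub ϱ hμ _ A _ rfl)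

end PositiveIntro

/-- Positive modalities: for `μ : p ⟶ q` sharp and `ϱ : q ⟶ r` transparent, and for every
`g : Γ.A ⟶ Γ.(F_μ A).B` that lifts `ℓ : Γ.A ⟶ Γ.(F_μ A)`, there is a chosen diagonal filler
`Γ.(F_μ A) ⟶ Γ.(F_μ A).B`, natural in `Γ`. -/
structure PositiveModalities (h : IsAdjointModalNaturalModel M T) extends PositiveIntro M T where
  /-- the chosen diagonal filler -/
  fill {p q r : K} {μ : p ⟶ q} {ϱ : q ⟶ r} (hμ : M.sharp μ) (hϱ : M.transparent ϱ)
    {Γ : D.Ctx r} (A : (T.TyAt μ).obj (op ((D.lock ϱ).obj Γ)))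
    (B : (T.Ty r).obj (op (h.comprTransparent hϱ (toPositiveIntro.FAt ϱ hμ A)).ext))
    (g : (h.comprComp hμ hϱ A).ext ⟶ (h.compr B).ext)
    (hg : g ≫ (h.compr B).p = toPositiveIntro.ell h hμ hϱ A) :
    (h.comprTransparent hϱ (toPositiveIntro.FAt ϱ hμ A)).ext ⟶ (h.compr B).ext
  fill_p {p q r : K} {μ : p ⟶ q} {ϱ : q ⟶ r} (hμ : M.sharp μ) (hϱ : M.transparent ϱ)
    {Γ : D.Ctx r} (A : (T.TyAt μ).obj (op ((D.lock ϱ).obj Γ)))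
    (B : (T.Ty r).obj (op (h.comprTransparent hϱ (toPositiveIntro.FAt ϱ hμ A)).ext))
    (g : (h.comprComp hμ hϱ A).ext ⟶ (h.compr B).ext)
    (hg : g ≫ (h.compr B).p = toPositiveIntro.ell h hμ hϱ A) :
    fill hμ hϱ A B g hg ≫ (h.compr B).p = 𝟙 _
  ell_fill {p q r : K} {μ : p ⟶ q} {ϱ : q ⟶ r} (hμ : M.sharp μ) (hϱ : M.transparent ϱ)
    {Γ : D.Ctx r} (A : (T.TyAt μ).obj (op ((D.lock ϱ).obj Γ)))
    (B : (T.Ty r).obj (op (h.comprTransparent hϱ (toPositiveIntro.FAt ϱ hμ A)).ext))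
    (g : (h.comprComp hμ hϱ A).ext ⟶ (h.compr B).ext)
    (hg : g ≫ (h.compr B).p = toPositiveIntro.ell h hμ hϱ A) :
    toPositiveIntro.ell h hμ hϱ A ≫ fill hμ hϱ A B g hg = g
  fill_sub {p q r : K} {μ : p ⟶ q} {ϱ : q ⟶ r} (hμ : M.sharp μ) (hϱ : M.transparent ϱ)
    {Γ Θ : D.Ctx r} (σ : Θ ⟶ Γ) (A : (T.TyAt μ).obj (op ((D.lock ϱ).obj Γ)))
    (B : (T.Ty r).obj (op (h.comprTransparent hϱ (toPositiveIntro.FAt ϱ hμ A)).ext))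
    (g : (h.comprComp hμ hϱ A).ext ⟶ (h.compr B).ext)
    (hg : g ≫ (h.compr B).p = toPositiveIntro.ell h hμ hϱ A)
    (A' : (T.TyAt μ).obj (op ((D.lock ϱ).obj Θ)))
    (hA : A' = (T.TyAt μ).map ((D.lock ϱ).map σ).op A)
    (B' : (T.Ty r).obj (op (h.comprTransparent hϱ (toPositiveIntro.FAt ϱ hμ A')).ext))
    (hB : B' = (T.Ty r).map (reindex (h.comprTransparent hϱ _) (h.comprTransparent hϱ _) σ
      (toPositiveIntro.FAt_sub ϱ hμ σ A A' hA)).op B)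
    (g' : (h.comprComp hμ hϱ A').ext ⟶ (h.compr B').ext)
    (hg' : g' ≫ (h.compr B').p = toPositiveIntro.ell h hμ hϱ A')
    (hgg' : g' ≫ reindex (h.compr B') (h.compr B) _ hB =
      reindex (h.comprComp hμ hϱ A') (h.comprComp hμ hϱ A) σ hA ≫ g) :
    fill hμ hϱ A' B' g' hg' ≫ reindex (h.compr B') (h.compr B) _ hB =
      reindex (h.comprTransparent hϱ _) (h.comprTransparent hϱ _) σ
        (toPositiveIntro.FAt_sub ϱ hμ σ A A' hA) ≫ fill hμ hϱ A B g hg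

variable (M T) in
/-- Negative modalities: for `μ : p ⟶ q` sinister, with right adjoint `μ†`, the functor `D^{μ†}`
has a dependent right adjoint, i.e. `(D^{μ†})^* τ_q` is a pullback of `τ_p`. -/
def HasNegativeModalities : Prop :=
  ∀ {p q : K} (μ : p ⟶ q) (hμ : M.sinister μ),
    ∃ (U : T.TyAt (M.dagger μ hμ) ⟶ T.Ty p) (V : T.TmAt (M.dagger μ hμ) ⟶ T.Tm p),
      IsPullback V (T.tpAt (M.dagger μ hμ)) (T.tp p) U

variable (M T) in
/-- `(D, τ)` models MATT over the adjoint mode theory `M`: it is an adjoint modal natural model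
with a `Π`-structure, positive modalities and negative modalities. -/
def ModelsMATT : Prop :=
  ∃ h : IsAdjointModalNaturalModel M T,
    Nonempty (PiStructure h) ∧ Nonempty (PositiveModalities h) ∧ HasNegativeModalities M T

end models

/-- A natural pseudo-model on a category `D`: a representable strict natural transformation with
discrete fibers between groupoid-valued pseudofunctors on `D^op`. -/
structure NaturalPseudoModel (D : Type u) [Category.{v} D] where
  /-- the pseudofunctor of types -/
  Ty : Pseudofunctor (LocallyDiscrete Dᵒᵖ) Cat.{v₂, u₂}
  /-- the pseudofunctor of terms -/
  Tm : Pseudofunctor (LocallyDiscrete Dᵒᵖ) Cat.{v₂, u₂}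
  isGroupoid_Ty (Γ : D) : IsGroupoid (Ty.obj ⟨op Γ⟩)
  isGroupoid_Tm (Γ : D) : IsGroupoid (Tm.obj ⟨op Γ⟩)
  /-- the type of a term -/
  tp : Pseudofunctor.StrongTrans Tm Ty
  tp_strict {a b : LocallyDiscrete Dᵒᵖ} (f : a ⟶ b) :
    ∃ h : Tm.map f ≫ tp.app b = tp.app a ≫ Ty.map f, tp.naturality f = eqToIso h
  /-- The components of `tp` are discrete fibrations. -/
  tp_discrete {Γ : D} (a : Tm.obj ⟨op Γ⟩) {B : Ty.obj ⟨op Γ⟩}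
    (φ : (tp.app ⟨op Γ⟩).toFunctor.obj a ⟶ B) :
    ∃! x : Σ b, a ⟶ b, (⟨(tp.app ⟨op Γ⟩).toFunctor.obj x.1,
      (tp.app ⟨op Γ⟩).toFunctor.map x.2⟩ : Σ B', (tp.app ⟨op Γ⟩).toFunctor.obj a ⟶ B') = ⟨B, φ⟩
  /-- the comprehension of a type -/
  ext {Γ : D} (A : Ty.obj ⟨op Γ⟩) : D
  /-- the type projection of a type -/
  p {Γ : D} (A : Ty.obj ⟨op Γ⟩) : ext A ⟶ Γ
  /-- the generic term of a type -/
  var {Γ : D} (A : Ty.obj ⟨op Γ⟩) : Tm.obj ⟨op (ext A)⟩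
  /-- the type of the generic term -/
  var_tp {Γ : D} (A : Ty.obj ⟨op Γ⟩) :
    (tp.app ⟨op (ext A)⟩).toFunctor.obj (var A) ⟶ (Ty.map (p A).op.toLoc).toFunctor.obj A
  /-- The comprehension represents the pullback of `tp` along the map `A` from the presheaf
  represented by `Γ` to `Ty`. Since `tp` has discrete fibers, it is immaterial whether this is the
  strict pullback or, as here, the one whose elements are a substitution `σ : Θ ⟶ Γ`, a term `a`
  over `Θ`, and an isomorphism from the type of `a` to `A[σ]`. -/
  existsUnique {Γ : D} (A : Ty.obj ⟨op Γ⟩) {Θ : D} (σ : Θ ⟶ Γ) (a : Tm.obj ⟨op Θ⟩)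
    (φ : (tp.app ⟨op Θ⟩).toFunctor.obj a ⟶ (Ty.map σ.op.toLoc).toFunctor.obj A) :
    ∃! u : Θ ⟶ ext A, ∃ (h : u ≫ p A = σ) (ψ : a ⟶ (Tm.map u.op.toLoc).toFunctor.obj (var A)),
      (tp.app ⟨op Θ⟩).toFunctor.map ψ ≫ (tp.naturality u.op.toLoc).hom.toNatTrans.app (var A) ≫
        (Ty.map u.op.toLoc).toFunctor.map (var_tp A) ≫
          (Ty.mapComp' (p A).op.toLoc u.op.toLoc σ.op.toLoc
            (by rw [← h]; rfl)).inv.toNatTrans.app A = φ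

namespace NaturalPseudoModel

variable {D : Type u} [Category.{v} D] (N : NaturalPseudoModel.{v, u, v₂, u₂} D)

/-- The types over `Γ`. -/
abbrev TyOver (Γ : D) : Type u₂ := N.Ty.obj ⟨op Γ⟩

/-- The pushforward of every type over `Γ` along `δ : Γ ⟶ Θ` exists and is a type over `Θ`. -/
def TypeExponentiable {Γ Θ : D} (δ : Γ ⟶ Θ) : Prop :=
  ∀ B : N.TyOver Γ, ∃ (C : N.TyOver Θ) (P : D) (e : P ⟶ N.ext B) (l : P ⟶ N.ext C),
    IsDistributivityPullback δ (N.p B) e l (N.p C)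

/-- A morphism is anodyne if it lifts against all type projections over its codomain. -/
def Anodyne {Γ Θ : D} (f : Γ ⟶ Θ) : Prop :=
  ∀ (B : N.TyOver Θ) (g : Γ ⟶ N.ext B), g ≫ N.p B = f →
    ∃ s : Θ ⟶ N.ext B, s ≫ N.p B = 𝟙 Θ ∧ f ≫ s = g

/-- A morphism is stably anodyne if every pullback of it is anodyne. -/
def StablyAnodyne {Γ Θ : D} (f : Γ ⟶ Θ) : Prop :=
  ∀ {Γ' Θ' : D} (t : Γ' ⟶ Γ) (f' : Γ' ⟶ Θ') (b : Θ' ⟶ Θ), IsPullback t f' f b → N.Anodyne f'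

/-- An element of `Ty^!(Γ)`: a type over a local universe `V`, and a morphism `Γ ⟶ V`. -/
structure SplitTy (Γ : D) where
  /-- the local universe -/
  base : D
  /-- the type over the local universe -/
  ty : N.TyOver base
  /-- the name of the type -/
  name : Γ ⟶ base

/-- An element of `Tm^!(Γ)`: a type over a local universe `V`, and a morphism from `Γ` to its
comprehension. -/
structure SplitTm (Γ : D) where
  /-- the local universe -/
  base : D
  /-- the type over the local universe -/
  ty : N.TyOver base
  /-- the name of the term -/
  name : Γ ⟶ N.ext ty

/-- The presheaf `Ty^!`. -/
def splitTy : Dᵒᵖ ⥤ Type (max u v u₂) where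
  obj Γ := N.SplitTy Γ.unop
  map f := ↾fun A => ⟨A.base, A.ty, f.unop ≫ A.name⟩
  map_id Γ := by ext A; simp
  map_comp f g := by ext A; simp

/-- The presheaf `Tm^!`. -/
def splitTm : Dᵒᵖ ⥤ Type (max u v u₂) where
  obj Γ := N.SplitTm Γ.unop
  map f := ↾fun a => ⟨a.base, a.ty, f.unop ≫ a.name⟩
  map_id Γ := by ext a; simp
  map_comp f g := by ext a; simp

/-- The left adjoint splitting `τ^! : Tm^! ⟶ Ty^!`. -/
def splitting : N.splitTm ⟶ N.splitTy where
  app Γ := ↾fun a => ⟨a.base, a.ty, a.name ≫ N.p a.ty⟩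
  naturality Γ Θ f := by
    ext a
    exact congrArg (SplitTy.mk a.base a.ty) (Category.assoc _ _ _)

end NaturalPseudoModel

/-- A modal pre-model over a 2-category `K`: a pseudofunctor `C : K ⟶ Cat` together with the
structure of a natural pseudo-model on every `C_p`. -/
structure ModalPreModel (K : Type u) [Bicategory.{w, v} K] where
  /-- the underlying pseudofunctor -/
  functor : Pseudofunctor K Cat.{v₁, u₁}
  /-- the natural pseudo-models -/
  model (p : K) : NaturalPseudoModel.{v₁, u₁, v₂, u₂} (functor.obj p)

namespace ModalPreModel

variable {K : Type u} [Bicategory.{w, v} K] [Strict K] (M : AdjointModeTheory K)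
  (C : ModalPreModel.{w, v, u, v₁, u₁, v₂, u₂} K)

/-- The action of a modal pre-model on a 1-cell. -/
abbrev act {p q : K} (μ : p ⟶ q) : C.functor.obj p ⥤ C.functor.obj q :=
  (C.functor.map μ).toFunctor

/-- Pre-`Π`-structure: for `μ` sharp, any pullback of the image under `C_μ` of a type projection is
type-exponentiable. -/
def HasPrePi : Prop :=
  ∀ {p q : K} (μ : p ⟶ q), M.sharp μ → ∀ {Γ : C.functor.obj p} (A : (C.model p).TyOver Γ)
    {X Y : C.functor.obj q} (t : X ⟶ (C.act μ).obj ((C.model p).ext A)) (δ : X ⟶ Y)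
    (b : Y ⟶ (C.act μ).obj Γ), IsPullback t δ ((C.act μ).map ((C.model p).p A)) b →
      (C.model q).TypeExponentiable δ

/-- Positive pre-modalities: for `μ : p ⟶ q` sharp and `A ∈ Ty_p(Γ)`, there are a type
`F ∈ Ty_q(C_μ Γ)` and a map `i : C_μ(Γ.A) ⟶ (C_μ Γ).F` over `C_μ Γ` such that `C_ϱ(i)` is stably
anodyne for every transparent `ϱ`. -/
def HasPositivePreModalities : Prop :=
  ∀ {p q : K} (μ : p ⟶ q), M.sharp μ → ∀ {Γ : C.functor.obj p} (A : (C.model p).TyOver Γ),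
    ∃ (F : (C.model q).TyOver ((C.act μ).obj Γ))
      (i : (C.act μ).obj ((C.model p).ext A) ⟶ (C.model q).ext F),
      i ≫ (C.model q).p F = (C.act μ).map ((C.model p).p A) ∧
        ∀ {r : K} (ϱ : q ⟶ r), M.transparent ϱ →
          (C.model r).StablyAnodyne ((C.act ϱ).map i)

/-- Negative pre-modalities: for `μ : p ⟶ q` sinister and `A ∈ Ty_q(Γ)`, there is a type
`U ∈ Ty_p(C_{μ†} Γ)` whose comprehension is isomorphic to `C_{μ†}(Γ.A)` over `C_{μ†} Γ`. -/
def HasNegativePreModalities : Prop :=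
  ∀ {p q : K} (μ : p ⟶ q) (hμ : M.sinister μ) {Γ : C.functor.obj q} (A : (C.model q).TyOver Γ),
    ∃ (U : (C.model p).TyOver ((C.act (M.dagger μ hμ)).obj Γ))
      (e : (C.model p).ext U ≅ (C.act (M.dagger μ hμ)).obj ((C.model q).ext A)),
      e.hom ≫ (C.act (M.dagger μ hμ)).map ((C.model q).p A) = (C.model p).p U

end ModalPreModel

/-- A category is locally cartesian closed if it has pullbacks and every pullback functor between
its slices has a right adjoint. -/
def IsLocallyCartesianClosed (C : Type u) [Category.{v} C] : Prop :=
  ∃ _ : HasPullbacks C, ∀ {X Y : C} (f : X ⟶ Y), (Over.pullback f).IsLeftAdjoint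

/-- The restriction to `L` of a modal context structure `D` over `FreeAdj L ⊤`, made covariant by
sending `μ` to `D^{μ†}`, which is right adjoint to `D^μ`, and a 2-cell to its mate. -/
def ModalContext.covariant {L : Type u} [Bicategory.{w, v} L] [Strict L]
    (D : ModalContext.{max w v u, max v u, u, v₁, u₁} (FreeAdj L ⊤)) :
    Pseudofunctor L Cat.{v₁, u₁} :=
  ((toAdj (FreeAdj.inl ⊤).toPseudofunctor (fun μ => FreeAdj.dag μ trivial)
    (fun μ => FreeAdj.adj μ trivial)).comp (adjForgetRight (FreeAdj L ⊤))).comp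
      D.functor.toPseudofunctor

/-- An adjoint modal pre-model over a 2-category `L` with a class `S` of 1-cells. -/
structure AdjointModalPreModel (L : Type u) [Bicategory.{w, v} L] [Strict L]
    (S : MorphismProperty L) where
  /-- the modal context structure, over `L` with right adjoints added for all 1-cells -/
  hat : ModalContext.{max w v u, max v u, u, v₁, u₁} (FreeAdj L ⊤)
  isLocallyCartesianClosed (p : FreeAdj L ⊤) : IsLocallyCartesianClosed (hat.Ctx p)
  /-- the modal pre-model, over `L` with right adjoints added for the 1-cells in `S` -/
  C : ModalPreModel.{max w v u, max v u, u, v₁, u₁, v₂, u₂} (FreeAdj L S)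
  /-- the reflections, pseudonatural in the 1-cells of `L` -/
  refl : Pseudofunctor.StrongTrans hat.covariant
    ((FreeAdj.inl S).toPseudofunctor.comp C.functor)
  preservesFiniteLimits (p : L) : PreservesFiniteLimits (refl.app p).toFunctor
  /-- the right adjoints of the reflections -/
  incl (p : L) : C.functor.obj ⟨p⟩ ⥤ hat.Ctx ⟨p⟩
  /-- the adjunctions between the reflections and their right adjoints -/
  adj (p : L) : (refl.app p).toFunctor ⊣ incl p
  incl_full (p : L) : (incl p).Full
  incl_faithful (p : L) : (incl p).Faithful

namespace AdjointModalPreModel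

variable {L : Type u} [Bicategory.{w, v} L] [Strict L] {S : MorphismProperty L}
  (X : AdjointModalPreModel.{w, v, u, v₁, u₁, v₂, u₂} L S)

/-- The modal context structure of an adjoint modal pre-model, restricted to `FreeAdj L S`. -/
def context : ModalContext.{max w v u, max v u, u, v₁, u₁} (FreeAdj L S) where
  functor := (Coop.mapStrict (FreeAdj.map (le_top : S ≤ ⊤))).comp X.hat.functor
  hasTerminal p := X.hat.hasTerminal ⟨p.base⟩

/-- The reflection at a mode. -/
def reflection (p : FreeAdj L S) : X.context.Ctx p ⥤ X.C.functor.obj p :=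
  (X.refl.app p.base).toFunctor

/-- The left adjoint splittings of the natural pseudo-models, pulled back along the reflections. -/
def typing : Typing.{max w v u, max v u, u, v₁, u₁, max u₁ v₁ u₂} X.context where
  Ty p := (X.reflection p).op ⋙ (X.C.model p).splitTy
  Tm p := (X.reflection p).op ⋙ (X.C.model p).splitTm
  tp p := Functor.whiskerLeft (X.reflection p).op (X.C.model p).splitting

end AdjointModalPreModel

-- Write L_p for the reflections, R_p for their right adjoints, D^μ for `lock`, and D_μ for the
-- right adjoint `unlock` of D^μ when μ is in `L`. A type over Γ is a triple (V, E, n) with E a type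
-- over V and n : L Γ ⟶ V; substitution changes only n. An operation is therefore strictly stable
-- under substitution as soon as it makes one choice for each E (or each pair of types) and treats n
-- by a universal property. This is what lets structure that exists only up to isomorphism in the
-- pseudo-models yield strict structure.
--
-- Representability. For a tangible μ, the functor L_p D^μ has a right adjoint H with L_q H ≅ C_μ
-- (`nonempty_rightAction`). If μ is in `L`, take H = D_μ R_p. For μ ∘ ν†, the functor D^{ν†} is
-- D_ν, which L turns into C_ν by pseudonaturality, and C_ν has the right adjoint C_{ν†}; so H = D_μ
-- R C_{ν†}. The comprehension of (V, E, n) is the pullback of H(p_E) along the transpose of n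
-- (`NamedExt.nonempty`).
--
-- Π-types. For fixed E and F over V and W, local cartesian closure yields an object U that
-- classifies a map Γ ⟶ H V together with a map to R W from the induced pullback of H(p_E). The
-- reflection preserves pullbacks, so it sends the universal pullback of H(p_E) to a pullback of
-- C_μ(p_E), which is type-exponentiable. This gives one Π-type over L U; every Π(A, B) is its
-- reindexing along L of the classifying map (`PiUniverse`).
--
-- Positive modalities. F_μ is computed on names by L_q H ≅ C_μ. All maps ℓ are pullbacks of a
-- single map, which L_r sends to C_ϱ(i) up to isomorphism (`anodyne_map_of_isPullback`). A second
-- classifying object parametrizes the lifting problems; the universal one is solved once, by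
-- anodyneness, and its solution is reindexed (`FillUniverse`).
--
-- Negative modalities. L_q D^{μ†} ≅ C_μ L_p and C_μ ⊣ C_{μ†} identify names L_q D^{μ†} Γ ⟶ V with
-- names L_p Γ ⟶ C_{μ†} V, which gives the pullback square directly (`isPullback_neg`).

universe v₃ u₃ v₄ u₄ v₅ u₅ v₆ u₆

/-! ### Substitution in a pseudo-model, and stability of type projections under pullback. -/

namespace NaturalPseudoModel

variable {D : Type u} [Category.{v} D] (N : NaturalPseudoModel.{v, u, v₂, u₂} D)

/-- The terms over `Γ`. -/
abbrev TmOver (Γ : D) : Type u₂ := N.Tm.obj ⟨op Γ⟩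

/-- Substitution in types. -/
def sub {Γ Θ : D} (f : Θ ⟶ Γ) : N.TyOver Γ ⥤ N.TyOver Θ := (N.Ty.map f.op.toLoc).toFunctor

/-- Substitution in terms. -/
def subTm {Γ Θ : D} (f : Θ ⟶ Γ) : N.TmOver Γ ⥤ N.TmOver Θ := (N.Tm.map f.op.toLoc).toFunctor

/-- The type of a term. -/
def tpOver (Γ : D) : N.TmOver Γ ⥤ N.TyOver Γ := (N.tp.app ⟨op Γ⟩).toFunctor

/-- The type of the generic term. -/
def varTp {Γ : D} (A : N.TyOver Γ) :
    (N.tpOver (N.ext A)).obj (N.var A) ⟶ (N.sub (N.p A)).obj A :=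
  N.var_tp A

theorem comp_toLoc {Γ Φ Θ : D} {g : Θ ⟶ Φ} {f : Φ ⟶ Γ} {k : Θ ⟶ Γ} (h : g ≫ f = k) :
    f.op.toLoc ≫ g.op.toLoc = k.op.toLoc := by
  subst h; rfl

/-- Substitution in types is compatible with composition. -/
def subComp {Γ Φ Θ : D} (g : Θ ⟶ Φ) (f : Φ ⟶ Γ) (k : Θ ⟶ Γ) (h : g ≫ f = k) :
    N.sub f ⋙ N.sub g ≅ N.sub k :=
  (Cat.Hom.toNatIso (N.Ty.mapComp' f.op.toLoc g.op.toLoc k.op.toLoc (comp_toLoc h))).symm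

/-- Substitution in terms is compatible with composition. -/
def subTmComp {Γ Φ Θ : D} (g : Θ ⟶ Φ) (f : Φ ⟶ Γ) (k : Θ ⟶ Γ) (h : g ≫ f = k) :
    N.subTm f ⋙ N.subTm g ≅ N.subTm k :=
  (Cat.Hom.toNatIso (N.Tm.mapComp' f.op.toLoc g.op.toLoc k.op.toLoc (comp_toLoc h))).symm

/-- Substitution is compatible with typing. -/
def tpSub {Γ Θ : D} (f : Θ ⟶ Γ) : N.subTm f ⋙ N.tpOver Θ ≅ N.tpOver Γ ⋙ N.sub f :=
  Cat.Hom.toNatIso (N.tp.naturality f.op.toLoc)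

theorem subComp_assoc {Γ Φ Ξ Θ : D} (h : Θ ⟶ Ξ) (g : Ξ ⟶ Φ) (f : Φ ⟶ Γ) (A : N.TyOver Γ)
    {gf : Ξ ⟶ Γ} (e₁ : g ≫ f = gf) {hg : Θ ⟶ Φ} (e₂ : h ≫ g = hg) {k : Θ ⟶ Γ}
    (e₃ : h ≫ gf = k) (e₄ : hg ≫ f = k) :
    (N.sub h).map ((N.subComp g f gf e₁).hom.app A) ≫ (N.subComp h gf k e₃).hom.app A =
      (N.subComp h g hg e₂).hom.app ((N.sub f).obj A) ≫ (N.subComp hg f k e₄).hom.app A :=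
  N.Ty.mapComp'_inv_whiskerRight_mapComp'₀₂₃_inv_app f.op.toLoc g.op.toLoc h.op.toLoc
    gf.op.toLoc hg.op.toLoc k.op.toLoc (comp_toLoc e₁) (comp_toLoc e₂) (comp_toLoc e₃) A

theorem tpSub_comp {Γ Φ Θ : D} (g : Θ ⟶ Φ) (f : Φ ⟶ Γ) (k : Θ ⟶ Γ) (h : g ≫ f = k)
    (a : N.TmOver Γ) :
    (N.tpOver Θ).map ((N.subTmComp g f k h).hom.app a) ≫ (N.tpSub k).hom.app a =
      (N.tpSub g).hom.app ((N.subTm f).obj a) ≫ (N.sub g).map ((N.tpSub f).hom.app a) ≫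
        (N.subComp g f k h).hom.app ((N.tpOver Γ).obj a) := by
  subst h
  have key := Pseudofunctor.StrongTrans.naturality_comp_hom_app N.tp f.op.toLoc g.op.toLoc a
  rw [← Pseudofunctor.mapComp'_eq_mapComp, ← Pseudofunctor.mapComp'_eq_mapComp] at key
  have e : (N.tpSub (g ≫ f)).hom.app a = (N.tpOver Θ).map
      ((N.subTmComp g f (g ≫ f) rfl).inv.app a) ≫ (N.tpSub g).hom.app ((N.subTm f).obj a) ≫
        (N.sub g).map ((N.tpSub f).hom.app a) ≫
          (N.subComp g f _ rfl).hom.app ((N.tpOver Γ).obj a) := key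
  rw [e, ← Functor.map_comp_assoc, Iso.hom_inv_id_app]
  simp

/-- The map `u : Θ ⟶ Γ.A` classifies the term `a` of type `A[σ]`. -/
def Classifies {Γ : D} (A : N.TyOver Γ) {Θ : D} (σ : Θ ⟶ Γ) (a : N.TmOver Θ)
    (φ : (N.tpOver Θ).obj a ⟶ (N.sub σ).obj A) (u : Θ ⟶ N.ext A) : Prop :=
  ∃ (h : u ≫ N.p A = σ) (ψ : a ⟶ (N.subTm u).obj (N.var A)),
    (N.tpOver Θ).map ψ ≫ (N.tpSub u).hom.app (N.var A) ≫ (N.sub u).map (N.varTp A) ≫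
      (N.subComp u (N.p A) σ h).hom.app A = φ

theorem existsUnique_classifies {Γ : D} (A : N.TyOver Γ) {Θ : D} (σ : Θ ⟶ Γ) (a : N.TmOver Θ)
    (φ : (N.tpOver Θ).obj a ⟶ (N.sub σ).obj A) : ∃! u, N.Classifies A σ a φ u :=
  N.existsUnique A σ a φ

/-- Classification depends on the term only up to isomorphism, so the uniqueness clause can compare
terms that are merely isomorphic. -/
theorem Classifies.congr {Γ : D} {A : N.TyOver Γ} {Θ : D} {σ : Θ ⟶ Γ} {a a' : N.TmOver Θ}
    {φ : (N.tpOver Θ).obj a ⟶ (N.sub σ).obj A} {u : Θ ⟶ N.ext A} (h : N.Classifies A σ a φ u)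
    (χ : a' ⟶ a) : N.Classifies A σ a' ((N.tpOver Θ).map χ ≫ φ) u := by
  obtain ⟨h, ψ, rfl⟩ := h
  exact ⟨h, χ ≫ ψ, by simp⟩

/-- Classification is natural in the context. The content is the coherence of `subComp` and `tpSub`;
after it, the proofs below need little besides uniqueness of classifying maps. -/
theorem Classifies.precomp {Γ : D} {A : N.TyOver Γ} {Θ : D} {σ : Θ ⟶ Γ} {a : N.TmOver Θ}
    {φ : (N.tpOver Θ).obj a ⟶ (N.sub σ).obj A} {v : Θ ⟶ N.ext A} (h : N.Classifies A σ a φ v)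
    {Ξ : D} (u : Ξ ⟶ Θ) (σ' : Ξ ⟶ Γ) (hσ : u ≫ σ = σ') :
    N.Classifies A σ' ((N.subTm u).obj a) ((N.tpSub u).hom.app a ≫ (N.sub u).map φ ≫
      (N.subComp u σ σ' hσ).hom.app A) (u ≫ v) := by
  obtain ⟨h, ψ, rfl⟩ := h
  refine ⟨by rw [Category.assoc, h, hσ],
    (N.subTm u).map ψ ≫ (N.subTmComp u v _ rfl).hom.app _, ?_⟩
  have n₁ := (N.tpSub u).hom.naturality ψ
  have n₂ := (N.subComp u v _ rfl).hom.naturality (N.varTp A)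
  dsimp at n₁ n₂
  simp only [Functor.map_comp, Category.assoc]
  rw [← reassoc_of% n₁, N.subComp_assoc u v (N.p A) A h rfl hσ (by rw [Category.assoc, h, hσ]),
    reassoc_of% n₂, ← reassoc_of% (N.tpSub_comp u v _ rfl (N.var A))]

/-- The generic term over `Γ.A`, precomposed with `u`. -/
theorem classifies_self {Γ : D} (A : N.TyOver Γ) {Θ : D} (u : Θ ⟶ N.ext A) {σ : Θ ⟶ Γ}
    (h : u ≫ N.p A = σ) : N.Classifies A σ ((N.subTm u).obj (N.var A))
      ((N.tpSub u).hom.app (N.var A) ≫ (N.sub u).map (N.varTp A) ≫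
      (N.subComp u (N.p A) σ h).hom.app A) u :=
  ⟨h, 𝟙 _, by simp⟩

/-- Type projections are stable under pullback. -/
theorem exists_isPullback_p {Γ Φ : D} (b : Φ ⟶ Γ) (A : N.TyOver Γ) :
    ∃ (A' : N.TyOver Φ) (q : N.ext A' ⟶ N.ext A), IsPullback q (N.p A') (N.p A) b := by
  let A' := (N.sub b).obj A
  -- The generic term of A[b] is also a term of A over `N.p A' ≫ b`, through the comparison of
  -- iterated substitutions; `q` classifies it.
  obtain ⟨q, hq, -⟩ := N.existsUnique_classifies A (N.p A' ≫ b) (N.var A')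
    (N.varTp A' ≫ (N.subComp (N.p A') b _ rfl).hom.app A)
  have hqp : q ≫ N.p A = N.p A' ≫ b := hq.1
  -- Composing with `q` keeps the term and only transports its type along `subComp`, so uniqueness
  -- for `A` and uniqueness for `A'` can be played against each other.
  have key : ∀ {Θ : D} {σ : Θ ⟶ Φ} {a : N.TmOver Θ} {φ : (N.tpOver Θ).obj a ⟶ (N.sub σ).obj A'}
      {u : Θ ⟶ N.ext A'}, N.Classifies A' σ a φ u →
      N.Classifies A (σ ≫ b) a (φ ≫ (N.subComp σ b _ rfl).hom.app A) (u ≫ q) := by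
    rintro Θ σ a φ u ⟨h, ψ, rfl⟩
    have h₁ := (hq.precomp N u (σ ≫ b) (by rw [← Category.assoc, h])).congr N ψ
    simp only [Functor.map_comp, Category.assoc] at h₁ ⊢
    rwa [N.subComp_assoc u (N.p A') b A rfl h] at h₁
  have lift : ∀ s : PullbackCone (N.p A) b, ∃! u : s.pt ⟶ N.ext A',
      u ≫ q = s.fst ∧ u ≫ N.p A' = s.snd := by
    intro s
    have hv := N.classifies_self A s.fst s.condition
    obtain ⟨u, hu, -⟩ := N.existsUnique_classifies A' s.snd _
      (((N.tpSub s.fst).hom.app (N.var A) ≫ (N.sub s.fst).map (N.varTp A) ≫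
        (N.subComp s.fst (N.p A) _ s.condition).hom.app A) ≫
          (N.subComp s.snd b _ rfl).inv.app A)
    have hu' := key hu
    simp only [Category.assoc, Iso.inv_hom_id_app, Category.comp_id] at hu'
    refine ⟨u, ⟨(N.existsUnique_classifies _ _ _ _).unique hu' hv, hu.1⟩, ?_⟩
    rintro u' ⟨h₁, h₂⟩
    have hc := N.classifies_self A' u' h₂
    -- Since `u' ≫ q = s.fst`, the term classified by `u'` is isomorphic, over its type, to the one
    -- classified by `u`. Both maps then classify the same term of `A'`.
    obtain ⟨_, ψ, hψ⟩ := h₁ ▸ key hc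
    have hcc := hu.congr N ψ
    rw [← Category.assoc, hψ, Category.assoc, Iso.hom_inv_id_app] at hcc
    erw [Category.comp_id] at hcc
    exact (N.existsUnique_classifies _ _ _ _).unique hc hcc
  exact ⟨A', q, ⟨⟨hqp⟩, ⟨PullbackCone.IsLimit.mk _ (fun s => (lift s).choose)
    (fun s => (lift s).choose_spec.1.1) (fun s => (lift s).choose_spec.1.2)
    (fun s m h₁ h₂ => (lift s).unique ⟨h₁, h₂⟩ (lift s).choose_spec.1)⟩⟩⟩

end NaturalPseudoModel

/-! ### Comprehensions of left adjoint splittings, described by names. -/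

namespace NaturalPseudoModel

variable {D : Type u} [Category.{v} D] {C : Type u₁} [Category.{v₁} C]
  {N : NaturalPseudoModel.{v₁, u₁, v₂, u₂} C} {G : D ⥤ C}

variable (N G) in
/-- The left adjoint splitting, pulled back along a functor. -/
abbrev splittingAlong : G.op ⋙ N.splitTm ⟶ G.op ⋙ N.splitTy :=
  Functor.whiskerLeft G.op N.splitting

variable (G) in
/-- A comprehension of the element `(V, E, n)` of the left adjoint splitting pulled back along
`G`. -/
structure NamedExt {Γ : D} {V : C} (E : N.TyOver V) (n : G.obj Γ ⟶ V) where
  /-- the extended context -/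
  ext : D
  /-- the type projection -/
  p : ext ⟶ Γ
  /-- the name of the generic term -/
  gen : G.obj ext ⟶ N.ext E
  gen_p : gen ≫ N.p E = G.map p ≫ n
  existsUnique_lift {Θ : D} (σ : Θ ⟶ Γ) (t : G.obj Θ ⟶ N.ext E)
    (h : t ≫ N.p E = G.map σ ≫ n) : ∃! u : Θ ⟶ ext, u ≫ p = σ ∧ G.map u ≫ gen = t

namespace NamedExt

variable {Γ : D} {V : C} {E : N.TyOver V} {n : G.obj Γ ⟶ V} (c : NamedExt G E n)

theorem hom_ext {Θ : D} {u u' : Θ ⟶ c.ext} (h : u ≫ c.p = u' ≫ c.p)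
    (h' : G.map u ≫ c.gen = G.map u' ≫ c.gen) : u = u' :=
  (c.existsUnique_lift (u' ≫ c.p) (G.map u' ≫ c.gen)
    (by rw [Category.assoc, gen_p]; simp)).unique ⟨h, h'⟩ ⟨rfl, rfl⟩

/-- The morphism into a comprehension given by the name of a term. -/
noncomputable def lift {Θ : D} (σ : Θ ⟶ Γ) (t : G.obj Θ ⟶ N.ext E)
    (h : t ≫ N.p E = G.map σ ≫ n) : Θ ⟶ c.ext :=
  (c.existsUnique_lift σ t h).choose

@[simp]
theorem lift_p {Θ : D} (σ : Θ ⟶ Γ) (t : G.obj Θ ⟶ N.ext E)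
    (h : t ≫ N.p E = G.map σ ≫ n) : c.lift σ t h ≫ c.p = σ :=
  (c.existsUnique_lift σ t h).choose_spec.1.1

theorem lift_p_assoc {Θ : D} (σ : Θ ⟶ Γ) (t : G.obj Θ ⟶ N.ext E)
    (h : t ≫ N.p E = G.map σ ≫ n) {Z : D} (f : Γ ⟶ Z) : c.lift σ t h ≫ c.p ≫ f = σ ≫ f := by
  rw [← Category.assoc, lift_p]

@[simp]
theorem lift_gen {Θ : D} (σ : Θ ⟶ Γ) (t : G.obj Θ ⟶ N.ext E)
    (h : t ≫ N.p E = G.map σ ≫ n) : G.map (c.lift σ t h) ≫ c.gen = t :=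
  (c.existsUnique_lift σ t h).choose_spec.1.2

theorem map_gen_p {Θ : D} (g : Θ ⟶ c.ext) {σ : Θ ⟶ Γ} (hg : g ≫ c.p = σ) :
    (G.map g ≫ c.gen) ≫ N.p E = G.map σ ≫ n := by
  rw [Category.assoc, gen_p, ← hg, Functor.map_comp, Category.assoc]

/-- The square of a reindexing is a pullback. -/
theorem isPullback_reindex {Θ : D} {σ : Θ ⟶ Γ} {n' : G.obj Θ ⟶ V} (hn : n' = G.map σ ≫ n)
    (c' : NamedExt G E n') (u : c'.ext ⟶ c.ext) (h₁ : u ≫ c.p = c'.p ≫ σ)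
    (h₂ : G.map u ≫ c.gen = c'.gen) : IsPullback u c'.p c.p σ := by
  subst hn
  have hlift : ∀ s : PullbackCone c.p σ, (G.map s.fst ≫ c.gen) ≫ N.p E =
      G.map s.snd ≫ G.map σ ≫ n := by
    intro s
    rw [Category.assoc, gen_p, ← Functor.map_comp_assoc, s.condition, Functor.map_comp_assoc]
  refine ⟨⟨h₁⟩, ⟨PullbackCone.IsLimit.mk _
    (fun s => c'.lift s.snd (G.map s.fst ≫ c.gen) (hlift s)) ?_ ?_ ?_⟩⟩
  · intro s
    refine c.hom_ext ?_ ?_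
    · rw [Category.assoc, h₁, lift_p_assoc, s.condition]
    · rw [Functor.map_comp, Category.assoc, h₂, lift_gen]
  · intro s
    exact lift_p _ _ _ _
  · intro s m h h'
    refine c'.hom_ext ?_ ?_
    · rw [h', lift_p]
    · rw [lift_gen, ← h, ← h₂, Functor.map_comp, Category.assoc]

/-- A comprehension is a pullback of the image of a type projection under the right adjoint. -/
theorem isPullback {H : C ⥤ D} (adj : G ⊣ H) : IsPullback (adj.homEquiv _ _ c.gen) c.p
    (H.map (N.p E)) (adj.homEquiv _ _ n) := by
  have hlift : ∀ s : PullbackCone (H.map (N.p E)) (adj.homEquiv _ _ n),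
      (adj.homEquiv _ _).symm s.fst ≫ N.p E = G.map s.snd ≫ n := by
    intro s
    rw [← adj.homEquiv_naturality_right_symm, s.condition, adj.homEquiv_naturality_left_symm,
      Equiv.symm_apply_apply]
  refine ⟨⟨?_⟩, ⟨PullbackCone.IsLimit.mk _
    (fun s => c.lift s.snd _ (hlift s)) ?_ ?_ ?_⟩⟩
  · rw [← adj.homEquiv_naturality_right, gen_p, adj.homEquiv_naturality_left]
  · intro s
    rw [← adj.homEquiv_naturality_left, lift_gen, Equiv.apply_symm_apply]
  · intro s
    exact lift_p _ _ _ _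
  · intro s m h₁ h₂
    refine c.hom_ext ?_ ?_
    · rw [h₂, lift_p]
    · rw [lift_gen, ← h₁, ← adj.homEquiv_naturality_left, Equiv.symm_apply_apply]

/-- Comprehensions exist along a left adjoint. -/
theorem nonempty [HasPullbacks D] {H : C ⥤ D} (adj : G ⊣ H) {Γ : D} {V : C} (E : N.TyOver V)
    (n : G.obj Γ ⟶ V) : Nonempty (NamedExt G E n) := by
  let q := pullback.fst (H.map (N.p E)) (adj.homEquiv _ _ n)
  let r := pullback.snd (H.map (N.p E)) (adj.homEquiv _ _ n)
  have hqr : q ≫ H.map (N.p E) = r ≫ adj.homEquiv _ _ n := pullback.condition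
  -- Under G ⊣ H, a map t : G Θ ⟶ V.E lying over G(σ) ≫ n is a map Θ ⟶ H(V.E) lying over σ followed
  -- by the transpose of n, hence a map into this pullback.
  refine ⟨⟨pullback (H.map (N.p E)) (adj.homEquiv _ _ n), r, (adj.homEquiv _ _).symm q, ?_, ?_⟩⟩
  · rw [← adj.homEquiv_naturality_right_symm, hqr, adj.homEquiv_naturality_left_symm,
      Equiv.symm_apply_apply]
  intro Θ σ t ht
  have ht' : adj.homEquiv _ _ t ≫ H.map (N.p E) = σ ≫ adj.homEquiv _ _ n := by
    rw [← adj.homEquiv_naturality_right, ht, adj.homEquiv_naturality_left]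
  refine ⟨pullback.lift (adj.homEquiv _ _ t) σ ht', ⟨pullback.lift_snd _ _ _, ?_⟩, ?_⟩
  · rw [← adj.homEquiv_naturality_left_symm, pullback.lift_fst, Equiv.symm_apply_apply]
  · rintro u ⟨h₁, h₂⟩
    refine pullback.hom_ext ?_ ?_
    · rw [pullback.lift_fst, ← h₂, adj.homEquiv_naturality_left, Equiv.apply_symm_apply]
    · rw [pullback.lift_snd]; exact h₁

end NamedExt

/-- Equality in the splitting is strict in the local universe and in the type over it. Only the name
of a term is left free, and it must be a lift of the name of its type. -/
theorem exists_of_splitting_eq {Γ : C} {a : N.SplitTm Γ} {V : C} {E : N.TyOver V} {n : Γ ⟶ V}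
    (h : (⟨a.base, a.ty, a.name ≫ N.p a.ty⟩ : N.SplitTy Γ) = ⟨V, E, n⟩) :
    ∃ t : Γ ⟶ N.ext E, a = ⟨V, E, t⟩ ∧ t ≫ N.p E = n := by
  obtain ⟨V', E', t⟩ := a
  obtain ⟨rfl, h⟩ := (SplitTy.mk.injEq ..).mp h
  obtain ⟨h₁, h₂⟩ := h
  cases h₁
  exact ⟨t, rfl, eq_of_heq h₂⟩

theorem SplitTm.name_injective {Γ V : C} {E : N.TyOver V} {t t' : Γ ⟶ N.ext E}
    (h : (⟨V, E, t⟩ : N.SplitTm Γ) = ⟨V, E, t'⟩) : t = t' := by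
  cases h; rfl

/-- The comprehensions of the left adjoint splitting pulled back along `G`. -/
def NamedExt.comprehension {Γ : D} (A : (G.op ⋙ N.splitTy).obj (op Γ))
    (c : NamedExt G (SplitTy.ty A) (SplitTy.name A)) : Comprehension (N.splittingAlong G) A where
  ext := c.ext
  p := c.p
  var := (⟨_, _, c.gen⟩ : N.SplitTm (G.obj c.ext))
  tp_var := congrArg (SplitTy.mk _ _) c.gen_p
  existsUnique σ a h := by
    obtain ⟨t, rfl, ht⟩ := exists_of_splitting_eq h
    obtain ⟨u, ⟨h₁, h₂⟩, hu⟩ := c.existsUnique_lift σ t ht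
    exact ⟨u, ⟨h₁, congrArg (SplitTm.mk _ _) h₂⟩,
      fun u' h => hu u' ⟨h.1, SplitTm.name_injective h.2⟩⟩

theorem exists_gen {Γ : D} {A : (G.op ⋙ N.splitTy).obj (op Γ)}
    (c : Comprehension (N.splittingAlong G) A) :
    ∃ t : G.obj c.ext ⟶ N.ext (SplitTy.ty A), c.var = (⟨_, _, t⟩ : N.SplitTm _) ∧
      t ≫ N.p (SplitTy.ty A) = G.map c.p ≫ SplitTy.name A :=
  exists_of_splitting_eq c.tp_var

/-- The comprehension of an element of the left adjoint splitting in terms of names. -/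
noncomputable def namedExt {Γ : D} {A : (G.op ⋙ N.splitTy).obj (op Γ)}
    (c : Comprehension (N.splittingAlong G) A) : NamedExt G (SplitTy.ty A) (SplitTy.name A) where
  ext := c.ext
  p := c.p
  gen := (exists_gen c).choose
  gen_p := (exists_gen c).choose_spec.2
  existsUnique_lift {Θ} σ t h := by
    obtain ⟨u, ⟨h₁, h₂⟩, hu⟩ := c.existsUnique σ (⟨_, _, t⟩ : N.SplitTm (G.obj Θ))
      (congrArg (SplitTy.mk _ _) h)
    have e := (exists_gen c).choose_spec.1
    exact ⟨u, ⟨h₁, SplitTm.name_injective ((congrArg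
      ((G.op ⋙ N.splitTm).map u.op) e).symm.trans h₂)⟩, fun u' h => hu u' ⟨h.1,
        (congrArg ((G.op ⋙ N.splitTm).map u'.op) e).trans (congrArg (SplitTm.mk _ _) h.2)⟩⟩

theorem namedExt_var {Γ : D} {A : (G.op ⋙ N.splitTy).obj (op Γ)}
    (c : Comprehension (N.splittingAlong G) A) :
    c.var = (⟨_, _, (namedExt c).gen⟩ : N.SplitTm (G.obj c.ext)) :=
  (exists_gen c).choose_spec.1

/-- Converts the universal property of a `Comprehension`, stated for elements of the splitting, into
an equation between names. The equality `ha` is propositional, so it also covers terms whose type is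
only provably a reindexing. -/
theorem map_lift_gen {Γ : D} {A : (G.op ⋙ N.splitTy).obj (op Γ)}
    (c : Comprehension (N.splittingAlong G) A) {Θ : D} (σ : Θ ⟶ Γ)
    (a : (G.op ⋙ N.splitTm).obj (op Θ)) (h) {t : G.obj Θ ⟶ N.ext (SplitTy.ty A)}
    (ha : a = (⟨_, _, t⟩ : N.SplitTm (G.obj Θ))) :
    G.map (Comprehension.lift c σ a h) ≫ (namedExt c).gen = t :=
  SplitTm.name_injective ((congrArg ((G.op ⋙ N.splitTm).map (Comprehension.lift c σ a h).op)
    (namedExt_var c)).symm.trans ((c.existsUnique σ a h).choose_spec.1.2.trans ha))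

theorem map_reindex_gen {Γ Θ : D} {A : (G.op ⋙ N.splitTy).obj (op Γ)} (σ : Θ ⟶ Γ)
    (c' : Comprehension (N.splittingAlong G) ((G.op ⋙ N.splitTy).map σ.op A))
    (c : Comprehension (N.splittingAlong G) A) :
    G.map (Comprehension.reindex c' c σ rfl) ≫ (namedExt c).gen = (namedExt c').gen :=
  map_lift_gen c _ _ _ (namedExt_var c')

end NaturalPseudoModel

/-! ### Pushforwards and classifying objects in a locally cartesian closed category. -/

section LocallyCartesianClosed

variable {D : Type u} [Category.{v} D]

/-- The right adjoint of a pullback functor constructs pushforwards. -/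
theorem isDistributivityPullback_of_adjunction [HasPullbacks D] {A B : D} (f : A ⟶ B)
    {R : Over A ⥤ Over B} (adj : Over.pullback f ⊣ R) (G : Over A) :
    IsDistributivityPullback f G.hom (adj.counit.app G).left (pullback.fst (R.obj G).hom f)
      (R.obj G).hom := by
  have hε : (adj.counit.app G).left ≫ G.hom = pullback.snd (R.obj G).hom f :=
    Over.w (adj.counit.app G)
  refine ⟨?_, ?_⟩
  · rw [hε]
    exact (IsPullback.of_hasPullback (R.obj G).hom f).flip
  intro X Y x m y hX
  let i : X ≅ pullback y f := hX.flip.isoPullback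
  have hi₁ : i.hom ≫ pullback.fst y f = m := hX.flip.isoPullback_hom_fst
  have hi₂ : i.hom ≫ pullback.snd y f = x ≫ G.hom := hX.flip.isoPullback_hom_snd
  have hfst (t : Over.mk y ⟶ R.obj G) : ((Over.pullback f).map t).left ≫
      pullback.fst (R.obj G).hom f = pullback.fst y f ≫ t.left := pullback.lift_fst _ _ _
  have hsnd (t : Over.mk y ⟶ R.obj G) : ((Over.pullback f).map t).left ≫
      pullback.snd (R.obj G).hom f = pullback.snd y f := pullback.lift_snd _ _ _
  -- The test pullback is isomorphic to the chosen one, which makes `x` a morphism over `A` out of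
  -- the pullback of `y`; its transpose is the required map.
  let k : (Over.pullback f).obj (Over.mk y) ⟶ G :=
    Over.homMk (i.inv ≫ x) (by
      rw [Category.assoc, ← hi₂, Iso.inv_hom_id_assoc]; rfl)
  have hk : i.hom ≫ k.left = x := i.hom_inv_id_assoc x
  have hcounit (t : Over.mk y ⟶ R.obj G) : ((adj.homEquiv _ _).symm t).left =
      ((Over.pullback f).map t).left ≫ (adj.counit.app G).left := by
    rw [adj.homEquiv_counit]; rfl
  refine ⟨(i.hom ≫ ((Over.pullback f).map (adj.homEquiv _ _ k)).left,
    (adj.homEquiv _ _ k).left), ⟨?_, ?_, Over.w (adj.homEquiv _ _ k)⟩, ?_⟩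
  · dsimp only
    rw [Category.assoc, ← hcounit, Equiv.symm_apply_apply, hk]
  · dsimp only
    rw [Category.assoc, hfst, reassoc_of% hi₁]
  · rintro ⟨t₁, t₂⟩ ⟨h₁, h₂, h₃⟩
    dsimp only at h₁ h₂ h₃
    let t : Over.mk y ⟶ R.obj G := Over.homMk t₂ h₃
    -- The component on `X` is forced by the one on `Y`, since both of its projections to the chosen
    -- pullback are prescribed.
    have ht₁ : t₁ = i.hom ≫ ((Over.pullback f).map t).left := by
      refine pullback.hom_ext ?_ ?_
      · rw [h₂, Category.assoc, hfst, reassoc_of% hi₁]; rfl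
      · rw [Category.assoc, hsnd, hi₂, ← h₁, Category.assoc, hε]
    have ht : t = adj.homEquiv _ _ k := by
      rw [← Equiv.symm_apply_eq]
      refine Over.OverMorphism.ext ?_
      rw [hcounit, ← cancel_epi i.hom, hk, ← h₁, ht₁, Category.assoc]
    rw [ht₁, ← ht]
    rfl

/-- Pushforwards exist in a locally cartesian closed category. -/
theorem IsLocallyCartesianClosed.exists_isDistributivityPullback (h : IsLocallyCartesianClosed D)
    {A B E : D} (f : A ⟶ B) (g : E ⟶ A) :
    ∃ (P Z : D) (e : P ⟶ E) (l : P ⟶ Z) (z : Z ⟶ B), IsDistributivityPullback f g e l z := by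
  obtain ⟨_, hf⟩ := h
  have := hf f
  exact ⟨_, _, _, _, _, isDistributivityPullback_of_adjunction f
    (Adjunction.ofIsLeftAdjoint (Over.pullback f)) (Over.mk g)⟩

/-- An object over `B` that classifies morphisms to `W` from pullbacks of `f : A ⟶ B`. -/
structure MapClassifier {A B : D} (f : A ⟶ B) (W : D) where
  /-- the classifying object -/
  U : D
  /-- the pullback of `f` to the classifying object -/
  P : D
  /-- the projection to `A` -/
  a : P ⟶ A
  /-- the universal morphism -/
  b : P ⟶ W
  /-- the projection to the classifying object -/
  l : P ⟶ U
  /-- the projection of the classifying object -/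
  z : U ⟶ B
  isPullback : IsPullback a l f z
  existsUnique {X Y : D} (x : X ⟶ A) (w : X ⟶ W) (m : X ⟶ Y) (y : Y ⟶ B)
    (h : IsPullback x m f y) : ∃! t : (X ⟶ P) × (Y ⟶ U),
      t.1 ≫ a = x ∧ t.1 ≫ b = w ∧ t.1 ≫ l = m ≫ t.2 ∧ t.2 ≫ z = y

/-- Maps X ⟶ W from an object over A are maps X ⟶ A × W over A, so the pushforward of the projection
A × W ⟶ A along f is the classifying object. -/
theorem IsLocallyCartesianClosed.nonempty_mapClassifier [HasTerminal D]
    (h : IsLocallyCartesianClosed D) {A B : D} (f : A ⟶ B) (W : D) :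
    Nonempty (MapClassifier f W) := by
  have : HasPullbacks D := h.choose
  have : HasBinaryProducts D := hasBinaryProducts_of_hasTerminal_and_pullbacks D
  obtain ⟨P, Z, e, l, z, hd⟩ := h.exists_isDistributivityPullback f (prod.fst : A ⨯ W ⟶ A)
  refine ⟨⟨Z, P, e ≫ prod.fst, e ≫ prod.snd, l, z, hd.isPullback, ?_⟩⟩
  intro X Y x w m y hX
  obtain ⟨t, ⟨h₁, h₂, h₃⟩, ht⟩ := hd.terminal (prod.lift x w) m y (by rwa [prod.lift_fst])
  refine ⟨t, ⟨?_, ?_, h₂, h₃⟩, ?_⟩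
  · rw [reassoc_of% h₁, prod.lift_fst]
  · rw [reassoc_of% h₁, prod.lift_snd]
  · rintro t' ⟨k₁, k₂, k₃, k₄⟩
    refine ht t' ⟨Limits.prod.hom_ext ?_ ?_, k₃, k₄⟩
    · rw [prod.lift_fst, Category.assoc, k₁]
    · rw [prod.lift_snd, Category.assoc, k₂]

/-- An object over `B` that classifies commutative squares from pullbacks of `g : A₂ ⟶ A₁` to
`τ : K ⟶ W`, where `A₁` and `A₂` are objects over `B`. -/
structure SquareClassifier {A₁ A₂ B K W : D} (f : A₁ ⟶ B) (g : A₂ ⟶ A₁) (τ : K ⟶ W) where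
  /-- the classifying object -/
  U : D
  /-- the pullback of `A₁` to the classifying object -/
  P₁ : D
  /-- the pullback of `A₂` to the classifying object -/
  P₂ : D
  /-- the projection to `A₁` -/
  a₁ : P₁ ⟶ A₁
  /-- the projection to `A₂` -/
  a₂ : P₂ ⟶ A₂
  /-- the bottom of the universal square -/
  b₁ : P₁ ⟶ W
  /-- the top of the universal square -/
  b₂ : P₂ ⟶ K
  /-- the pullback of `g` -/
  q : P₂ ⟶ P₁
  /-- the projection to the classifying object -/
  l : P₁ ⟶ U
  /-- the projection of the classifying object -/
  z : U ⟶ B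
  isPullback₁ : IsPullback a₁ l f z
  isPullback₂ : IsPullback a₂ q g a₁
  w : b₂ ≫ τ = q ≫ b₁
  existsUnique {X₁ X₂ Y : D} (x₁ : X₁ ⟶ A₁) (x₂ : X₂ ⟶ A₂) (r : X₂ ⟶ X₁) (m : X₁ ⟶ Y)
    (y : Y ⟶ B) (h₁ : IsPullback x₁ m f y) (h₂ : IsPullback x₂ r g x₁) (w₁ : X₁ ⟶ W)
    (w₂ : X₂ ⟶ K) (hw : w₂ ≫ τ = r ≫ w₁) : ∃! t : (X₁ ⟶ P₁) × (X₂ ⟶ P₂) × (Y ⟶ U),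
      (t.1 ≫ a₁ = x₁ ∧ t.1 ≫ b₁ = w₁ ∧ t.1 ≫ l = m ≫ t.2.2) ∧
        (t.2.1 ≫ a₂ = x₂ ∧ t.2.1 ≫ b₂ = w₂ ∧ t.2.1 ≫ q = r ≫ t.1) ∧ t.2.2 ≫ z = y

/-- Two pushforwards in succession. The first classifies the bottom of the square. Over its
universal family, a top for the given bottom is a section of a pullback of τ, and these sections are
classified by pushing that pullback forward to the first classifying object. -/
theorem IsLocallyCartesianClosed.nonempty_squareClassifier [HasTerminal D]
    (h : IsLocallyCartesianClosed D) {A₁ A₂ B K W : D} (f : A₁ ⟶ B) (g : A₂ ⟶ A₁) (τ : K ⟶ W) :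
    Nonempty (SquareClassifier f g τ) := by
  have : HasPullbacks D := h.choose
  obtain ⟨M⟩ := h.nonempty_mapClassifier f W
  let α := pullback.fst g M.a
  let r₀ := pullback.snd g M.a
  have hr : IsPullback α r₀ g M.a := IsPullback.of_hasPullback _ _
  let s := pullback.fst (r₀ ≫ M.b) τ
  obtain ⟨P, Z, e, l, z, hd⟩ := h.exists_isDistributivityPullback (r₀ ≫ M.l) s
  have hl := IsPullback.of_hasPullback M.l z
  have hP := hd.isPullback
  have hcomm : (e ≫ s ≫ r₀) ≫ M.l = l ≫ z := by simpa using hP.w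
  -- The distributivity square lies over the composite `r₀ ≫ M.l`; cancelling the square over `M.l`
  -- leaves the universal pullback of `g`.
  have hq : IsPullback (e ≫ s) (hl.lift _ _ hcomm) r₀ (pullback.fst M.l z) :=
    IsPullback.of_bot (by simpa using hP) (by simp) hl
  refine ⟨⟨Z, pullback M.l z, P, pullback.fst M.l z ≫ M.a, (e ≫ s) ≫ α,
    pullback.fst M.l z ≫ M.b, e ≫ pullback.snd _ _, hl.lift _ _ hcomm, pullback.snd M.l z,
    z ≫ M.z, hl.paste_horiz M.isPullback, hq.paste_horiz hr, ?_, ?_⟩⟩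
  · rw [IsPullback.lift_fst_assoc, Category.assoc, ← pullback.condition]
    simp [s]
  intro X₁ X₂ Y x₁ x₂ r m y h₁ h₂ w₁ w₂ hw
  obtain ⟨⟨k₁, k₀⟩, ⟨c₁, c₂, c₃, c₄⟩, hk⟩ := M.existsUnique x₁ w₁ m y h₁
  dsimp only at c₁ c₂ c₃ c₄
  -- By cancellation, the test data become pullbacks of the universal family of `M`, which is what
  -- the second universal property needs.
  have hX₁ : IsPullback k₁ m M.l k₀ :=
    IsPullback.of_right (by rw [c₁, c₄]; exact h₁) c₃ M.isPullback
  have hj : x₂ ≫ g = (r ≫ k₁) ≫ M.a := by rw [Category.assoc, c₁, h₂.w]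
  let j := hr.lift x₂ (r ≫ k₁) hj
  have hj₁ : j ≫ α = x₂ := hr.lift_fst _ _ _
  have hj₂ : j ≫ r₀ = r ≫ k₁ := hr.lift_snd _ _ _
  have hX₂ : IsPullback j r r₀ k₁ :=
    IsPullback.of_right (by rw [hj₁, c₁]; exact h₂) hj₂ hr
  have hi : j ≫ r₀ ≫ M.b = w₂ ≫ τ := by rw [reassoc_of% hj₂, c₂, hw]
  obtain ⟨⟨t₂, t₃⟩, ⟨d₁, d₂, d₃⟩, ht⟩ := hd.terminal (pullback.lift j w₂ hi) (r ≫ m) k₀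
    (by rw [pullback.lift_fst]; exact hX₂.paste_vert hX₁)
  dsimp only at d₁ d₂ d₃
  have d₁' : t₂ ≫ e ≫ s = j := by rw [reassoc_of% d₁, pullback.lift_fst]
  refine ⟨(hl.lift k₁ (m ≫ t₃) (by rw [Category.assoc, d₃, c₃]), t₂, t₃),
    ⟨⟨?_, ?_, ?_⟩, ⟨?_, ?_, ?_⟩, ?_⟩, ?_⟩
  · rw [IsPullback.lift_fst_assoc, c₁]
  · rw [IsPullback.lift_fst_assoc, c₂]
  · exact hl.lift_snd _ _ _
  · simp only [Category.assoc] at d₁' ⊢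
    rw [reassoc_of% d₁', hj₁]
  · simp only [reassoc_of% d₁, pullback.lift_snd]
  · refine hl.hom_ext ?_ ?_
    · simp only [Category.assoc, IsPullback.lift_fst]
      rw [← hj₂, ← d₁', Category.assoc, Category.assoc]
    · simp only [Category.assoc, IsPullback.lift_snd]
      rw [d₂, Category.assoc]
  · simp only [reassoc_of% d₃, c₄]
  · rintro ⟨t₁', t₂', t₃'⟩ ⟨⟨k₁', k₂', k₃'⟩, ⟨n₁, n₂, n₃⟩, k₄'⟩
    dsimp only at k₁' k₂' k₃' k₄' n₁ n₂ n₃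
    -- A competitor composed with the projections to the first stage is pinned down there; only then
    -- is it a competitor for the second pushforward.
    have e₁ := hk (t₁' ≫ pullback.fst M.l z, t₃' ≫ z) ⟨by simpa using k₁', by simpa using k₂',
      by simp only [Category.assoc]; rw [pullback.condition, reassoc_of% k₃'], by simpa using k₄'⟩
    obtain ⟨e₁, e₂⟩ := Prod.mk.inj e₁
    have e₃ := ht (t₂', t₃') ⟨?_, ?_, e₂⟩
    · obtain ⟨e₃, e₄⟩ := Prod.mk.inj e₃
      subst e₃ e₄
      refine Prod.ext (hl.hom_ext ?_ ?_) rfl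
      · rw [hl.lift_fst]; exact e₁
      · rw [hl.lift_snd]; exact k₃'
    · refine pullback.hom_ext ?_ ?_
      · rw [pullback.lift_fst]
        refine hr.hom_ext ?_ ?_
        · rw [hj₁, ← n₁]; simp [s]
        · have := congrArg (· ≫ pullback.fst M.l z) n₃
          simp only [Category.assoc, IsPullback.lift_fst, e₁] at this
          rw [hj₂, ← this]; simp [s]
      · rw [pullback.lift_snd, ← n₂]; simp
    · have := congrArg (· ≫ pullback.snd M.l z) n₃
      simpa only [Category.assoc, IsPullback.lift_snd, k₃'] using this

end LocallyCartesianClosed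

/-! ### The local universe of Π-types. -/

namespace NaturalPseudoModel

section Pi

variable {D : Type u} [Category.{v} D] {C' : Type u₁} [Category.{v₁} C'] {C : Type u₂}
  [Category.{v₂} C] {N' : NaturalPseudoModel.{v₁, u₁, v₃, u₃} C'}
  {N : NaturalPseudoModel.{v₂, u₂, v₄, u₄} C}
  {G : D ⥤ C'} {H : C' ⥤ D} (adj : G ⊣ H) {L : D ⥤ C} {R : C ⥤ D} (adjL : L ⊣ R)

/-- The local universe of the types `Π(A, B)`, where `A` is a reindexing of `E` and `B` is a
reindexing of `F`. -/
structure PiUniverse (H : C' ⥤ D) {L : D ⥤ C} {R : C ⥤ D} (adjL : L ⊣ R) {V : C'}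
    (E : N'.TyOver V) {W : C} (F : N.TyOver W) extends
    MapClassifier (H.map (N'.p E)) (R.obj W) where
  /-- the universal family -/
  fam : N.TyOver (L.obj P)
  /-- the comparison of the universal family with `F` -/
  q : N.ext fam ⟶ N.ext F
  isPullback_q : IsPullback q (N.p fam) (N.p F) ((adjL.homEquiv _ _).symm b)
  /-- the universal `Π`-type -/
  ty : N.TyOver (L.obj U)
  /-- the domain of the universal evaluation map -/
  dom : C
  /-- the universal evaluation map -/
  e : dom ⟶ N.ext fam
  /-- the projection of the domain of the universal evaluation map -/
  k : dom ⟶ N.ext ty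
  isDistributivityPullback : IsDistributivityPullback (L.map l) (N.p fam) e k (N.p ty)

/-- The universal family `M.l` is a pullback of H(p_E), and L preserves that pullback, so `hE`
applies to L(`M.l`) and to the reindexing of F along the transpose of `M.b`. -/
theorem PiUniverse.nonempty [HasTerminal D] (hD : IsLocallyCartesianClosed D)
    [PreservesFiniteLimits L] {V : C'} (E : N'.TyOver V) {W : C} (F : N.TyOver W)
    (hE : ∀ {X Y : C} (t : X ⟶ L.obj (H.obj (N'.ext E))) (δ : X ⟶ Y) (b : Y ⟶ L.obj (H.obj V)),
      IsPullback t δ (L.map (H.map (N'.p E))) b → N.TypeExponentiable δ) :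
    Nonempty (PiUniverse H adjL E F) := by
  obtain ⟨M⟩ := hD.nonempty_mapClassifier (H.map (N'.p E)) (R.obj W)
  obtain ⟨fam, q, hq⟩ := N.exists_isPullback_p ((adjL.homEquiv _ _).symm M.b) F
  obtain ⟨ty, dom, e, k, h⟩ := hE _ _ _ (M.isPullback.map L) fam
  exact ⟨⟨M, fam, q, hq, ty, dom, e, k, h⟩⟩

namespace PiUniverse

variable {adjL} {V : C'} {E : N'.TyOver V} {W : C} {F : N.TyOver W} (M : PiUniverse H adjL E F)
  {Γ : D} {n : G.obj Γ ⟶ V} (c : NamedExt G E n) (m : L.obj c.ext ⟶ W)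

/-- The comprehension of (V, E, n) is a pullback of H(p_E), so the transposes of `n` and `m` are
exactly test data for the classifying object. -/
theorem existsUnique_classify : ∃! t : (c.ext ⟶ M.P) × (Γ ⟶ M.U),
    t.1 ≫ M.a = adj.homEquiv _ _ c.gen ∧ t.1 ≫ M.b = adjL.homEquiv _ _ m ∧
      t.1 ≫ M.l = c.p ≫ t.2 ∧ t.2 ≫ M.z = adj.homEquiv _ _ n :=
  M.existsUnique _ _ _ _ (c.isPullback adj)

/-- The map to the local universe. -/
noncomputable def toU : Γ ⟶ M.U := (M.existsUnique_classify adj c m).choose.2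

/-- The map to the universal extended context. -/
noncomputable def toP : c.ext ⟶ M.P := (M.existsUnique_classify adj c m).choose.1

theorem toP_a : M.toP adj c m ≫ M.a = adj.homEquiv _ _ c.gen :=
  (M.existsUnique_classify adj c m).choose_spec.1.1

theorem toP_b : M.toP adj c m ≫ M.b = adjL.homEquiv _ _ m :=
  (M.existsUnique_classify adj c m).choose_spec.1.2.1

theorem toP_l : M.toP adj c m ≫ M.l = c.p ≫ M.toU adj c m :=
  (M.existsUnique_classify adj c m).choose_spec.1.2.2.1

theorem toU_z : M.toU adj c m ≫ M.z = adj.homEquiv _ _ n :=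
  (M.existsUnique_classify adj c m).choose_spec.1.2.2.2

theorem map_toP_b : L.map (M.toP adj c m) ≫ (adjL.homEquiv _ _).symm M.b = m := by
  rw [← adjL.homEquiv_naturality_left_symm, toP_b, Equiv.symm_apply_apply]

theorem isPullback_toP : IsPullback (M.toP adj c m) c.p M.l (M.toU adj c m) :=
  IsPullback.of_right (by rw [toP_a, toU_z]; exact c.isPullback adj) (M.toP_l adj c m)
    M.isPullback

section sub

variable {Θ : D} (σ : Θ ⟶ Γ) {n' : G.obj Θ ⟶ V} (hn : n' = G.map σ ≫ n) (c' : NamedExt G E n')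
  (r : c'.ext ⟶ c.ext) (hr₁ : r ≫ c.p = c'.p ≫ σ) (hr₂ : G.map r ≫ c.gen = c'.gen)
  (m' : L.obj c'.ext ⟶ W) (hm : m' = L.map r ≫ m)

include hn hr₁ hr₂ hm

/-- Uniqueness of classifying maps. This equation is the source of the strict stability of Π(A, B)
under substitution. -/
theorem to_sub : M.toP adj c' m' = r ≫ M.toP adj c m ∧ M.toU adj c' m' = σ ≫ M.toU adj c m := by
  have h := (M.existsUnique_classify adj c' m').unique
    (y₁ := (M.toP adj c' m', M.toU adj c' m')) (y₂ := (r ≫ M.toP adj c m, σ ≫ M.toU adj c m))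
    ⟨M.toP_a adj c' m', M.toP_b adj c' m', M.toP_l adj c' m', M.toU_z adj c' m'⟩ ⟨?_, ?_, ?_, ?_⟩
  · exact Prod.mk.inj h
  · rw [Category.assoc, toP_a, ← adj.homEquiv_naturality_left, hr₂]
  · rw [Category.assoc, toP_b, ← adjL.homEquiv_naturality_left, hm]
  · rw [Category.assoc, toP_l, reassoc_of% hr₁]
  · rw [Category.assoc, toU_z, ← adj.homEquiv_naturality_left, hn]

end sub

section ev

variable (cB : NamedExt L F m) (cP : NamedExt L M.ty (L.map (M.toU adj c m)))
  {n' : G.obj cP.ext ⟶ V} (hn : n' = G.map cP.p ≫ n)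
  (cA : NamedExt G E n') (ρ : cA.ext ⟶ c.ext)
  (hρ₁ : ρ ≫ c.p = cA.p ≫ cP.p) (hρ₂ : G.map ρ ≫ c.gen = cA.gen)

/-- The map to the domain of the universal evaluation map. -/
noncomputable def toDom : L.obj cA.ext ⟶ M.dom :=
  M.isDistributivityPullback.isPullback.lift (L.map (ρ ≫ M.toP adj c m)) (L.map cA.p ≫ cP.gen)
    (by rw [← L.map_comp, Category.assoc, toP_l, reassoc_of% hρ₁, Category.assoc, cP.gen_p]
        simp)

theorem toDom_e_p : M.toDom adj c m cP cA ρ hρ₁ ≫ M.e ≫ N.p M.fam =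
    L.map ρ ≫ L.map (M.toP adj c m) := by
  rw [toDom, IsPullback.lift_fst, L.map_comp]

theorem toDom_k : M.toDom adj c m cP cA ρ hρ₁ ≫ M.k = L.map cA.p ≫ cP.gen :=
  IsPullback.lift_snd _ _ _ _

theorem toDom_e_q_p : (M.toDom adj c m cP cA ρ hρ₁ ≫ M.e ≫ M.q) ≫ N.p F = L.map ρ ≫ m := by
  rw [Category.assoc, Category.assoc, M.isPullback_q.w, reassoc_of% (M.toDom_e_p adj c m cP cA ρ hρ₁), map_toP_b]

/-- The evaluation map. -/
noncomputable def ev : cA.ext ⟶ cB.ext :=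
  cB.lift ρ (M.toDom adj c m cP cA ρ hρ₁ ≫ M.e ≫ M.q) (M.toDom_e_q_p adj c m cP cA ρ hρ₁)

theorem ev_p : M.ev adj c m cB cP cA ρ hρ₁ ≫ cB.p = ρ := cB.lift_p _ _ _

theorem ev_gen : L.map (M.ev adj c m cB cP cA ρ hρ₁) ≫ cB.gen =
    M.toDom adj c m cP cA ρ hρ₁ ≫ M.e ≫ M.q := cB.lift_gen _ _ _

include hn hρ₂ in
-- A test pullback over Γ, pasted with the classifying square and mapped by L, becomes a test
-- pullback for the universal pushforward over L U. The maps found there are names, which the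
-- comprehensions turn back into maps of contexts. No separate Beck–Chevalley argument is needed,
-- because the universal property already ranges over all bases above L U.
theorem isDistributivityPullback_ev [PreservesFiniteLimits L] :
    IsDistributivityPullback c.p cB.p (M.ev adj c m cB cP cA ρ hρ₁) cA.p cP.p := by
  have hA : IsPullback ρ cA.p c.p cP.p := c.isPullback_reindex hn cA ρ hρ₁ hρ₂
  refine ⟨by rwa [ev_p], ?_⟩
  intro X Y x m₀ y hX
  have hx : (L.map x ≫ cB.gen) ≫ N.p F =
      L.map (x ≫ cB.p ≫ M.toP adj c m) ≫ (adjL.homEquiv _ _).symm M.b := by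
    rw [Category.assoc, cB.gen_p, L.map_comp, L.map_comp, Category.assoc, Category.assoc,
      map_toP_b]
  -- A term of B is a term of the universal family over L(`M.P`), since B is its reindexing along
  -- L(`toP`).
  obtain ⟨x', hx₁, hx₂⟩ : ∃ x' : L.obj X ⟶ N.ext M.fam, x' ≫ M.q = L.map x ≫ cB.gen ∧
      x' ≫ N.p M.fam = L.map (x ≫ cB.p ≫ M.toP adj c m) :=
    ⟨M.isPullback_q.lift _ _ hx, IsPullback.lift_fst _ _ _ _, IsPullback.lift_snd _ _ _ _⟩
  have hL : IsPullback (x' ≫ N.p M.fam) (L.map m₀) (L.map M.l) (L.map (y ≫ M.toU adj c m)) := by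
    rw [hx₂, ← Category.assoc]
    exact (hX.paste_horiz (M.isPullback_toP adj c m)).map L
  obtain ⟨⟨s₁, s₂⟩, ⟨hs₁, hs₂, hs₃⟩, hs⟩ := M.isDistributivityPullback.terminal x' _ _ hL
  dsimp only at hs₁ hs₂ hs₃
  -- The base component of the solution in `C` is the name of a term of Π(A, B).
  let t₂ := cP.lift y s₂ (by rw [hs₃, L.map_comp])
  have ht₂ : t₂ ≫ cP.p = y := cP.lift_p _ _ _
  have ht₂' : L.map t₂ ≫ cP.gen = s₂ := cP.lift_gen _ _ _
  have hw := hX.w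
  simp only [Category.assoc] at hw
  obtain ⟨t₁, ht₁, ht₁'⟩ : ∃ t₁ : X ⟶ cA.ext, t₁ ≫ ρ = x ≫ cB.p ∧ t₁ ≫ cA.p = m₀ ≫ t₂ :=
    ⟨hA.lift (x ≫ cB.p) (m₀ ≫ t₂) (by rw [Category.assoc, hw, Category.assoc, ht₂]),
      IsPullback.lift_fst _ _ _ _, IsPullback.lift_snd _ _ _ _⟩
  refine ⟨(t₁, t₂), ⟨?_, ht₁', ht₂⟩, ?_⟩
  · refine cB.hom_ext ?_ ?_
    · rw [Category.assoc, ev_p, ht₁]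
    · have hs₁' : L.map t₁ ≫ M.toDom adj c m cP cA ρ hρ₁ = s₁ := by
        refine M.isDistributivityPullback.isPullback.hom_ext ?_ ?_
        · rw [Category.assoc, toDom_e_p, ← L.map_comp_assoc, ht₁, ← Category.assoc, hs₁, hx₂]
          simp
        · rw [Category.assoc, toDom_k, ← L.map_comp_assoc, ht₁', hs₂, L.map_comp,
            Category.assoc, ht₂']
      rw [L.map_comp, Category.assoc, ev_gen, reassoc_of% hs₁', reassoc_of% hs₁, hx₁]
  · rintro ⟨t₁', t₂'⟩ ⟨h₁, h₂, h₃⟩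
    dsimp only at h₁ h₂ h₃
    have hρ : t₁' ≫ ρ = x ≫ cB.p := by rw [← h₁, Category.assoc, ev_p]
    -- A competitor among contexts yields a competitor in `C`. Uniqueness there fixes the name of
    -- `t₂'`, hence `t₂'`, and the pullback `hA` then fixes `t₁'`.
    have e := hs (L.map t₁' ≫ M.toDom adj c m cP cA ρ hρ₁, L.map t₂' ≫ cP.gen) ⟨?_, ?_, ?_⟩
    · have e₂ : t₂' = t₂ := cP.hom_ext (by rw [h₃, ht₂]) (by rw [ht₂']; exact (Prod.mk.inj e).2)
      subst e₂
      exact Prod.ext (hA.hom_ext (by rw [hρ, ht₁]) (by rw [h₂, ht₁'])) rfl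
    · refine M.isPullback_q.hom_ext ?_ ?_
      · rw [hx₁, ← h₁, L.map_comp]
        simp only [Category.assoc, ev_gen]
      · rw [hx₂, ← Category.assoc x, ← hρ]
        simp only [Category.assoc, toDom_e_p, L.map_comp]
    · simp only [Category.assoc, toDom_k]
      rw [← L.map_comp_assoc, h₂, L.map_comp, Category.assoc]
    · simp only [Category.assoc, cP.gen_p]
      rw [← L.map_comp_assoc, h₃, L.map_comp]

/-- The evaluation map is stable under reindexing. -/
theorem ev_sub {Θ : D} (σ : Θ ⟶ Γ) {n₁ : G.obj Θ ⟶ V} (hn₁ : n₁ = G.map σ ≫ n)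
    (c₁ : NamedExt G E n₁) (r : c₁.ext ⟶ c.ext) (hr₁ : r ≫ c.p = c₁.p ≫ σ)
    (hr₂ : G.map r ≫ c.gen = c₁.gen) (m₁ : L.obj c₁.ext ⟶ W) (hm : m₁ = L.map r ≫ m)
    (cB₁ : NamedExt L F m₁) (cP₁ : NamedExt L M.ty (L.map (M.toU adj c₁ m₁)))
    {n₁' : G.obj cP₁.ext ⟶ V} (cA₁ : NamedExt G E n₁') (ρ₁ : cA₁.ext ⟶ c₁.ext)
    (hρ₁₁ : ρ₁ ≫ c₁.p = cA₁.p ≫ cP₁.p) (hρ₁₂ : G.map ρ₁ ≫ c₁.gen = cA₁.gen)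
    (rB : cB₁.ext ⟶ cB.ext) (hB₁ : rB ≫ cB.p = cB₁.p ≫ r) (hB₂ : L.map rB ≫ cB.gen = cB₁.gen)
    (rP : cP₁.ext ⟶ cP.ext) (hP₁ : rP ≫ cP.p = cP₁.p ≫ σ) (hP₂ : L.map rP ≫ cP.gen = cP₁.gen)
    (rA : cA₁.ext ⟶ cA.ext) (hA₁ : rA ≫ cA.p = cA₁.p ≫ rP)
    (hA₂ : G.map rA ≫ cA.gen = cA₁.gen) (hρ₂ : G.map ρ ≫ c.gen = cA.gen) :
    M.ev adj c₁ m₁ cB₁ cP₁ cA₁ ρ₁ hρ₁₁ ≫ rB = rA ≫ M.ev adj c m cB cP cA ρ hρ₁ := by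
  have hρ : ρ₁ ≫ r = rA ≫ ρ := by
    refine c.hom_ext ?_ ?_
    · simp only [Category.assoc, hr₁, hρ₁, reassoc_of% hρ₁₁, reassoc_of% hA₁, hP₁]
    · simp only [Functor.map_comp, Category.assoc, hr₂, hρ₂, hρ₁₂, hA₂]
  refine cB.hom_ext ?_ ?_
  · rw [Category.assoc, hB₁, ← Category.assoc, ev_p, Category.assoc, ev_p, hρ]
  · rw [L.map_comp, Category.assoc, hB₂, ev_gen, L.map_comp, Category.assoc, ev_gen]
    simp only [← Category.assoc]
    congr 2
    refine M.isDistributivityPullback.isPullback.hom_ext ?_ ?_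
    · simp only [Category.assoc, toDom_e_p]
      rw [(M.to_sub adj c m σ hn₁ c₁ r hr₁ hr₂ m₁ hm).1]
      simp only [← L.map_comp, reassoc_of% hρ]
    · simp only [Category.assoc, toDom_k]
      rw [← hP₂, ← L.map_comp_assoc, ← L.map_comp_assoc, hA₁]

end ev

end PiUniverse

end Pi

end NaturalPseudoModel

/-! ### The local universe of lifting problems for positive modalities. -/

namespace NaturalPseudoModel

section Fill

variable {D : Type u} [Category.{v} D] [HasPullbacks D] {C₁ : Type u₁} [Category.{v₁} C₁]
  {C₂ : Type u₂} [Category.{v₂} C₂] {C : Type u₃} [Category.{v₃} C]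
  {N₁ : NaturalPseudoModel.{v₁, u₁, v₄, u₄} C₁} {N₂ : NaturalPseudoModel.{v₂, u₂, v₅, u₅} C₂}
  {N : NaturalPseudoModel.{v₃, u₃, v₆, u₆} C}
  {G₁ : D ⥤ C₁} {H₁ : C₁ ⥤ D} (adj₁ : G₁ ⊣ H₁) {G₂ : D ⥤ C₂} {H₂ : C₂ ⥤ D} (adj₂ : G₂ ⊣ H₂)
  {L : D ⥤ C} {R : C ⥤ D} (adjL : L ⊣ R)
  {V₁ : C₁} {E : N₁.TyOver V₁} {V₂ : C₂} {F : N₂.TyOver V₂} {φ : H₁.obj V₁ ⟶ H₂.obj V₂}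
  {ψ : H₁.obj (N₁.ext E) ⟶ H₂.obj (N₂.ext F)}
  (hψ : ψ ≫ H₂.map (N₂.p F) = H₁.map (N₁.p E) ≫ φ)

/-- The local universe of the lifting problems against reindexings of `T`, for the reindexings
of the map induced by `ψ`. -/
structure FillUniverse (hψ : ψ ≫ H₂.map (N₂.p F) = H₁.map (N₁.p E) ≫ φ)
    {W : C} (T : N.TyOver W) extends
    SquareClassifier (pullback.snd (H₂.map (N₂.p F)) φ) (pullback.lift ψ (H₁.map (N₁.p E)) hψ)
      (R.map (N.p T)) where
  /-- the universal filler -/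
  s : L.obj P₁ ⟶ N.ext T
  s_p : s ≫ N.p T = (adjL.homEquiv _ _).symm b₁
  q_s : L.map q ≫ s = (adjL.homEquiv _ _).symm b₂

/-- The universal square, transposed along L ⊣ R, is a lifting problem for L(`M.q`) against p_T, and
`M.q` is a pullback of the map induced by ψ. One application of anodyneness solves it. -/
theorem FillUniverse.nonempty [HasTerminal D] (hD : IsLocallyCartesianClosed D) {W : C}
    (T : N.TyOver W)
    (hE : ∀ {P₁ P₂ : D} (a₁ : P₁ ⟶ _) (a₂ : P₂ ⟶ _) (q : P₂ ⟶ P₁),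
      IsPullback a₂ q (pullback.lift ψ (H₁.map (N₁.p E)) hψ) a₁ → N.Anodyne (L.map q)) :
    Nonempty (FillUniverse adjL hψ T) := by
  obtain ⟨M⟩ := hD.nonempty_squareClassifier (pullback.snd (H₂.map (N₂.p F)) φ)
    (pullback.lift ψ (H₁.map (N₁.p E)) hψ) (R.map (N.p T))
  -- Anodyne maps lift only against types over their own codomain, so T is first pulled back to
  -- L(`M.P₁`).
  obtain ⟨T', k, hk⟩ := N.exists_isPullback_p ((adjL.homEquiv _ _).symm M.b₁) T
  have hw : (adjL.homEquiv _ _).symm M.b₂ ≫ N.p T = L.map M.q ≫ (adjL.homEquiv _ _).symm M.b₁ := by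
    rw [← adjL.homEquiv_naturality_right_symm, M.w, adjL.homEquiv_naturality_left_symm]
  obtain ⟨s, hs₁, hs₂⟩ := hE _ _ _ M.isPullback₂ T' (hk.lift _ _ hw) (hk.lift_snd _ _ _)
  exact ⟨⟨M, s ≫ k, by rw [Category.assoc, hk.w, reassoc_of% hs₁],
    by rw [reassoc_of% hs₂, hk.lift_fst]⟩⟩

namespace FillUniverse

variable {adjL hψ} {W : C} {T : N.TyOver W} (M : FillUniverse adjL hψ T)
  {Γ : D} {n₁ : G₁.obj Γ ⟶ V₁} {n₂ : G₂.obj Γ ⟶ V₂}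
  (hn : adj₂.homEquiv _ _ n₂ = adj₁.homEquiv _ _ n₁ ≫ φ)
  (c₁ : NamedExt G₁ E n₁) (c₂ : NamedExt G₂ F n₂) (ℓ : c₁.ext ⟶ c₂.ext)
  (hℓ : ℓ ≫ c₂.p = c₁.p)
  (hℓ' : adj₂.homEquiv _ _ (G₂.map ℓ ≫ c₂.gen) = adj₁.homEquiv _ _ c₁.gen ≫ ψ)
  (m : L.obj c₂.ext ⟶ W) (t : L.obj c₁.ext ⟶ N.ext T) (ht : t ≫ N.p T = L.map ℓ ≫ m)

/-- The map from the comprehension of a reindexing of `F` to the universal comprehension. -/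
noncomputable def toBase : c₂.ext ⟶ pullback (H₂.map (N₂.p F)) φ :=
  pullback.lift (adj₂.homEquiv _ _ c₂.gen) (c₂.p ≫ adj₁.homEquiv _ _ n₁)
    (by rw [← adj₂.homEquiv_naturality_right, c₂.gen_p, adj₂.homEquiv_naturality_left, hn,
          Category.assoc])

/-- By `hn`, the transposed name of the second type factors through φ, so its comprehension is also
a pullback of the pulled-back projection over H₁ V₁. Both comprehensions thereby live over one base.
-/
theorem isPullback_toBase : IsPullback (toBase adj₁ adj₂ hn c₂) c₂.p
    (pullback.snd (H₂.map (N₂.p F)) φ) (adj₁.homEquiv _ _ n₁) := by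
  refine IsPullback.of_right ?_ (pullback.lift_snd _ _ _) (IsPullback.of_hasPullback _ _)
  rw [toBase, pullback.lift_fst, ← hn]
  exact c₂.isPullback adj₂

include hℓ hℓ' in
theorem isPullback_gen : IsPullback (adj₁.homEquiv _ _ c₁.gen) ℓ
    (pullback.lift ψ (H₁.map (N₁.p E)) hψ) (toBase adj₁ adj₂ hn c₂) := by
  -- Both comprehensions are pullbacks along the transpose of `n₁`; cancelling the lower square
  -- makes ℓ a pullback of the one map induced by ψ.
  refine IsPullback.of_bot ?_ ?_ (isPullback_toBase adj₁ adj₂ hn c₂)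
  · rw [hℓ, pullback.lift_snd]
    exact c₁.isPullback adj₁
  · refine pullback.hom_ext ?_ ?_
    · simp only [Category.assoc, toBase, pullback.lift_fst]
      rw [← hℓ', adj₂.homEquiv_naturality_left]
    · simp only [Category.assoc, toBase, pullback.lift_snd]
      rw [← adj₁.homEquiv_naturality_right, c₁.gen_p, adj₁.homEquiv_naturality_left,
        reassoc_of% hℓ]

include hℓ hℓ' ht in
theorem existsUnique_classify : ∃! k : (c₂.ext ⟶ M.P₁) × (c₁.ext ⟶ M.P₂) × (Γ ⟶ M.U),
    (k.1 ≫ M.a₁ = toBase adj₁ adj₂ hn c₂ ∧ k.1 ≫ M.b₁ = adjL.homEquiv _ _ m ∧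
      k.1 ≫ M.l = c₂.p ≫ k.2.2) ∧
    (k.2.1 ≫ M.a₂ = adj₁.homEquiv _ _ c₁.gen ∧ k.2.1 ≫ M.b₂ = adjL.homEquiv _ _ t ∧
      k.2.1 ≫ M.q = ℓ ≫ k.1) ∧ k.2.2 ≫ M.z = adj₁.homEquiv _ _ n₁ :=
  M.existsUnique _ _ ℓ _ _ (isPullback_toBase adj₁ adj₂ hn c₂)
    (isPullback_gen adj₁ adj₂ hn c₁ c₂ ℓ hℓ hℓ') _ _
    (by rw [← adjL.homEquiv_naturality_right, ht, adjL.homEquiv_naturality_left])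

/-- The name of the filler. -/
noncomputable def fillName : L.obj c₂.ext ⟶ N.ext T :=
  L.map (M.existsUnique_classify adj₁ adj₂ hn c₁ c₂ ℓ hℓ hℓ' m t ht).choose.1 ≫ M.s

theorem fillName_p : M.fillName adj₁ adj₂ hn c₁ c₂ ℓ hℓ hℓ' m t ht ≫ N.p T = m := by
  have h := (M.existsUnique_classify adj₁ adj₂ hn c₁ c₂ ℓ hℓ hℓ' m t ht).choose_spec.1.1.2.1
  rw [fillName, Category.assoc, M.s_p, ← adjL.homEquiv_naturality_left_symm, h,
    Equiv.symm_apply_apply]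

theorem map_fillName : L.map ℓ ≫ M.fillName adj₁ adj₂ hn c₁ c₂ ℓ hℓ hℓ' m t ht = t := by
  have h := (M.existsUnique_classify adj₁ adj₂ hn c₁ c₂ ℓ hℓ hℓ' m t ht).choose_spec.1.2.1
  rw [fillName, ← L.map_comp_assoc, ← h.2.2, L.map_comp, Category.assoc, M.q_s,
    ← adjL.homEquiv_naturality_left_symm, h.2.1, Equiv.symm_apply_apply]

/-- The filler name is the universal filler precomposed with L of a classifying map, so uniqueness
of classifying maps gives its stability. -/
theorem fillName_sub {Θ : D} (σ : Θ ⟶ Γ) {n₁' : G₁.obj Θ ⟶ V₁} {n₂' : G₂.obj Θ ⟶ V₂}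
    (hn' : adj₂.homEquiv _ _ n₂' = adj₁.homEquiv _ _ n₁' ≫ φ) (hσ : n₁' = G₁.map σ ≫ n₁)
    (c₁' : NamedExt G₁ E n₁') (c₂' : NamedExt G₂ F n₂') (ℓ₁ : c₁'.ext ⟶ c₂'.ext)
    (hℓ₁ : ℓ₁ ≫ c₂'.p = c₁'.p)
    (hℓ₁' : adj₂.homEquiv _ _ (G₂.map ℓ₁ ≫ c₂'.gen) = adj₁.homEquiv _ _ c₁'.gen ≫ ψ)
    (m' : L.obj c₂'.ext ⟶ W) (t' : L.obj c₁'.ext ⟶ N.ext T) (ht' : t' ≫ N.p T = L.map ℓ₁ ≫ m')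
    (r₁ : c₁'.ext ⟶ c₁.ext) (h₁ : r₁ ≫ c₁.p = c₁'.p ≫ σ) (h₁' : G₁.map r₁ ≫ c₁.gen = c₁'.gen)
    (r₂ : c₂'.ext ⟶ c₂.ext) (h₂ : r₂ ≫ c₂.p = c₂'.p ≫ σ) (h₂' : G₂.map r₂ ≫ c₂.gen = c₂'.gen)
    (hm : m' = L.map r₂ ≫ m) (htt : t' = L.map r₁ ≫ t) :
    M.fillName adj₁ adj₂ hn' c₁' c₂' ℓ₁ hℓ₁ hℓ₁' m' t' ht' =
      L.map r₂ ≫ M.fillName adj₁ adj₂ hn c₁ c₂ ℓ hℓ hℓ' m t ht := by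
  obtain ⟨⟨d₁, d₂, d₃⟩, ⟨d₄, d₅, d₆⟩, d₇⟩ :=
    (M.existsUnique_classify adj₁ adj₂ hn c₁ c₂ ℓ hℓ hℓ' m t ht).choose_spec.1
  -- That ℓ commutes with reindexing is not assumed: it follows because ℓ is determined by its
  -- projection and by the transposed name given by ψ.
  have hrℓ : r₁ ≫ ℓ = ℓ₁ ≫ r₂ := by
    refine c₂.hom_ext ?_ ?_
    · rw [Category.assoc, hℓ, h₁, Category.assoc, h₂, reassoc_of% hℓ₁]
    · refine (adj₂.homEquiv _ _).injective ?_
      rw [Functor.map_comp, Functor.map_comp, Category.assoc, Category.assoc, h₂', hℓ₁',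
        adj₂.homEquiv_naturality_left, hℓ', ← h₁', adj₁.homEquiv_naturality_left, Category.assoc]
  have key := (M.existsUnique_classify adj₁ adj₂ hn' c₁' c₂' ℓ₁ hℓ₁ hℓ₁' m' t' ht').unique
    (M.existsUnique_classify adj₁ adj₂ hn' c₁' c₂' ℓ₁ hℓ₁ hℓ₁' m' t' ht').choose_spec.1
    (y₂ := (r₂ ≫ (M.existsUnique_classify adj₁ adj₂ hn c₁ c₂ ℓ hℓ hℓ' m t ht).choose.1,
      r₁ ≫ (M.existsUnique_classify adj₁ adj₂ hn c₁ c₂ ℓ hℓ hℓ' m t ht).choose.2.1,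
      σ ≫ (M.existsUnique_classify adj₁ adj₂ hn c₁ c₂ ℓ hℓ hℓ' m t ht).choose.2.2))
    ⟨⟨?_, ?_, ?_⟩, ⟨?_, ?_, ?_⟩, ?_⟩
  · rw [fillName, key, L.map_comp, Category.assoc, fillName]
  · rw [Category.assoc, d₁]
    refine pullback.hom_ext ?_ ?_
    · simp only [Category.assoc, toBase, pullback.lift_fst]
      rw [← adj₂.homEquiv_naturality_left, h₂']
    · simp only [Category.assoc, toBase, pullback.lift_snd]
      rw [reassoc_of% h₂, hσ, adj₁.homEquiv_naturality_left]
  · rw [Category.assoc, d₂, hm, adjL.homEquiv_naturality_left]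
  · rw [Category.assoc, d₃, reassoc_of% h₂]
  · rw [Category.assoc, d₄, ← h₁', adj₁.homEquiv_naturality_left]
  · rw [Category.assoc, d₅, htt, adjL.homEquiv_naturality_left]
  · rw [Category.assoc, d₆, reassoc_of% hrℓ]
  · rw [Category.assoc, d₇, hσ, adj₁.homEquiv_naturality_left]

variable (cB : NamedExt L T m) (g : c₁.ext ⟶ cB.ext) (hg : g ≫ cB.p = ℓ)

/-- The filler. -/
noncomputable def fill : c₂.ext ⟶ cB.ext :=
  cB.lift (𝟙 _) (M.fillName adj₁ adj₂ hn c₁ c₂ ℓ hℓ hℓ' m (L.map g ≫ cB.gen) (cB.map_gen_p g hg))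
    (by rw [fillName_p, L.map_id, Category.id_comp])

theorem fill_p : M.fill adj₁ adj₂ hn c₁ c₂ ℓ hℓ hℓ' m cB g hg ≫ cB.p = 𝟙 _ :=
  cB.lift_p _ _ _

theorem map_fill_gen : L.map (M.fill adj₁ adj₂ hn c₁ c₂ ℓ hℓ hℓ' m cB g hg) ≫ cB.gen =
    M.fillName adj₁ adj₂ hn c₁ c₂ ℓ hℓ hℓ' m (L.map g ≫ cB.gen) (cB.map_gen_p g hg) :=
  cB.lift_gen _ _ _

theorem comp_fill : ℓ ≫ M.fill adj₁ adj₂ hn c₁ c₂ ℓ hℓ hℓ' m cB g hg = g := by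
  refine cB.hom_ext ?_ ?_
  · rw [Category.assoc, fill_p, Category.comp_id, hg]
  · rw [L.map_comp, Category.assoc, map_fill_gen, map_fillName]

/-- The filler is stable under reindexing. -/
theorem fill_sub {Θ : D} (σ : Θ ⟶ Γ) {n₁' : G₁.obj Θ ⟶ V₁} {n₂' : G₂.obj Θ ⟶ V₂}
    (hn' : adj₂.homEquiv _ _ n₂' = adj₁.homEquiv _ _ n₁' ≫ φ) (hσ : n₁' = G₁.map σ ≫ n₁)
    (c₁' : NamedExt G₁ E n₁') (c₂' : NamedExt G₂ F n₂') (ℓ₁ : c₁'.ext ⟶ c₂'.ext)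
    (hℓ₁ : ℓ₁ ≫ c₂'.p = c₁'.p)
    (hℓ₁' : adj₂.homEquiv _ _ (G₂.map ℓ₁ ≫ c₂'.gen) = adj₁.homEquiv _ _ c₁'.gen ≫ ψ)
    (m' : L.obj c₂'.ext ⟶ W) (cB' : NamedExt L T m') (g' : c₁'.ext ⟶ cB'.ext)
    (hg' : g' ≫ cB'.p = ℓ₁)
    (r₁ : c₁'.ext ⟶ c₁.ext) (h₁ : r₁ ≫ c₁.p = c₁'.p ≫ σ) (h₁' : G₁.map r₁ ≫ c₁.gen = c₁'.gen)
    (r₂ : c₂'.ext ⟶ c₂.ext) (h₂ : r₂ ≫ c₂.p = c₂'.p ≫ σ) (h₂' : G₂.map r₂ ≫ c₂.gen = c₂'.gen)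
    (hm : m' = L.map r₂ ≫ m) (rB : cB'.ext ⟶ cB.ext) (hB : rB ≫ cB.p = cB'.p ≫ r₂)
    (hB' : L.map rB ≫ cB.gen = cB'.gen) (hgg' : g' ≫ rB = r₁ ≫ g) :
    M.fill adj₁ adj₂ hn' c₁' c₂' ℓ₁ hℓ₁ hℓ₁' m' cB' g' hg' ≫ rB =
      r₂ ≫ M.fill adj₁ adj₂ hn c₁ c₂ ℓ hℓ hℓ' m cB g hg := by
  refine cB.hom_ext ?_ ?_
  · rw [Category.assoc, hB, ← Category.assoc, fill_p, Category.id_comp, Category.assoc, fill_p,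
      Category.comp_id]
  · rw [L.map_comp, Category.assoc, hB', map_fill_gen, L.map_comp, Category.assoc, map_fill_gen]
    refine M.fillName_sub adj₁ adj₂ hn c₁ c₂ ℓ hℓ hℓ' m _ _ σ hn' hσ c₁' c₂' ℓ₁ hℓ₁ hℓ₁' m' _ _
      r₁ h₁ h₁' r₂ h₂ h₂' hm ?_
    rw [← hB', ← L.map_comp_assoc, hgg', L.map_comp, Category.assoc]

end FillUniverse

end Fill

/-! ### From stably anodyne maps of the pre-model to pullbacks of the universal ℓ. -/

section anodyne

variable {D : Type u} [Category.{v} D] [HasPullbacks D] {D' : Type*} [Category* D']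
  {C₁ : Type u₁} [Category.{v₁} C₁]
  {C₂ : Type u₂} [Category.{v₂} C₂] {C : Type u₃} [Category.{v₃} C]
  {N₁ : NaturalPseudoModel.{v₁, u₁, v₄, u₄} C₁} {N₂ : NaturalPseudoModel.{v₂, u₂, v₅, u₅} C₂}
  {N : NaturalPseudoModel.{v₃, u₃, v₆, u₆} C}
  {H : C₁ ⥤ D'} {L₂ : D' ⥤ C₂} {R₂ : C₂ ⥤ D'} (adj₂ : L₂ ⊣ R₂) {K : D' ⥤ D}
  {L : D ⥤ C} {S : C₁ ⥤ C₂} {T : C₂ ⥤ C} (θ : H ⋙ L₂ ≅ S) (κ : K ⋙ L ≅ L₂ ⋙ T)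
  {V : C₁} {E : N₁.TyOver V} {F : N₂.TyOver (S.obj V)} {i : S.obj (N₁.ext E) ⟶ N₂.ext F}
  (hi : i ≫ N₂.p F = S.map (N₁.p E))

/-- The comparison of `H` with `R₂ ∘ S`. -/
def toReflected (X : C₁) : H.obj X ⟶ R₂.obj (S.obj X) := adj₂.homEquiv _ _ (θ.hom.app X)

theorem map_toReflected_counit (X : C₁) :
    L₂.map (toReflected adj₂ θ X) ≫ adj₂.counit.app _ = θ.hom.app X :=
  (adj₂.homEquiv_counit _ _ _).symm.trans (Equiv.symm_apply_apply _ _)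

-- Computes the transposed name of a positive modality: it is the transposed name of the original
-- type followed by φ, the image under K of `toReflected`. This supplies the hypothesis `hn` of
-- `FillUniverse`.
omit [HasPullbacks D] in
theorem homEquiv_map_comp {G : D' ⥤ C₁} (adj : G ⊣ H) {J : D ⥤ D'} (adjJ : J ⊣ K) {Γ : D}
    {X : C₁} (n : G.obj (J.obj Γ) ⟶ X) :
    (adjJ.comp adj₂).homEquiv Γ (S.obj X) (L₂.map (adj.homEquiv _ _ n) ≫ θ.hom.app X) =
      (adjJ.comp adj).homEquiv Γ X n ≫ K.map (toReflected adj₂ θ X) := by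
  rw [Adjunction.comp_homEquiv, Adjunction.comp_homEquiv]
  simp only [Equiv.trans_apply]
  rw [Adjunction.homEquiv_naturality_left, Adjunction.homEquiv_naturality_right]
  rfl

-- Supplies the commuting square `hψ` of `FillUniverse`, with ψ induced by i; it is naturality of θ,
-- transposed.
omit [HasPullbacks D] in
include hi in
theorem toReflected_comp : K.map (toReflected adj₂ θ (N₁.ext E) ≫ R₂.map i) ≫
    (R₂ ⋙ K).map (N₂.p F) = (H ⋙ K).map (N₁.p E) ≫ K.map (toReflected adj₂ θ V) := by
  rw [Functor.comp_map, Functor.comp_map, ← K.map_comp, ← K.map_comp, Category.assoc,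
    ← R₂.map_comp, hi, toReflected, toReflected, ← adj₂.homEquiv_naturality_right,
    ← adj₂.homEquiv_naturality_left]
  congr 2
  exact (θ.hom.naturality (N₁.p E)).symm

include κ in
/-- The pullbacks of the map induced by a stably anodyne map are sent to anodyne maps. -/
theorem anodyne_map_of_isPullback [PreservesFiniteLimits L] [R₂.Full] [R₂.Faithful]
    (hT : N.StablyAnodyne (T.map i)) {P₁ P₂ : D} (a₁ : P₁ ⟶ _) (a₂ : P₂ ⟶ _) (q : P₂ ⟶ P₁)
    (h : IsPullback a₂ q (pullback.lift (K.map (toReflected adj₂ θ (N₁.ext E) ≫ R₂.map i))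
      ((H ⋙ K).map (N₁.p E)) (toReflected_comp adj₂ θ hi)) a₁) : N.Anodyne (L.map q) := by
  let w := toReflected adj₂ θ V
  -- R₂ is fully faithful, so the counit is invertible; L₂(w) followed by it is a component of θ.
  have hw : IsIso (L₂.map w) := by
    have h₁ : IsIso (L₂.map w ≫ adj₂.counit.app (S.obj V)) := by
      rw [map_toReflected_counit]; infer_instance
    exact IsIso.of_isIso_comp_right (L₂.map w) (adj₂.counit.app (S.obj V))
  have hKw : IsIso (L.map (K.map w)) := by
    have h₁ : IsIso ((L₂ ⋙ T).map w) := by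
      rw [Functor.comp_map]; infer_instance
    exact ((NatIso.isIso_map_iff κ w).mpr h₁)
  -- L preserves this pullback and inverts K(w), so after applying L the codomain of the induced map
  -- is L K R₂ of the comprehension of F.
  have hpr : IsIso (L.map (pullback.fst ((R₂ ⋙ K).map (N₂.p F)) (K.map w))) :=
    ((IsPullback.of_hasPullback ((R₂ ⋙ K).map (N₂.p F)) (K.map w)).map L).isIso_fst_of_isIso
  -- L of the induced map is T(i) up to isomorphism. As L also preserves `h`, L(q) is a pullback of
  -- T(i), and stable anodyneness applies.
  have sq : IsPullback (κ.hom.app (H.obj (N₁.ext E)) ≫ T.map (θ.hom.app _))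
      (L.map (pullback.lift (K.map (toReflected adj₂ θ (N₁.ext E) ≫ R₂.map i))
        ((H ⋙ K).map (N₁.p E)) (toReflected_comp adj₂ θ hi))) (T.map i)
      (L.map (pullback.fst ((R₂ ⋙ K).map (N₂.p F)) (K.map w)) ≫
        κ.hom.app (R₂.obj (N₂.ext F)) ≫ T.map (adj₂.counit.app _)) := by
    refine IsPullback.of_horiz_isIso ⟨?_⟩
    rw [← L.map_comp_assoc, pullback.lift_fst]
    have h₁ := κ.hom.naturality (toReflected adj₂ θ (N₁.ext E) ≫ R₂.map i)
    rw [Functor.comp_map, Functor.comp_map] at h₁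
    rw [reassoc_of% h₁, Category.assoc, ← T.map_comp, ← T.map_comp]
    congr 2
    rw [L₂.map_comp, Category.assoc, adj₂.counit_naturality, ← Category.assoc,
      map_toReflected_counit]
  exact hT _ _ _ ((h.map L).paste_horiz sq)

end anodyne

end NaturalPseudoModel

/-! ### Adjoints of the actions of 1-cells. -/

/-- A 1-cell of `B`, as a 1-cell of `B^coop`. -/
abbrev Coop.homMk {B : Type u} [Bicategory.{w, v} B] {a b : B} (f : a ⟶ b) :
    (⟨b⟩ : Coop B) ⟶ ⟨a⟩ := Coop.Hom.mk f

/-- An adjunction of `B`, as an adjunction of `B^coop`. -/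
def Coop.adj {B : Type u} [Bicategory.{w, v} B] {a b : B} {f : a ⟶ b} {g : b ⟶ a} (h : f ⊣ g) :
    Bicategory.Adjunction (Coop.homMk f) (Coop.homMk g) where
  -- Reversing 1-cells exchanges left and right adjoints, and reversing 2-cells exchanges them back,
  -- together with unit and counit.
  unit := Coop.Hom₂.mk h.counit
  counit := Coop.Hom₂.mk h.unit
  left_triangle := by
    ext
    simpa [leftZigzag, bicategoricalComp] using h.left_triangle
  right_triangle := by
    ext
    simpa [rightZigzag, bicategoricalComp] using h.right_triangle

namespace ModalContext

variable {K : Type u} [Bicategory.{w, v} K] (D : ModalContext.{w, v, u, v₁, u₁} K)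

/-- The action of a modal context structure on an adjunction. -/
def lockAdj {p q : K} {μ : p ⟶ q} {ν : q ⟶ p} (h : μ ⊣ ν) : D.lock μ ⊣ D.lock ν :=
  Adjunction.ofCat (D.functor.mapAdjunction (Coop.adj h))

/-- The action of a modal context structure on an isomorphism of 1-cells. -/
def lockIso {p q : K} {μ ν : p ⟶ q} (e : μ ≅ ν) : D.lock μ ≅ D.lock ν :=
  Cat.Hom.toNatIso (D.functor.map₂Iso (Coop.isoMk (f := Coop.homMk μ) (g := Coop.homMk ν) e.symm))

end ModalContext

namespace ModalPreModel

variable {K : Type u} [Bicategory.{w, v} K] [Strict K]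
  (C : ModalPreModel.{w, v, u, v₁, u₁, v₂, u₂} K)

/-- The action of a modal pre-model on an adjunction. -/
def actAdj {p q : K} {μ : p ⟶ q} {ν : q ⟶ p} (h : μ ⊣ ν) : C.act μ ⊣ C.act ν :=
  Adjunction.ofCat (C.functor.mapAdjunction h)

/-- The action of a modal pre-model on an isomorphism of 1-cells. -/
def actIso {p q : K} {μ ν : p ⟶ q} (e : μ ≅ ν) : C.act μ ≅ C.act ν :=
  Cat.Hom.toNatIso (C.functor.map₂Iso e)

/-- The action of a modal pre-model on a composite. -/
def actComp {p q r : K} (μ : p ⟶ q) (ν : q ⟶ r) : C.act (μ ≫ ν) ≅ C.act μ ⋙ C.act ν :=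
  Cat.Hom.toNatIso (C.functor.mapComp μ ν)

end ModalPreModel

namespace AdjointModalPreModel

variable {L : Type u} [Bicategory.{w, v} L] [Strict L] {S : MorphismProperty L}
  (X : AdjointModalPreModel.{w, v, u, v₁, u₁, v₂, u₂} L S)

/-- The right adjoint of the reflection at a mode. -/
def inclusion (p : FreeAdj L S) : X.C.functor.obj p ⥤ X.context.Ctx p := X.incl p.base

/-- The reflections are left adjoints. -/
def reflectionAdj (p : FreeAdj L S) : X.reflection p ⊣ X.inclusion p := X.adj p.base

instance (p : FreeAdj L S) : (X.inclusion p).Full := X.incl_full p.base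

instance (p : FreeAdj L S) : (X.inclusion p).Faithful := X.incl_faithful p.base

/-- The right adjoint of the action of a 1-cell of `L`. -/
def unlock {p q : L} (μ : p ⟶ q) : X.context.Ctx ⟨p⟩ ⥤ X.context.Ctx ⟨q⟩ :=
  X.hat.lock (FreeAdj.dag μ trivial)

/-- The action of a 1-cell of `L` is a left adjoint. -/
def lockUnlockAdj {p q : L} (μ : p ⟶ q) :
    X.context.lock (FreeAdj.inl₁ μ : (⟨p⟩ : FreeAdj L S) ⟶ ⟨q⟩) ⊣ X.unlock μ :=
  X.hat.lockAdj (FreeAdj.adj μ trivial)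

/-- The reflections commute with the covariant actions of the 1-cells of `L`. -/
def unlockReflection {p q : L} (μ : p ⟶ q) :
    X.unlock μ ⋙ X.reflection ⟨q⟩ ≅
      X.reflection ⟨p⟩ ⋙ X.C.act (FreeAdj.inl₁ μ : (⟨p⟩ : FreeAdj L S) ⟶ ⟨q⟩) :=
  Cat.Hom.toNatIso (X.refl.naturality μ)

/-- Holds by definition because the comparison `FreeAdj.map` preserves the adjoined right adjoints.
-/
theorem lock_dag {p q : L} (μ : p ⟶ q) (hμ : S μ) :
    X.context.lock (FreeAdj.dag μ hμ) = X.unlock μ := rfl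

/-- A right adjoint of the action of a 1-cell followed by the reflection, compatible with the
covariant action on the pre-model. -/
structure RightAction {p q : FreeAdj L S} (ω : p ⟶ q) where
  /-- the right adjoint -/
  H : X.C.functor.obj p ⥤ X.context.Ctx q
  /-- the adjunction -/
  adj : X.context.lock ω ⋙ X.reflection p ⊣ H
  /-- the comparison with the covariant action -/
  θ : H ⋙ X.reflection q ≅ X.C.act ω

/-- The span form of a sharp 1-cell is what is needed here. Only the composite of `lock ω` with the
reflection has to be a left adjoint: a factor `lock` of some ν† need not be one by itself, but the
reflection converts it to C_ν, which is. -/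
theorem nonempty_rightAction {p q : FreeAdj L S} {ω : p ⟶ q} (h : FreeAdj.IsSpan S ω) :
    Nonempty (X.RightAction ω) := by
  have counitIso (p : FreeAdj L S) : X.inclusion p ⋙ X.reflection p ≅ 𝟭 _ :=
    asIso (X.reflectionAdj p).counit
  obtain ⟨p⟩ := p
  obtain ⟨q⟩ := q
  rcases h with ⟨μ, ⟨e⟩⟩ | ⟨r, ν, hν, μ, ⟨e⟩⟩
  · refine ⟨⟨X.inclusion ⟨p⟩ ⋙ X.unlock μ, ?_, ?_⟩⟩
    · exact ((X.lockUnlockAdj μ).comp (X.reflectionAdj ⟨p⟩)).ofNatIsoLeft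
        (Functor.isoWhiskerRight (X.context.lockIso e.symm) _)
    · exact Functor.associator _ _ _ ≪≫ Functor.isoWhiskerLeft _ (X.unlockReflection μ) ≪≫
        (Functor.associator _ _ _).symm ≪≫ Functor.isoWhiskerRight (counitIso ⟨p⟩) _ ≪≫
        Functor.leftUnitor _ ≪≫ X.C.actIso e.symm
  · refine ⟨⟨X.C.act (FreeAdj.dag ν hν) ⋙ X.inclusion ⟨r⟩ ⋙ X.unlock μ, ?_, ?_⟩⟩
    · refine (((X.lockUnlockAdj μ).comp (X.reflectionAdj ⟨r⟩)).comp
        (X.C.actAdj (FreeAdj.adj ν hν))).ofNatIsoLeft ?_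
      -- `lock` reverses composition, so it sends `dag ν hν ≫ inl₁ μ` to the lock of μ followed by
      -- the covariant action of ν, past which the reflection is moved.
      refine ?_ ≪≫ Functor.isoWhiskerRight (X.context.lockIso e.symm) _
      rw [X.context.lock_comp, X.lock_dag]
      exact Functor.associator _ _ _ ≪≫ Functor.isoWhiskerLeft _ (X.unlockReflection ν).symm ≪≫
        (Functor.associator _ _ _).symm
    · exact Functor.associator _ _ _ ≪≫ Functor.isoWhiskerLeft _ (Functor.associator _ _ _ ≪≫
        Functor.isoWhiskerLeft _ (X.unlockReflection μ) ≪≫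
        (Functor.associator _ _ _).symm ≪≫ Functor.isoWhiskerRight (counitIso ⟨r⟩) _ ≪≫
        Functor.leftUnitor _) ≪≫ (X.C.actComp _ _).symm ≪≫ X.C.actIso e.symm

end AdjointModalPreModel

/-! ### Representability and Π-structure. -/

namespace AdjointModalPreModel

open NaturalPseudoModel Comprehension

variable {L : Type u} [Bicategory.{w, v} L] [Strict L] {S : MorphismProperty L}
  (X : AdjointModalPreModel.{w, v, u, v₁, u₁, v₂, u₂} L S)

theorem context_isLocallyCartesianClosed (p : FreeAdj L S) :
    IsLocallyCartesianClosed (X.context.Ctx p) :=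
  X.isLocallyCartesianClosed ⟨p.base⟩

instance (p : FreeAdj L S) : HasTerminal (X.context.Ctx p) := X.context.hasTerminal p

instance (p : FreeAdj L S) :
    PreservesFiniteLimits (X.reflection p) :=
  X.preservesFiniteLimits p.base

instance (p : FreeAdj L S) : HasPullbacks (X.context.Ctx p) :=
  (X.context_isLocallyCartesianClosed p).choose

theorem isAdjointModalNaturalModel :
    IsAdjointModalNaturalModel (FreeAdj.modeTheory S) X.typing := by
  intro p q μ hμ Γ A
  obtain ⟨r⟩ := X.nonempty_rightAction hμ
  obtain ⟨c⟩ := NamedExt.nonempty r.adj (N := X.C.model p) (SplitTy.ty A) (SplitTy.name A)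
  exact ⟨NamedExt.comprehension (N := X.C.model p) (G := X.context.lock μ ⋙ X.reflection p) A c⟩

variable {X}

/-- The comprehension of a type at a sharp 1-cell, in terms of names. -/
noncomputable abbrev sharpExt
    (h : IsAdjointModalNaturalModel (FreeAdj.modeTheory S) X.typing) {p q : FreeAdj L S}
    {μ : p ⟶ q} (hμ : (FreeAdj.modeTheory S).sharp μ) {Γ : X.context.Ctx q}
    (A : (X.typing.TyAt μ).obj (op Γ)) :
    NamedExt (N := X.C.model p) (X.context.lock μ ⋙ X.reflection p)
      (SplitTy.ty A) (SplitTy.name A) :=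
  namedExt (h.comprSharp hμ A)

/-- The comprehension of a type at a transparent 1-cell, in terms of names. -/
noncomputable abbrev transparentExt
    (h : IsAdjointModalNaturalModel (FreeAdj.modeTheory S) X.typing) {p q : FreeAdj L S}
    {ϱ : p ⟶ q} (hϱ : (FreeAdj.modeTheory S).transparent ϱ) {Γ : X.context.Ctx q}
    (A : (X.typing.TyAt ϱ).obj (op Γ)) :
    NamedExt (N := X.C.model p) (X.context.lock ϱ ⋙ X.reflection p)
      (SplitTy.ty A) (SplitTy.name A) :=
  namedExt (h.comprTransparent hϱ A)

/-- The comprehension of a type at a composite 1-cell, in terms of names. -/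
noncomputable abbrev compExt
    (h : IsAdjointModalNaturalModel (FreeAdj.modeTheory S) X.typing) {p q r : FreeAdj L S}
    {μ : p ⟶ q} {ϱ : q ⟶ r} (hμ : (FreeAdj.modeTheory S).sharp μ)
    (hϱ : (FreeAdj.modeTheory S).transparent ϱ) {Γ : X.context.Ctx r}
    (A : (X.typing.TyAt μ).obj (op ((X.context.lock ϱ).obj Γ))) :
    NamedExt (N := X.C.model p) (X.context.lock ϱ ⋙ X.context.lock μ ⋙ X.reflection p)
      (SplitTy.ty A) (SplitTy.name A) :=
  namedExt (G := X.context.lock ϱ ⋙ X.context.lock μ ⋙ X.reflection p) (h.comprComp hμ hϱ A)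

/-- The ordinary comprehension of a type, in terms of names. -/
noncomputable abbrev idExt
    (h : IsAdjointModalNaturalModel (FreeAdj.modeTheory S) X.typing) {p : FreeAdj L S}
    {Γ : X.context.Ctx p} (A : (X.typing.Ty p).obj (op Γ)) :
    NamedExt (N := X.C.model p) (X.reflection p) (SplitTy.ty A) (SplitTy.name A) :=
  namedExt (h.compr A)

variable (X) in
/-- A choice of right adjoint at a sharp 1-cell. -/
noncomputable def rightAction {p q : FreeAdj L S} {μ : p ⟶ q}
    (hμ : (FreeAdj.modeTheory S).sharp μ) : X.RightAction μ :=
  (X.nonempty_rightAction hμ).some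

theorem nonempty_piUniverse (hPi : X.C.HasPrePi (FreeAdj.modeTheory S)) {p q : FreeAdj L S}
    {μ : p ⟶ q} (hμ : (FreeAdj.modeTheory S).sharp μ) {V : X.C.functor.obj p}
    (E : (X.C.model p).TyOver V) {W : X.C.functor.obj q} (F : (X.C.model q).TyOver W) :
    Nonempty (PiUniverse (X.rightAction hμ).H (X.reflectionAdj q) E F) := by
  refine PiUniverse.nonempty _ (X.context_isLocallyCartesianClosed q) E F ?_
  intro Y Z t δ b hδ
  -- Pre-Π-structure speaks of pullbacks of C_μ(p_E); θ identifies that map with the reflection of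
  -- H(p_E).
  refine hPi μ hμ E (t ≫ (X.rightAction hμ).θ.hom.app _) δ (b ≫ (X.rightAction hμ).θ.hom.app _) ?_
  exact hδ.paste_horiz (IsPullback.of_horiz_isIso
    ⟨((X.rightAction hμ).θ.hom.naturality ((X.C.model p).p E)).symm⟩)

section Pi

variable (hPi : X.C.HasPrePi (FreeAdj.modeTheory S))
  (h : IsAdjointModalNaturalModel (FreeAdj.modeTheory S) X.typing) {p q : FreeAdj L S}
  {μ : p ⟶ q} (hμ : (FreeAdj.modeTheory S).sharp μ)

/-- A choice of local universe for the types `Π(A, B)`. -/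
noncomputable def piUniverse {V : X.C.functor.obj p} (E : (X.C.model p).TyOver V)
    {W : X.C.functor.obj q} (F : (X.C.model q).TyOver W) :
    PiUniverse (X.rightAction hμ).H (X.reflectionAdj q) E F :=
  (nonempty_piUniverse hPi hμ E F).some

variable {Γ : X.context.Ctx q} (A : (X.typing.TyAt μ).obj (op Γ))
  (B : (X.typing.Ty q).obj (op (h.comprSharp hμ A).ext))

/-- The map that names the type `Π(A, B)`. -/
noncomputable def piName : Γ ⟶ (piUniverse hPi hμ (SplitTy.ty A) (SplitTy.ty B)).U :=
  (piUniverse hPi hμ (SplitTy.ty A) (SplitTy.ty B)).toU (X.rightAction hμ).adj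
    (sharpExt h hμ A) (SplitTy.name B)

/-- The type `Π(A, B)`. -/
noncomputable def pi : (X.typing.Ty q).obj (op Γ) :=
  (⟨_, (piUniverse hPi hμ (SplitTy.ty A) (SplitTy.ty B)).ty,
    (X.reflection q).map (piName hPi h hμ A B)⟩ : (X.C.model q).SplitTy ((X.reflection q).obj Γ))

/-- Substitution fixes the types over the local universes, so the same `piUniverse` serves both
sides and only the classifying maps, related by `to_sub`, have to be compared. -/
theorem pi_sub {Θ : X.context.Ctx q} (σ : Θ ⟶ Γ) (A' : (X.typing.TyAt μ).obj (op Θ))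
    (hA : A' = (X.typing.TyAt μ).map σ.op A)
    (B' : (X.typing.Ty q).obj (op (h.comprSharp hμ A').ext))
    (hB : B' = (X.typing.Ty q).map (reindex (h.comprSharp hμ A') (h.comprSharp hμ A) σ hA).op B) :
    pi hPi h hμ A' B' = (X.typing.Ty q).map σ.op (pi hPi h hμ A B) := by
  subst hA
  subst hB
  have := ((piUniverse hPi hμ (SplitTy.ty A) (SplitTy.ty B)).to_sub (X.rightAction hμ).adj
    (sharpExt h hμ A) (SplitTy.name B) σ rfl (sharpExt h hμ ((X.typing.TyAt μ).map σ.op A))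
    (reindex (h.comprSharp hμ _) (h.comprSharp hμ A) σ rfl) (reindex_p _ _ _ _)
    (map_reindex_gen (G := X.context.lock μ ⋙ X.reflection p) σ (h.comprSharp hμ _)
      (h.comprSharp hμ A)) _ rfl).2
  exact congrArg (SplitTy.mk _ _) ((congrArg (X.reflection q).map this).trans
    ((X.reflection q).map_comp _ _))

/-- The evaluation map of `Π(A, B)`. -/
noncomputable def piEv :
    (h.comprSharp hμ ((X.typing.TyAt μ).map (h.compr (pi hPi h hμ A B)).p.op A)).ext ⟶
      (h.compr B).ext :=
  (piUniverse hPi hμ (SplitTy.ty A) (SplitTy.ty B)).ev (X.rightAction hμ).adj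
    (sharpExt h hμ A) (SplitTy.name B) (idExt h B) (idExt h (pi hPi h hμ A B))
    (sharpExt h hμ ((X.typing.TyAt μ).map (h.compr (pi hPi h hμ A B)).p.op A))
    (reindex (h.comprSharp hμ _) (h.comprSharp hμ A) (h.compr (pi hPi h hμ A B)).p rfl)
    (reindex_p _ _ _ _)

theorem piEv_sub {Θ : X.context.Ctx q} (σ : Θ ⟶ Γ) (A' : (X.typing.TyAt μ).obj (op Θ))
    (hA : A' = (X.typing.TyAt μ).map σ.op A)
    (B' : (X.typing.Ty q).obj (op (h.comprSharp hμ A').ext))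
    (hB : B' = (X.typing.Ty q).map (reindex (h.comprSharp hμ A') (h.comprSharp hμ A) σ hA).op B) :
    piEv hPi h hμ A' B' ≫ reindex (h.compr B') (h.compr B) _ hB =
      reindex (h.comprSharp hμ _) (h.comprSharp hμ _)
        (reindex (h.compr _) (h.compr _) σ (pi_sub hPi h hμ A B σ A' hA B' hB))
        (map_p _ _ _ _ hA) ≫ piEv hPi h hμ A B := by
  subst hA
  subst hB
  let A' := (X.typing.TyAt μ).map σ.op A
  let u := reindex (h.comprSharp hμ A') (h.comprSharp hμ A) σ rfl
  let B' := (X.typing.Ty q).map u.op B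
  exact (piUniverse hPi hμ (SplitTy.ty A) (SplitTy.ty B)).ev_sub (X.rightAction hμ).adj
    (sharpExt h hμ A) (SplitTy.name B) (idExt h B) (idExt h (pi hPi h hμ A B))
    (sharpExt h hμ ((X.typing.TyAt μ).map (h.compr (pi hPi h hμ A B)).p.op A))
    (reindex (h.comprSharp hμ _) (h.comprSharp hμ A) (h.compr (pi hPi h hμ A B)).p rfl)
    (reindex_p _ _ _ _) σ rfl (sharpExt h hμ A') u (reindex_p _ _ _ _)
    (map_reindex_gen (G := X.context.lock μ ⋙ X.reflection p) _ _ _) _ rfl (idExt h B')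
    (idExt h (pi hPi h hμ A' B'))
    (sharpExt h hμ ((X.typing.TyAt μ).map (h.compr (pi hPi h hμ A' B')).p.op A'))
    (reindex (h.comprSharp hμ _) (h.comprSharp hμ A') (h.compr (pi hPi h hμ A' B')).p rfl)
    (reindex_p _ _ _ _)
    (map_reindex_gen (G := X.context.lock μ ⋙ X.reflection p) _ _ _)
    _ (reindex_p _ _ _ _) (map_reindex_gen (G := X.reflection q) _ _ _)
    -- The type Π(A', B') is a reindexing of Π(A, B) only by the proved equality `pi_sub`, so
    -- `map_reindex_gen`, which wants it definitionally, is replaced by `map_lift_gen`.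
    _ (reindex_p _ _ _ _) (map_lift_gen (G := X.reflection q) _ _ _ _ (namedExt_var _))
    (reindex (h.comprSharp hμ _) (h.comprSharp hμ _) (reindex (h.compr _) (h.compr _) σ
      (pi_sub hPi h hμ A B σ A' rfl B' rfl)) (map_p _ _ _ _ rfl)) (reindex_p _ _ _ _)
    (map_lift_gen (G := X.context.lock μ ⋙ X.reflection p) _ _ _ _ (namedExt_var
      (G := X.context.lock μ ⋙ X.reflection p)
      (h.comprSharp hμ ((X.typing.TyAt μ).map (h.compr (pi hPi h hμ A' B')).p.op A'))))
    (map_reindex_gen (G := X.context.lock μ ⋙ X.reflection p) _ _ _)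

/-- The `Π`-structure. -/
noncomputable def piStructure : PiStructure h where
  Pi hμ _ A B := pi hPi h hμ A B
  Pi_sub hμ _ _ σ A B A' hA B' hB := pi_sub hPi h hμ A B σ A' hA B' hB
  ev hμ _ A B := piEv hPi h hμ A B
  ev_p _ _ _ _ := PiUniverse.ev_p ..
  ev_sub hμ _ _ σ A B A' hA B' hB := piEv_sub hPi h hμ A B σ A' hA B' hB
  isDistributivityPullback {p _ μ} hμ _ A B :=
    PiUniverse.isDistributivityPullback_ev (X.rightAction hμ).adj
      (piUniverse hPi hμ (SplitTy.ty A) (SplitTy.ty B)) (sharpExt h hμ A)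
      (SplitTy.name B) (idExt h B) (idExt h (pi hPi h hμ A B)) rfl 
      (sharpExt h hμ ((X.typing.TyAt μ).map (h.compr (pi hPi h hμ A B)).p.op A))
      (reindex (h.comprSharp hμ _) (h.comprSharp hμ A) (h.compr (pi hPi h hμ A B)).p rfl)
      (reindex_p _ _ _ _) (map_reindex_gen (G := X.context.lock μ ⋙ X.reflection p) _ _ _)

end Pi

end AdjointModalPreModel

/-! ### Positive modalities. -/

namespace AdjointModalPreModel

open NaturalPseudoModel Comprehension

variable {L : Type u} [Bicategory.{w, v} L] [Strict L] {S : MorphismProperty L}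
  {X : AdjointModalPreModel.{w, v, u, v₁, u₁, v₂, u₂} L S}

variable (X) in
/-- A right adjoint of the action of a transparent 1-cell, compatible with the covariant action on
the pre-model. -/
structure TransparentAction {q r : FreeAdj L S} (ϱ : q ⟶ r) where
  /-- the right adjoint -/
  K : X.context.Ctx q ⥤ X.context.Ctx r
  /-- the adjunction -/
  adj : X.context.lock ϱ ⊣ K
  /-- the comparison with the covariant action -/
  κ : K ⋙ X.reflection r ≅ X.reflection q ⋙ X.C.act ϱ

variable (X) in
theorem nonempty_transparentAction {q r : FreeAdj L S} {ϱ : q ⟶ r}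
    (h : (FreeAdj.modeTheory S).transparent ϱ) : Nonempty (X.TransparentAction ϱ) := by
  obtain ⟨ϱ', rfl⟩ := h
  exact ⟨⟨X.unlock ϱ', X.lockUnlockAdj ϱ', X.unlockReflection ϱ'⟩⟩

variable (X) in
/-- A choice of right adjoint at a transparent 1-cell. -/
noncomputable def transparentAction {q r : FreeAdj L S} {ϱ : q ⟶ r}
    (hϱ : (FreeAdj.modeTheory S).transparent ϱ) : X.TransparentAction ϱ :=
  (X.nonempty_transparentAction hϱ).some

section Positive

variable {p q r : FreeAdj L S} {μ : p ⟶ q} (hμ : (FreeAdj.modeTheory S).sharp μ) {ϱ : q ⟶ r}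
  (hϱ : (FreeAdj.modeTheory S).transparent ϱ)

/-- The name of the image of a type or a term under a positive modality. -/
noncomputable def posName {Γ : X.context.Ctx q} {V : X.C.functor.obj p}
    (n : (X.context.lock μ ⋙ X.reflection p).obj Γ ⟶ V) :
    (X.reflection q).obj Γ ⟶ (X.C.act μ).obj V :=
  (X.reflection q).map ((X.rightAction hμ).adj.homEquiv _ _ n) ≫
    (X.rightAction hμ).θ.hom.app V

/-- Naturality in the context makes F_μ and j strict morphisms of presheaves. -/
theorem posName_map_comp {Γ Θ : X.context.Ctx q} (σ : Θ ⟶ Γ) {V : X.C.functor.obj p}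
    (n : (X.context.lock μ ⋙ X.reflection p).obj Γ ⟶ V) :
    posName hμ ((X.context.lock μ ⋙ X.reflection p).map σ ≫ n) =
      (X.reflection q).map σ ≫ posName hμ n := by
  rw [posName, Adjunction.homEquiv_naturality_left, Functor.map_comp, Category.assoc, posName]

theorem posName_comp {Γ : X.context.Ctx q} {V W : X.C.functor.obj p}
    (n : (X.context.lock μ ⋙ X.reflection p).obj Γ ⟶ V) (f : V ⟶ W) :
    posName hμ (n ≫ f) = posName hμ n ≫ (X.C.act μ).map f := by
  rw [posName, Adjunction.homEquiv_naturality_right, Functor.map_comp, Category.assoc, posName,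
    Category.assoc]
  exact congrArg _ ((X.rightAction hμ).θ.hom.naturality f)

theorem homEquiv_posName {Γ : X.context.Ctx r} {V : X.C.functor.obj p}
    (n : (X.context.lock ϱ ⋙ X.context.lock μ ⋙ X.reflection p).obj Γ ⟶ V) :
    ((X.transparentAction hϱ).adj.comp (X.reflectionAdj q)).homEquiv _ _ (posName hμ n) =
      ((X.transparentAction hϱ).adj.comp (X.rightAction hμ).adj).homEquiv _ _ n ≫
        (X.transparentAction hϱ).K.map
          (toReflected (X.reflectionAdj q) (X.rightAction hμ).θ V) :=
  homEquiv_map_comp _ _ _ _ _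

theorem homEquiv_posName_comp {Γ : X.context.Ctx r} {V : X.C.functor.obj p}
    {W : X.C.functor.obj q}
    (n : (X.context.lock ϱ ⋙ X.context.lock μ ⋙ X.reflection p).obj Γ ⟶ V)
    (f : (X.C.act μ).obj V ⟶ W) :
    ((X.transparentAction hϱ).adj.comp (X.reflectionAdj q)).homEquiv _ _ (posName hμ n ≫ f) =
      ((X.transparentAction hϱ).adj.comp (X.rightAction hμ).adj).homEquiv _ _ n ≫
        (X.transparentAction hϱ).K.map
          (toReflected (X.reflectionAdj q) (X.rightAction hμ).θ V ≫ (X.inclusion q).map f) := by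
  rw [Adjunction.homEquiv_naturality_right, homEquiv_posName, Functor.map_comp, Category.assoc]
  rfl

variable (hpos : X.C.HasPositivePreModalities (FreeAdj.modeTheory S))
  {V : X.C.functor.obj p} (E : (X.C.model p).TyOver V)

/-- A choice of type for a positive modality. -/
noncomputable def posTy : (X.C.model q).TyOver ((X.C.act μ).obj V) := (hpos μ hμ E).choose

/-- A choice of introduction map for a positive modality. -/
noncomputable def posMap :
    (X.C.act μ).obj ((X.C.model p).ext E) ⟶ (X.C.model q).ext (posTy hμ hpos E) :=
  (hpos μ hμ E).choose_spec.choose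

theorem posMap_p : posMap hμ hpos E ≫ (X.C.model q).p (posTy hμ hpos E) =
    (X.C.act μ).map ((X.C.model p).p E) :=
  (hpos μ hμ E).choose_spec.choose_spec.1

include hϱ in
theorem stablyAnodyne_map_posMap :
    (X.C.model r).StablyAnodyne ((X.C.act ϱ).map (posMap hμ hpos E)) :=
  (hpos μ hμ E).choose_spec.choose_spec.2 ϱ hϱ

/-- The local universes of the lifting problems for a positive modality. -/
abbrev PosUniverse {W : X.C.functor.obj r} (T : (X.C.model r).TyOver W) :=
  FillUniverse (X.reflectionAdj r) (H₁ := (X.rightAction hμ).H ⋙ (X.transparentAction hϱ).K)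
    (H₂ := X.inclusion q ⋙ (X.transparentAction hϱ).K) (E := E) (F := posTy hμ hpos E)
    (toReflected_comp (K := (X.transparentAction hϱ).K)
      (X.reflectionAdj q) (X.rightAction hμ).θ (posMap_p hμ hpos E)) T

/-- Here κ is the pseudonaturality isomorphism at ϱ: it brings C_ϱ(i) into play, which explains why
positive pre-modalities demand anodyneness after every transparent action. -/
theorem nonempty_posUniverse {W : X.C.functor.obj r} (T : (X.C.model r).TyOver W) :
    Nonempty (PosUniverse hμ hϱ hpos E T) :=
  FillUniverse.nonempty _ _ (X.context_isLocallyCartesianClosed r) T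
    (fun a₁ a₂ q h => anodyne_map_of_isPullback _ _ (X.transparentAction hϱ).κ
      (posMap_p hμ hpos E)
      (stablyAnodyne_map_posMap hμ hϱ hpos E) a₁ a₂ q h)

/-- A choice of local universe for the lifting problems. -/
noncomputable def posUniverse {W : X.C.functor.obj r} (T : (X.C.model r).TyOver W) :
    PosUniverse hμ hϱ hpos E T :=
  (nonempty_posUniverse hμ hϱ hpos E T).some

end Positive

section Positive

variable (hpos : X.C.HasPositivePreModalities (FreeAdj.modeTheory S))

/-- The formation and introduction operations of the positive modalities. -/
noncomputable def positiveIntro : PositiveIntro (FreeAdj.modeTheory S) X.typing where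
  F {p q μ} hμ :=
    { app Γ := ↾fun A => (⟨_, posTy hμ hpos (SplitTy.ty A), posName hμ (SplitTy.name A)⟩ :
        (X.C.model q).SplitTy ((X.reflection q).obj Γ.unop))
      naturality Γ Θ σ := by
        ext A
        exact congrArg (SplitTy.mk _ _) (posName_map_comp hμ σ.unop (SplitTy.name A)) }
  j {p q μ} hμ :=
    { app Γ := ↾fun a => (⟨_, posTy hμ hpos (SplitTm.ty a),
        posName hμ (SplitTm.name a) ≫ posMap hμ hpos (SplitTm.ty a)⟩ :
        (X.C.model q).SplitTm ((X.reflection q).obj Γ.unop))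
      naturality Γ Θ σ := by
        ext a
        exact congrArg (SplitTm.mk _ _)
          ((congrArg (· ≫ posMap hμ hpos _) (posName_map_comp hμ σ.unop (SplitTm.name a))).trans
            (Category.assoc _ _ _)) }
  j_tp {p q μ} hμ := by
    ext Γ a
    exact congrArg (SplitTy.mk _ _) ((Category.assoc _ _ _).trans
      ((congrArg (posName hμ (SplitTm.name a) ≫ ·) (posMap_p hμ hpos _)).trans
        (posName_comp hμ _ _).symm))

variable (h : IsAdjointModalNaturalModel (FreeAdj.modeTheory S) X.typing) {p q r : FreeAdj L S}
  {μ : p ⟶ q} (hμ : (FreeAdj.modeTheory S).sharp μ) {ϱ : q ⟶ r}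
  (hϱ : (FreeAdj.modeTheory S).transparent ϱ) {Γ : X.context.Ctx r}
  (A : (X.typing.TyAt μ).obj (op ((X.context.lock ϱ).obj Γ)))

theorem map_ell_gen : (X.context.lock ϱ ⋙ X.reflection q).map
    ((positiveIntro hpos).ell h hμ hϱ A) ≫
      (transparentExt h hϱ ((positiveIntro hpos).FAt ϱ hμ A)).gen =
    posName hμ (compExt h hμ hϱ A).gen ≫ posMap hμ hpos (SplitTy.ty A) :=
  map_lift_gen (G := X.context.lock ϱ ⋙ X.reflection q) _ _ _ _
    (congrArg (((positiveIntro hpos).j hμ).app _) (namedExt_var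
      (G := X.context.lock ϱ ⋙ X.context.lock μ ⋙ X.reflection p) (h.comprComp hμ hϱ A)))

/-- Identifies ℓ with a reindexing of the universal map: this is the hypothesis on ℓ and ψ that
`FillUniverse` requires. -/
theorem homEquiv_map_ell_gen :
    ((X.transparentAction hϱ).adj.comp (X.reflectionAdj q)).homEquiv _ _
      ((X.context.lock ϱ ⋙ X.reflection q).map ((positiveIntro hpos).ell h hμ hϱ A) ≫
        (transparentExt h hϱ ((positiveIntro hpos).FAt ϱ hμ A)).gen) =
    ((X.transparentAction hϱ).adj.comp (X.rightAction hμ).adj).homEquiv _ _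
      (compExt h hμ hϱ A).gen ≫ (X.transparentAction hϱ).K.map
        (toReflected (X.reflectionAdj q) (X.rightAction hμ).θ _ ≫
          (X.inclusion q).map (posMap hμ hpos (SplitTy.ty A))) :=
  (congrArg _ (map_ell_gen hpos h hμ hϱ A)).trans (homEquiv_posName_comp hμ hϱ _ _)

variable (B : (X.typing.Ty r).obj (op (h.comprTransparent hϱ ((positiveIntro hpos).FAt ϱ hμ A)).ext))
  (g : (h.comprComp hμ hϱ A).ext ⟶ (h.compr B).ext)
  (hg : g ≫ (h.compr B).p = (positiveIntro hpos).ell h hμ hϱ A)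

/-- The filler for a positive modality. -/
noncomputable def posFill :
    (h.comprTransparent hϱ ((positiveIntro hpos).FAt ϱ hμ A)).ext ⟶ (h.compr B).ext :=
  (posUniverse hμ hϱ hpos (SplitTy.ty A) (SplitTy.ty B)).fill
    ((X.transparentAction hϱ).adj.comp (X.rightAction hμ).adj)
    ((X.transparentAction hϱ).adj.comp (X.reflectionAdj q))
    (homEquiv_posName hμ hϱ (SplitTy.name A)) (compExt h hμ hϱ A)
    (transparentExt h hϱ ((positiveIntro hpos).FAt ϱ hμ A))
    ((positiveIntro hpos).ell h hμ hϱ A) (lift_p _ _ _ _)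
    (homEquiv_map_ell_gen hpos h hμ hϱ A) (SplitTy.name B) (idExt h B) g hg

theorem ell_posFill :
    (positiveIntro hpos).ell h hμ hϱ A ≫ posFill hpos h hμ hϱ A B g hg = g :=
  (posUniverse hμ hϱ hpos (SplitTy.ty A) (SplitTy.ty B)).comp_fill
    ((X.transparentAction hϱ).adj.comp (X.rightAction hμ).adj)
    ((X.transparentAction hϱ).adj.comp (X.reflectionAdj q))
    (homEquiv_posName hμ hϱ (SplitTy.name A)) (compExt h hμ hϱ A)
    (transparentExt h hϱ ((positiveIntro hpos).FAt ϱ hμ A))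
    ((positiveIntro hpos).ell h hμ hϱ A) (lift_p _ _ _ _)
    (homEquiv_map_ell_gen hpos h hμ hϱ A) (SplitTy.name B) (idExt h B) g hg

theorem posFill_sub {Θ : X.context.Ctx r} (σ : Θ ⟶ Γ)
    (A' : (X.typing.TyAt μ).obj (op ((X.context.lock ϱ).obj Θ)))
    (hA : A' = (X.typing.TyAt μ).map ((X.context.lock ϱ).map σ).op A)
    (B' : (X.typing.Ty r).obj
      (op (h.comprTransparent hϱ ((positiveIntro hpos).FAt ϱ hμ A')).ext))
    (hB : B' = (X.typing.Ty r).map (reindex (h.comprTransparent hϱ _) (h.comprTransparent hϱ _) σ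
      ((positiveIntro hpos).FAt_sub ϱ hμ σ A A' hA)).op B)
    (g' : (h.comprComp hμ hϱ A').ext ⟶ (h.compr B').ext)
    (hg' : g' ≫ (h.compr B').p = (positiveIntro hpos).ell h hμ hϱ A')
    (hgg' : g' ≫ reindex (h.compr B') (h.compr B) _ hB =
      reindex (h.comprComp hμ hϱ A') (h.comprComp hμ hϱ A) σ hA ≫ g) :
    posFill hpos h hμ hϱ A' B' g' hg' ≫ reindex (h.compr B') (h.compr B) _ hB =
      reindex (h.comprTransparent hϱ _) (h.comprTransparent hϱ _) σ
        ((positiveIntro hpos).FAt_sub ϱ hμ σ A A' hA) ≫ posFill hpos h hμ hϱ A B g hg := by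
  subst hA
  subst hB
  let A' := (X.typing.TyAt μ).map ((X.context.lock ϱ).map σ).op A
  let u := reindex (h.comprTransparent hϱ ((positiveIntro hpos).FAt ϱ hμ A'))
    (h.comprTransparent hϱ ((positiveIntro hpos).FAt ϱ hμ A)) σ
    ((positiveIntro hpos).FAt_sub ϱ hμ σ A A' rfl)
  let B' := (X.typing.Ty r).map u.op B
  exact (posUniverse hμ hϱ hpos (SplitTy.ty A) (SplitTy.ty B)).fill_sub
    ((X.transparentAction hϱ).adj.comp (X.rightAction hμ).adj)
    ((X.transparentAction hϱ).adj.comp (X.reflectionAdj q))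
    (homEquiv_posName hμ hϱ (SplitTy.name A)) (compExt h hμ hϱ A)
    (transparentExt h hϱ ((positiveIntro hpos).FAt ϱ hμ A))
    ((positiveIntro hpos).ell h hμ hϱ A) (lift_p _ _ _ _)
    (homEquiv_map_ell_gen hpos h hμ hϱ A) (SplitTy.name B) (idExt h B) g hg σ
    (homEquiv_posName hμ hϱ (SplitTy.name A')) rfl (compExt h hμ hϱ A')
    (transparentExt h hϱ ((positiveIntro hpos).FAt ϱ hμ A'))
    ((positiveIntro hpos).ell h hμ hϱ A') (lift_p _ _ _ _)
    (homEquiv_map_ell_gen hpos h hμ hϱ A') (SplitTy.name B') (idExt h B') g' hg'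
    (reindex (h.comprComp hμ hϱ A') (h.comprComp hμ hϱ A) σ rfl) (reindex_p _ _ _ _)
    (map_reindex_gen (G := X.context.lock ϱ ⋙ X.context.lock μ ⋙ X.reflection p) σ
      (h.comprComp hμ hϱ A') (h.comprComp hμ hϱ A))
    u (reindex_p _ _ _ _)
    (map_lift_gen (G := X.context.lock ϱ ⋙ X.reflection q) _ _ _ _ (namedExt_var
      (G := X.context.lock ϱ ⋙ X.reflection q)
      (h.comprTransparent hϱ ((positiveIntro hpos).FAt ϱ hμ A'))))
    rfl (reindex (h.compr B') (h.compr B) u rfl) (reindex_p _ _ _ _)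
    (map_reindex_gen (G := X.reflection r) u (h.compr B') (h.compr B)) hgg'

/-- The positive modalities. -/
noncomputable def positiveModalities : PositiveModalities h where
  toPositiveIntro := positiveIntro hpos
  fill hμ hϱ _ A B g hg := posFill hpos h hμ hϱ A B g hg
  fill_p _ _ _ _ _ _ _ := FillUniverse.fill_p ..
  ell_fill hμ hϱ _ A B g hg := ell_posFill hpos h hμ hϱ A B g hg
  fill_sub hμ hϱ _ _ σ A B g hg A' hA B' hB g' hg' hgg' :=
    posFill_sub hpos h hμ hϱ A B g hg σ A' hA B' hB g' hg' hgg'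

end Positive

end AdjointModalPreModel

/-! ### Negative modalities. -/

namespace AdjointModalPreModel

open NaturalPseudoModel

variable {L : Type u} [Bicategory.{w, v} L] [Strict L] {S : MorphismProperty L}
  {X : AdjointModalPreModel.{w, v, u, v₁, u₁, v₂, u₂} L S}
  {p q : FreeAdj L S} {μ : p ⟶ q} (hμ : (FreeAdj.modeTheory S).sinister μ)

variable (X) in
/-- The reflections commute with the actions of the right adjoint of a sinister 1-cell. -/
noncomputable def daggerReflection :
    X.context.lock ((FreeAdj.modeTheory S).dagger μ hμ) ⋙ X.reflection q ≅
      X.reflection p ⋙ X.C.act μ :=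
  X.unlockReflection hμ.choose ≪≫
    Functor.isoWhiskerLeft _ (X.C.actIso (eqToIso hμ.choose_spec.2.symm))

/-- The name of the image of a type or a term under a negative modality. -/
noncomputable def negName (Γ : X.context.Ctx p) (V : X.C.functor.obj q) :
    ((X.context.lock ((FreeAdj.modeTheory S).dagger μ hμ) ⋙ X.reflection q).obj Γ ⟶ V) ≃
      ((X.reflection p).obj Γ ⟶ (X.C.act ((FreeAdj.modeTheory S).dagger μ hμ)).obj V) :=
  ((X.daggerReflection hμ).app Γ).homCongr (Iso.refl V) |>.trans
    ((X.C.actAdj ((FreeAdj.modeTheory S).daggerAdj μ hμ)).homEquiv _ _)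

theorem negName_map_comp {Γ Θ : X.context.Ctx p} (σ : Θ ⟶ Γ) {V : X.C.functor.obj q}
    (n : (X.context.lock ((FreeAdj.modeTheory S).dagger μ hμ) ⋙ X.reflection q).obj Γ ⟶ V) :
    negName hμ Θ V
      ((X.context.lock ((FreeAdj.modeTheory S).dagger μ hμ) ⋙ X.reflection q).map σ ≫ n) =
      (X.reflection p).map σ ≫ negName hμ Γ V n := by
  have h := (X.daggerReflection hμ).inv.naturality_assoc σ n
  simp only [negName, Equiv.trans_apply, Iso.homCongr_apply, Iso.refl_hom, Category.comp_id,
    Iso.app_inv]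
  rw [← Adjunction.homEquiv_naturality_left]
  exact congrArg _ h.symm

theorem negName_comp {Γ : X.context.Ctx p} {V W : X.C.functor.obj q}
    (n : (X.context.lock ((FreeAdj.modeTheory S).dagger μ hμ) ⋙ X.reflection q).obj Γ ⟶ V)
    (f : V ⟶ W) :
    negName hμ Γ W (n ≫ f) =
      negName hμ Γ V n ≫ (X.C.act ((FreeAdj.modeTheory S).dagger μ hμ)).map f := by
  simp only [negName, Equiv.trans_apply, Iso.homCongr_apply, Iso.refl_hom, Category.comp_id]
  rw [← Adjunction.homEquiv_naturality_right, Category.assoc]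

variable (hneg : X.C.HasNegativePreModalities (FreeAdj.modeTheory S))
  {V : X.C.functor.obj q} (E : (X.C.model q).TyOver V)

/-- A choice of type for a negative modality. -/
noncomputable def negTy :
    (X.C.model p).TyOver ((X.C.act ((FreeAdj.modeTheory S).dagger μ hμ)).obj V) :=
  (hneg μ hμ E).choose

/-- The comprehension of the chosen type for a negative modality. -/
noncomputable def negIso : (X.C.model p).ext (negTy hμ hneg E) ≅
    (X.C.act ((FreeAdj.modeTheory S).dagger μ hμ)).obj ((X.C.model q).ext E) :=
  (hneg μ hμ E).choose_spec.choose

theorem negIso_hom_p : (negIso hμ hneg E).hom ≫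
    (X.C.act ((FreeAdj.modeTheory S).dagger μ hμ)).map ((X.C.model q).p E) =
      (X.C.model p).p (negTy hμ hneg E) :=
  (hneg μ hμ E).choose_spec.choose_spec

theorem negName_comp_p {Γ : X.context.Ctx p}
    (t : (X.context.lock ((FreeAdj.modeTheory S).dagger μ hμ) ⋙ X.reflection q).obj Γ ⟶
      (X.C.model q).ext E) :
    (negName hμ Γ _ t ≫ (negIso hμ hneg E).inv) ≫ (X.C.model p).p (negTy hμ hneg E) =
      negName hμ Γ _ (t ≫ (X.C.model q).p E) := by
  rw [← negIso_hom_p, Category.assoc, Iso.inv_hom_id_assoc, negName_comp]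

/-- The action of a negative modality on types. -/
noncomputable def negOnTy :
    X.typing.TyAt ((FreeAdj.modeTheory S).dagger μ hμ) ⟶ X.typing.Ty p where
  app Γ := ↾fun A => (⟨_, negTy hμ hneg (SplitTy.ty A), negName hμ _ _ (SplitTy.name A)⟩ :
    (X.C.model p).SplitTy ((X.reflection p).obj Γ.unop))
  naturality Γ Θ σ := by
    ext A
    exact congrArg (SplitTy.mk _ _) (negName_map_comp hμ σ.unop (SplitTy.name A))

/-- The action of a negative modality on terms. -/
noncomputable def negOnTm :
    X.typing.TmAt ((FreeAdj.modeTheory S).dagger μ hμ) ⟶ X.typing.Tm p where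
  app Γ := ↾fun a => (⟨_, negTy hμ hneg (SplitTm.ty a),
    negName hμ _ _ (SplitTm.name a) ≫ (negIso hμ hneg (SplitTm.ty a)).inv⟩ :
    (X.C.model p).SplitTm ((X.reflection p).obj Γ.unop))
  naturality Γ Θ σ := by
    ext a
    exact congrArg (SplitTm.mk _ _)
      ((congrArg (· ≫ (negIso hμ hneg (SplitTm.ty a)).inv)
        (negName_map_comp hμ σ.unop (SplitTm.name a))).trans (Category.assoc _ _ _))

/-- Checked contextwise. A term on either side is a type over a local universe and a name, and the
passage on names is the bijection `negName`, corrected for terms by the invertible `negIso`. -/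
theorem isPullback_neg :
    IsPullback (negOnTm hμ hneg) (X.typing.tpAt ((FreeAdj.modeTheory S).dagger μ hμ))
      (X.typing.tp p) (negOnTy hμ hneg) := by
  refine IsPullback.of_forall_isPullback_app fun Γ => (Types.isPullback_iff ..).mpr ⟨?_, ?_, ?_⟩
  · ext a
    exact congrArg (SplitTy.mk _ _) (negName_comp_p hμ hneg _ (SplitTm.name a))
  · rintro (a : (X.C.model q).SplitTm _) (a' : (X.C.model q).SplitTm _) ⟨h, h'⟩
    -- Equal types force the two terms to share local universe and type, which their images alone
    -- would not show: the choice of `negTy` may identify different types.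
    obtain ⟨t, rfl, -⟩ := exists_of_splitting_eq h'
    have h₁ := SplitTm.name_injective h
    exact congrArg (SplitTm.mk _ _) ((negName hμ _ _).injective ((cancel_mono _).mp h₁))
  · rintro (b : (X.C.model p).SplitTm _) ⟨V, E, n⟩ h
    obtain ⟨t, rfl, ht⟩ := exists_of_splitting_eq h
    -- A term of the image type is a map to the comprehension of `negTy`, which is C_{μ†}(V.E) up to
    -- `negIso`; it therefore transposes back to a map to V.E.
    obtain ⟨t', ht'⟩ := (negName hμ Γ.unop _).surjective (t ≫ (negIso hμ hneg E).hom)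
    refine ⟨(⟨_, E, t'⟩ : (X.C.model q).SplitTm _), ?_, ?_⟩
    · refine congrArg (SplitTm.mk _ _) ?_
      rw [ht', Category.assoc, Iso.hom_inv_id, Category.comp_id]
    · refine congrArg (SplitTy.mk _ _) ((negName hμ Γ.unop _).injective ?_)
      refine (negName_comp_p hμ hneg E t').symm.trans ?_
      rw [ht', Category.assoc, Category.assoc, Iso.hom_inv_id_assoc]
      exact ht

theorem hasNegativeModalities (hneg : X.C.HasNegativePreModalities (FreeAdj.modeTheory S)) :
    HasNegativeModalities (FreeAdj.modeTheory S) X.typing :=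
  fun _ hμ => ⟨negOnTy hμ hneg, negOnTm hμ hneg, isPullback_neg hμ hneg⟩

end AdjointModalPreModel

theorem mainTheorem3 {L : Type u} [Bicategory.{w, v} L] [Strict L] (S : MorphismProperty L)
    (X : AdjointModalPreModel.{w, v, u, v₁, u₁, v₂, u₂} L S)
    (hPi : X.C.HasPrePi (FreeAdj.modeTheory S))
    (hpos : X.C.HasPositivePreModalities (FreeAdj.modeTheory S))
    (hneg : X.C.HasNegativePreModalities (FreeAdj.modeTheory S)) :
    ModelsMATT (FreeAdj.modeTheory S) X.typing :=
  ⟨X.isAdjointModalNaturalModel, ⟨AdjointModalPreModel.piStructure hPi _⟩,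
    ⟨AdjointModalPreModel.positiveModalities hpos _⟩,
    AdjointModalPreModel.hasNegativeModalities hneg⟩
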